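/- **Theorem (Linear convergence of overlapping Schwarz).** *Problem.* Let $T>0$ and consider the linear-quadratic optimal control problem $$\min_{x,u}\ \tfrac12\int_0^T \begin{bmatrix}x\\u\end{bmatrix}^{\!\top}\begin{bmatrix}Q&H^\top\\H&R\end{bmatrix}\begin{bmatrix}x\\u\end{bmatrix}dt+\tfrac12x(T)^\top Q_Tx(T)\quad\text{s.t. }\dot x=Ax+Bu,\ x(0)=x_0,$$ with $x(t)\in\mathbb R^{n_x}$, $u(t)\in\mathbb R^{n_u}$, over bounded measurable controls. A *solution* $(x,u,\lambda)$ of such a problem on an interval $[a,b]$ with initial state $p$ and terminal cost $L$ consists of the optimal pair $(x,u)$ with $u$ continuous, and its adjoint, $\dot\lambda=-A^\top\lambda-Qx-H^\top u$, $\lambda(b)=\nabla L(x(b))$. Let $(x^*,u^*,\lambda^*)$ be the solution of the full problem ($a=0$, $b=T$, $p=x_0$, $L(y)=\tfrac12y^\top Q_Ty$). *Assumptions*, with positive constants $\lambda_A,\lambda_B,\lambda_Q,\lambda_H,\lambda_R,\gamma_R,\gamma_Q,\alpha_0,\alpha_1,\beta_0,\beta_1$ and $\sigma\in(0,T)$;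 $\|\cdot\|$ is the Euclidean or operator norm and $\preceq$ the Loewner order of symmetric matrices: (1) $A,B,Q,H,R$ are continuous on $[0,T]$ with $\|A\|\le\lambda_A$, $\|B\|\le\lambda_B$, $\|Q\|\le\lambda_Q$, $\|H\|\le\lambda_H$, $\|R\|\le\lambda_R$. (2) (Uniform complete controllability.) Let $\Phi(t,s)$ be the evolution operator of $\dot x=Ax$ and $W(t_0,t_1)=\int_{t_0}^{t_1}\Phi(t_0,s)B(s)B(s)^\top\Phi(t_0,s)^\top ds$. For every $t_0\in[0,T-\sigma]$ there is $t_1\in[t_0,t_0+\sigma]$ with $\alpha_0I\preceq W(t_0,t_1)\preceq\alpha_1I$ and $\beta_0I\preceq\Phi(t_1,t_0)W(t_0,t_1)\Phi(t_1,t_0)^\top\preceq\beta_1I$. (3) (Coercivity.) $R(t)\succeq\gamma_RI$ and $Q(t)-H(t)^\top R(t)^{-1}H(t)\succeq\gamma_QI$ on $[0,T]$, and $\gamma_QI\preceq Q_T\preceq\lambda_QI$. *Algorithm.* Let $0=t_0<t_1<\dots<t_m=T$, let $\tau_j^0,\tau_j^1>0$ for $1\le j\le m$, and put $t_j^0=\max\{t_{j-1}-\tau_j^0,0\}$,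 $t_j^1=\min\{t_j+\tau_j^1,T\}$ and $\tau=\min_{1\le j\le m}\min\{\tau_j^0,\tau_j^1\}$. Assume $t_j+\tau\le T$ for all $1\le j<m$. Start with arbitrary functions $(x^{(0)},u^{(0)},\lambda^{(0)})$ on $[0,T]$ with $x^{(0)}(0)=x_0$. Given $(x^{(k)},u^{(k)},\lambda^{(k)})$, for each $j$ let $(x_j,u_j,\lambda_j)$ be the solution, in the sense above with the same $A,B,Q,H,R$, on $[t_j^0,t_j^1]$ with initial state $x^{(k)}(t_j^0)$ and terminal cost $\tfrac12y^\top Q(t_j^1)y-y^\top Q(t_j^1)q_j$, $q_j=x^{(k)}(t_j^1)-Q(t_j^1)^{-1}\lambda^{(k)}(t_j^1)$, if $j<m$, and $\tfrac12y^\top Q_Ty$ if $j=m$. Then $(x^{(k+1)},u^{(k+1)},\lambda^{(k+1)})$ equals $(x_j,u_j,\lambda_j)$ on $[t_{j-1},t_j)$ for $j<m$ and on $[t_{m-1},t_m]$ for $j=m$. *Conclusion.* Let $\omega^{(k)}\in[0,\infty]$ be the maximum of $\sup_{[0,T]}\|x^{(k)}-x^*\|$, $\sup_{[0,T]}\|u^{(k)}-u^*\|$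 and $\sup_{[0,T]}\|\lambda^{(k)}-\lambda^*\|$. Then for all $k\ge0$ $$\omega^{(k+1)}\le 3\,c(\sigma)\,e^{-\rho_Z(\sigma)\tau}\,\omega^{(k)},$$ where $c(\sigma),\rho_Z(\sigma)>0$ are the following constants, which depend only on the constants in (1)–(3) and not on $T$. With $a=\lambda_A+\lambda_B\lambda_H/\gamma_R$, $$\alpha_0'=\Big(\tfrac2{\alpha_0}+\tfrac{(\lambda_H/\gamma_R)^2}{\lambda_A}\big(1+\tfrac{\alpha_1}{\alpha_0}\big)^2(e^{2\lambda_A\sigma}-1)\Big)^{-1},\quad \alpha_1'=\tfrac{\lambda_B^2(e^{2a\sigma}-1)}{2a},\quad \tilde\alpha_0=\tfrac{1-e^{-2a\sigma}}{2a},\quad \tilde\alpha_1=\tfrac{e^{2a\sigma}-1}{2a},$$ $$c_0=e^{-2a\sigma}\min\Big\{2a\Big(\tfrac{\lambda_B^2}{\gamma_R}\big(1+\tfrac{\tilde\alpha_1}{\tilde\alpha_0}\big)^2+\tfrac1{\gamma_Q\tilde\alpha_0^2}\Big)^{-1},\ \Big(\tfrac{\lambda_B^2}{2\gamma_Ra}+\tfrac1{\gamma_Q}\Big)^{-1}\Big\},$$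 $$c_1=e^{2a\sigma}\max\Big\{\tfrac1{2a}\Big(\big(\lambda_Q+\tfrac{\lambda_H^2}{\gamma_R}\big)\big(1+\tfrac{\alpha_1'}{\alpha_0'}\big)^2+\tfrac{\lambda_R\lambda_B^2}{(\alpha_0')^2}\Big),\ \big(\lambda_Q+\tfrac{\lambda_H^2}{\gamma_R}\big)\big(1+\tfrac1{2a}\big)\Big\},$$ $$c_Z=\sqrt{c_1/c_0},\qquad \rho_Z(\sigma)=\frac{\gamma_Q}{2c_1},\qquad c(\sigma)=\Big(1+\tfrac1{\gamma_Q}\Big)\Big(1+\tfrac{\lambda_H}{\gamma_R}+\big(1+\tfrac{\lambda_B}{\gamma_R}\big)(c_1+\lambda_Q)\Big)\max\Big\{c_Z,\ \frac{c_Z^2\lambda_B^2\lambda_Q}{2\rho_Z(\sigma)\gamma_R}\Big\}.$$ -/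

import Mathlib

open Set MeasureTheory
open scoped Matrix Matrix.Norms.L2Operator MatrixOrder ENNReal

noncomputable section

namespace Schwarz

/-- `ℝⁿ` with the Euclidean norm. -/
abbrev Vec (n : ℕ) := EuclideanSpace ℝ (Fin n)

/-- Real matrices; `‖·‖` is the `ℓ²` operator norm and `≤` is the Loewner order
(`M ≤ N` iff `N - M` is symmetric positive semidefinite). -/
abbrev Mat (p q : ℕ) := Matrix (Fin p) (Fin q) ℝ

/-- The matrix-vector product on Euclidean spaces. -/
abbrev mulV {p q : ℕ} (M : Mat p q) (v : Vec q) : Vec p := Matrix.toEuclideanLin M v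

/-- The bilinear expression `vᵀ M w`. -/
def bil {p q : ℕ} (v : Vec p) (M : Mat p q) (w : Vec q) : ℝ := inner ℝ v (mulV M w)

/-! ### The linear-quadratic problem -/

/-- The coefficients of the linear-quadratic optimal control problem. Only their values on the
horizon `[0, T]` matter. -/
structure LQData (nx nu : ℕ) where
  A : ℝ → Mat nx nx
  B : ℝ → Mat nx nu
  Q : ℝ → Mat nx nx
  H : ℝ → Mat nu nx
  R : ℝ → Mat nu nu
  QT : Mat nx nx

/-- State, control and adjoint trajectories. -/
structure Trajectory (nx nu : ℕ) where
  x : ℝ → Vec nx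
  u : ℝ → Vec nu
  lam : ℝ → Vec nx

variable {nx nu : ℕ}

/-- The running cost `[x; u]ᵀ [Q Hᵀ; H R] [x; u]` at time `t`. -/
def LQData.stage (D : LQData nx nu) (t : ℝ) (x : Vec nx) (u : Vec nu) : ℝ :=
  bil x (D.Q t) x + bil x (D.H t)ᵀ u + bil u (D.H t) x + bil u (D.R t) u

/-- The cost functional on `[a, b]` with terminal cost `L`. -/
def LQData.cost (D : LQData nx nu) (a b : ℝ) (L : Vec nx → ℝ)
    (x : ℝ → Vec nx) (u : ℝ → Vec nu) : ℝ :=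
  (1 / 2) * (∫ t in a..b, D.stage t (x t) (u t)) + L (x b)

/-- Admissible pairs on `[a, b]` with initial state `p`: the control is bounded and measurable and
the state is the continuous solution of `ẋ = A x + B u`, `x(a) = p`, in integrated form. -/
structure LQData.Admissible (D : LQData nx nu) (a b : ℝ) (p : Vec nx)
    (x : ℝ → Vec nx) (u : ℝ → Vec nu) : Prop where
  control_meas : AEStronglyMeasurable u (volume.restrict (Icc a b))
  control_bdd : ∃ M : ℝ, ∀ t ∈ Icc a b, ‖u t‖ ≤ M
  state_cont : ContinuousOn x (Icc a b)
  state_eq : ∀ t ∈ Icc a b, x t = p + ∫ s in a..t, (mulV (D.A s) (x s) + mulV (D.B s) (u s))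

/-- `z = (x, u, λ)` solves the optimal control problem on `[a, b]` with initial state `p` and
terminal cost `L`: the pair `(x, u)` is an admissible minimizer with `u` its continuous
representative (an optimal control is only determined up to null sets), and `λ` is the associated
adjoint, `λ̇ = -Aᵀ λ - Q x - Hᵀ u` with `λ(b) = ∇ L (x(b))`. -/
structure LQData.IsSolution (D : LQData nx nu) (a b : ℝ) (p : Vec nx) (L : Vec nx → ℝ)
    (z : Trajectory nx nu) : Prop where
  admissible : D.Admissible a b p z.x z.u
  control_cont : ContinuousOn z.u (Icc a b)
  optimal : ∀ (x : ℝ → Vec nx) (u : ℝ → Vec nu), D.Admissible a b p x u →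
    D.cost a b L z.x z.u ≤ D.cost a b L x u
  adjoint_eq : ∀ t ∈ Icc a b,
    HasDerivWithinAt z.lam
      (-(mulV (D.A t)ᵀ (z.lam t)) - mulV (D.Q t) (z.x t) - mulV (D.H t)ᵀ (z.u t)) (Icc a b) t
  adjoint_end : z.lam b = gradient L (z.x b)

/-- The terminal cost `½ xᵀ Q_T x` of the full problem. -/
def LQData.fullTerminal (D : LQData nx nu) (y : Vec nx) : ℝ := (1 / 2) * bil y D.QT y

/-- `z` is the solution of the full problem on `[0, T]` with initial state `x0`. -/
def LQData.IsFullSolution (D : LQData nx nu) (T : ℝ) (x0 : Vec nx) (z : Trajectory nx nu) : Prop :=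
  D.IsSolution 0 T x0 D.fullTerminal z

/-! ### The assumptions -/

/-- The scalar constants of the assumptions; none of them refers to the horizon `T`. -/
structure Constants where
  lA : ℝ
  lB : ℝ
  lQ : ℝ
  lH : ℝ
  lR : ℝ
  gR : ℝ
  gQ : ℝ
  σ : ℝ
  α₀ : ℝ
  α₁ : ℝ
  β₀ : ℝ
  β₁ : ℝ

structure Constants.Positive (C : Constants) : Prop where
  lA : 0 < C.lA
  lB : 0 < C.lB
  lQ : 0 < C.lQ
  lH : 0 < C.lH
  lR : 0 < C.lR
  gR : 0 < C.gR
  gQ : 0 < C.gQ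
  σ : 0 < C.σ
  α₀ : 0 < C.α₀
  α₁ : 0 < C.α₁
  β₀ : 0 < C.β₀
  β₁ : 0 < C.β₁

/-- Continuity and boundedness of the coefficients. -/
structure LQData.Bounded (D : LQData nx nu) (T : ℝ) (C : Constants) : Prop where
  contA : ContinuousOn D.A (Icc 0 T)
  contB : ContinuousOn D.B (Icc 0 T)
  contQ : ContinuousOn D.Q (Icc 0 T)
  contH : ContinuousOn D.H (Icc 0 T)
  contR : ContinuousOn D.R (Icc 0 T)
  boundA : ∀ t ∈ Icc 0 T, ‖D.A t‖ ≤ C.lA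
  boundB : ∀ t ∈ Icc 0 T, ‖D.B t‖ ≤ C.lB
  boundQ : ∀ t ∈ Icc 0 T, ‖D.Q t‖ ≤ C.lQ
  boundH : ∀ t ∈ Icc 0 T, ‖D.H t‖ ≤ C.lH
  boundR : ∀ t ∈ Icc 0 T, ‖D.R t‖ ≤ C.lR

/-- `Φ t s` is the evolution operator of `ẋ = A x` on `[0, T]`: `∂ₜ Φ(t, s) = A(t) Φ(t, s)` and
`Φ(s, s) = I` for all `s, t` in `[0, T]` (in either order). -/
def IsEvolution (A : ℝ → Mat nx nx) (T : ℝ) (Φ : ℝ → ℝ → Mat nx nx) : Prop :=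
  ∀ s ∈ Icc 0 T, Φ s s = 1 ∧
    ∀ t ∈ Icc 0 T, HasDerivWithinAt (fun r => Φ r s) (A t * Φ t s) (Icc 0 T) t

/-- The evolution operator `Φ_A(t, s)` on `[0, T]`. For continuous `A` there is exactly one
on `[0, T] × [0, T]`. -/
def evolution (A : ℝ → Mat nx nx) (T : ℝ) : ℝ → ℝ → Mat nx nx :=
  Classical.epsilon (IsEvolution A T)

/-- The controllability Gramian `∫ Φ_A(t₀, s) B(s) B(s)ᵀ Φ_A(t₀, s)ᵀ ds` over `[t₀, t₁]`. -/
def gramian (A : ℝ → Mat nx nx) (B : ℝ → Mat nx nu) (T t₀ t₁ : ℝ) : Mat nx nx :=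
  ∫ s in t₀..t₁, evolution A T t₀ s * B s * (B s)ᵀ * (evolution A T t₀ s)ᵀ

/-- Uniform complete controllability with parameter `σ` and constants `α₀, α₁, β₀, β₁`. -/
def LQData.UCC (D : LQData nx nu) (T : ℝ) (C : Constants) : Prop :=
  ∀ t₀ ∈ Icc 0 (T - C.σ), ∃ t₁ ∈ Icc t₀ (t₀ + C.σ),
    C.α₀ • (1 : Mat nx nx) ≤ gramian D.A D.B T t₀ t₁ ∧
    gramian D.A D.B T t₀ t₁ ≤ C.α₁ • (1 : Mat nx nx) ∧
    C.β₀ • (1 : Mat nx nx) ≤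
      evolution D.A T t₁ t₀ * gramian D.A D.B T t₀ t₁ * (evolution D.A T t₁ t₀)ᵀ ∧
    evolution D.A T t₁ t₀ * gramian D.A D.B T t₀ t₁ * (evolution D.A T t₁ t₀)ᵀ ≤
      C.β₁ • (1 : Mat nx nx)

/-- Coercivity of the cost. -/
structure LQData.Coercive (D : LQData nx nu) (T : ℝ) (C : Constants) : Prop where
  R_lower : ∀ t ∈ Icc 0 T, C.gR • (1 : Mat nu nu) ≤ D.R t
  Q_lower : ∀ t ∈ Icc 0 T, C.gQ • (1 : Mat nx nx) ≤ D.Q t - (D.H t)ᵀ * (D.R t)⁻¹ * D.H t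
  QT_lower : C.gQ • (1 : Mat nx nx) ≤ D.QT
  QT_upper : D.QT ≤ C.lQ • (1 : Mat nx nx)

/-! ### The constants of the rate -/

namespace Constants

/-- `λ_A + λ_B λ_H / γ_R`, a bound for `A - B R⁻¹ H`. -/
def a (C : Constants) : ℝ := C.lA + C.lB * C.lH / C.gR

/-- Gramian lower bound for the pair `(A - B R⁻¹ H, B)`. -/
def α₀' (C : Constants) : ℝ :=
  (2 / C.α₀ + (C.lH / C.gR) ^ 2 / C.lA * (1 + C.α₁ / C.α₀) ^ 2 *
    (Real.exp (2 * C.lA * C.σ) - 1))⁻¹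

/-- Gramian upper bound for the pair `(A - B R⁻¹ H, B)`. -/
def α₁' (C : Constants) : ℝ := C.lB ^ 2 * (Real.exp (2 * C.σ * C.a) - 1) / (2 * C.a)

/-- Gramian lower bound for the dual pair `(-(A - B R⁻¹ H)ᵀ, I)`. -/
def αd₀ (C : Constants) : ℝ := 1 / (2 * C.a) * (1 - Real.exp (-2 * C.a * C.σ))

/-- Gramian upper bound for the dual pair `(-(A - B R⁻¹ H)ᵀ, I)`. -/
def αd₁ (C : Constants) : ℝ := 1 / (2 * C.a) * (Real.exp (2 * C.a * C.σ) - 1)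

/-- Lower bound for the Riccati matrix. -/
def c₀ (C : Constants) : ℝ :=
  min (2 * C.a * (C.lB ^ 2 / C.gR * (1 + C.αd₁ / C.αd₀) ^ 2 + 1 / (C.gQ * C.αd₀ ^ 2))⁻¹)
      ((C.lB ^ 2 / (2 * C.gR * C.a) + 1 / C.gQ)⁻¹)
    * Real.exp (-2 * C.a * C.σ)

/-- Upper bound for the Riccati matrix. -/
def c₁ (C : Constants) : ℝ :=
  max (((C.lQ + C.lH ^ 2 / C.gR) * (1 + C.α₁' / C.α₀') ^ 2 + C.lR * C.lB ^ 2 / C.α₀' ^ 2)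
        * (1 / (2 * C.a)))
      ((C.lQ + C.lH ^ 2 / C.gR) * (1 + 1 / (2 * C.a)))
    * Real.exp (2 * C.a * C.σ)

/-- `c_Z(σ)`. -/
def cZ (C : Constants) : ℝ := Real.sqrt (C.c₁ / C.c₀)

/-- The decay rate `ρ_Z(σ)`. -/
def ρZ (C : Constants) : ℝ := C.gQ / (2 * C.c₁)

/-- `Λ_b(σ)`, the sensitivity constant for boundary perturbations, with `λ_G = λ_Q`. -/
def Λb (C : Constants) : ℝ :=
  (1 + C.lH / C.gR + (1 + C.lB / C.gR) * (C.c₁ + C.lQ)) *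
    max C.cZ (C.cZ ^ 2 * C.lB ^ 2 * C.lQ / (2 * C.ρZ * C.gR))

/-- `c(σ)`. -/
def c (C : Constants) : ℝ := C.Λb * (1 + 1 / C.gQ)

end Constants

/-! ### The overlapping Schwarz algorithm -/

/-- A decomposition `0 = t₀ < t₁ < ⋯ < t_m = T` with overlap sizes. The index `j : Fin m` stands
for the subdomain number `j + 1`, that is `[t_j, t_{j+1}]`. -/
structure Decomposition (T : ℝ) (m : ℕ) where
  t : Fin (m + 1) → ℝ
  t_first : t 0 = 0
  t_last : t (Fin.last m) = T
  t_mono : StrictMono t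
  τ₀ : Fin m → ℝ
  τ₁ : Fin m → ℝ
  τ₀_pos : ∀ j, 0 < τ₀ j
  τ₁_pos : ∀ j, 0 < τ₁ j

namespace Decomposition

variable {T : ℝ} {m : ℕ}

/-- Left end of the overlapping subdomain. -/
def left (P : Decomposition T m) (j : Fin m) : ℝ := max (P.t j.castSucc - P.τ₀ j) 0

/-- Right end of the overlapping subdomain. -/
def right (P : Decomposition T m) (j : Fin m) : ℝ := min (P.t j.succ + P.τ₁ j) T

/-- The smallest overlap size (a minimum over the finite nonempty set of subdomains). -/
def τ (P : Decomposition T m) : ℝ := ⨅ j : Fin m, min (P.τ₀ j) (P.τ₁ j)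

/-- The set of times at which the aggregated iterate is taken from subdomain `j`. -/
def piece (P : Decomposition T m) (j : Fin m) : Set ℝ :=
  if (j : ℕ) + 1 = m then Icc (P.t j.castSucc) (P.t j.succ)
  else Ico (P.t j.castSucc) (P.t j.succ)

end Decomposition

variable {T : ℝ} {m : ℕ}

/-- The terminal cost of the `j`-th subproblem with boundary parameter `q`. -/
def LQData.subTerminal (D : LQData nx nu) (P : Decomposition T m) (j : Fin m) (q : Vec nx)
    (y : Vec nx) : ℝ :=
  if (j : ℕ) + 1 = m then (1 / 2) * bil y D.QT y
  else (1 / 2) * bil y (D.Q (P.right j)) y - bil y (D.Q (P.right j)) q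

/-- `z` solves the `j`-th subproblem with boundary parameters `p, q`. -/
def LQData.IsSubSolution (D : LQData nx nu) (P : Decomposition T m) (j : Fin m)
    (p q : Vec nx) (z : Trajectory nx nu) : Prop :=
  D.IsSolution (P.left j) (P.right j) p (D.subTerminal P j q) z

/-- One iteration of the overlapping Schwarz algorithm: on every subdomain solve the subproblem
with boundary parameters read off the current iterate, and concatenate. -/
def LQData.SchwarzStep (D : LQData nx nu) (P : Decomposition T m)
    (cur next : Trajectory nx nu) : Prop :=
  ∀ j : Fin m, ∃ z : Trajectory nx nu,
    D.IsSubSolution P j (cur.x (P.left j))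
      (cur.x (P.right j) - mulV (D.Q (P.right j))⁻¹ (cur.lam (P.right j))) z ∧
    ∀ t ∈ P.piece j, next.x t = z.x t ∧ next.u t = z.u t ∧ next.lam t = z.lam t

/-- `z k`, `k = 0, 1, 2, …`, are the iterates of the algorithm started from some `z 0` whose state
has the prescribed initial value. -/
structure LQData.IsSchwarzRun (D : LQData nx nu) (P : Decomposition T m) (x0 : Vec nx)
    (z : ℕ → Trajectory nx nu) : Prop where
  init : (z 0).x 0 = x0
  step : ∀ k, D.SchwarzStep P (z k) (z (k + 1))

/-- `‖f‖_∞` over `[0, T]`, as an extended nonnegative real. -/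
def supNorm {n : ℕ} (T : ℝ) (f : ℝ → Vec n) : ℝ≥0∞ := ⨆ t ∈ Icc 0 T, ‖f t‖ₑ

/-- The error `ω`: the maximum of the sup-norm errors in state, control and adjoint. -/
def omega (T : ℝ) (z zs : Trajectory nx nu) : ℝ≥0∞ :=
  max (supNorm T (fun t => z.x t - zs.x t))
    (max (supNorm T (fun t => z.u t - zs.u t)) (supNorm T (fun t => z.lam t - zs.lam t)))

end Schwarz

end

noncomputable section

namespace Schwarz

open scoped NNReal InnerProductSpace

/-!
The error of a subproblem solution is again an extremal: state `x` and adjoint `λ` solve the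
homogeneous Hamiltonian system obtained by eliminating the control through
`R u = -(H x + Bᵀ λ)`, with a prescribed `x(a)` and with `λ(b) = G x(b) + r` for a residual `r` read
off the boundary data. If `r = 0`, then `V = ⟪λ, x⟫` is twice the optimal cost to go. It is at most
`c₁ ‖x‖²`, since controllability provides a cheap competitor that is steered to zero, and at least
`c₀ ‖x‖²`, since the dual system, with the identity as input operator, is controllable. As
`V' ≤ -γ_Q ‖x‖²`, the state decays like `c_Z exp(-ρ_Z (t - a)) ‖x(a)‖`. A residual `r ≠ 0` is
absorbed by a Riccati operator and propagates backwards along the adjoint of this exponentially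
stable flow, so it enters with the factor `exp(-ρ_Z (b - t))`. On the part of a subdomain that is
kept, both boundaries are at distance at least `τ`, hence the factor `exp(-ρ_Z τ)`.
-/

/-! ### Ordinary differential equations and differential inequalities -/

section ODE

variable {F : Type*} [NormedAddCommGroup F] [NormedSpace ℝ F] {a b : ℝ}

lemma hasDerivWithinAt_Ici_of_Icc {f : ℝ → F} {f' : F} {t : ℝ}
    (h : HasDerivWithinAt f f' (Icc a b) t) (ht : t ∈ Ico a b) :
    HasDerivWithinAt f f' (Ici t) t := by
  refine h.mono_of_mem_nhdsWithin ?_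
  filter_upwards [Ico_mem_nhdsGE ht.2] with s hs
  exact ⟨ht.1.trans hs.1, hs.2.le⟩

lemma sub_le_sub_of_hasDerivWithinAt_le {f g f' g' : ℝ → ℝ} (hab : a ≤ b)
    (hf : ∀ t ∈ Icc a b, HasDerivWithinAt f (f' t) (Icc a b) t)
    (hg : ∀ t ∈ Icc a b, HasDerivWithinAt g (g' t) (Icc a b) t)
    (hle : ∀ t ∈ Icc a b, f' t ≤ g' t) : f b - f a ≤ g b - g a := by
  have hderiv : ∀ t ∈ Icc a b, HasDerivWithinAt (g - f) (g' t - f' t) (Icc a b) t :=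
    fun t ht => (hg t ht).sub (hf t ht)
  have hmono : MonotoneOn (g - f) (Icc a b) :=
    monotoneOn_of_hasDerivWithinAt_nonneg (convex_Icc a b)
      (fun t ht => (hderiv t ht).continuousWithinAt)
      (fun t ht => (hderiv t (interior_subset ht)).mono interior_subset)
      (fun t ht => sub_nonneg.2 (hle t (interior_subset ht)))
  have hincr : g a - f a ≤ g b - f b := hmono (left_mem_Icc.2 hab) (right_mem_Icc.2 hab) hab
  linarith

lemma eq_of_hasDerivWithinAt_zero {f : ℝ → F}
    (hf : ∀ t ∈ Icc a b, HasDerivWithinAt f 0 (Icc a b) t) {s t : ℝ} (hs : s ∈ Icc a b)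
    (ht : t ∈ Icc a b) : f s = f t := by
  have h := (convex_Icc a b).norm_image_sub_le_of_norm_hasDerivWithin_le
    (f := f) (f' := fun _ => 0) (C := 0) hf (by simp) ht hs
  simpa [sub_eq_zero] using h

lemma norm_le_mul_exp_of_norm_deriv_le {y y' : ℝ → F} {k : ℝ}
    (hy : ∀ t ∈ Icc a b, HasDerivWithinAt y (y' t) (Icc a b) t)
    (hk : ∀ t ∈ Icc a b, ‖y' t‖ ≤ k * ‖y t‖) {t : ℝ} (ht : t ∈ Icc a b) :
    ‖y t‖ ≤ ‖y a‖ * Real.exp (k * (t - a)) := by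
  rw [← gronwallBound_ε0]
  exact norm_le_gronwallBound_of_norm_deriv_right_le (f' := y')
    (fun s hs => (hy s hs).continuousWithinAt)
    (fun s hs => hasDerivWithinAt_Ici_of_Icc (hy s (Ico_subset_Icc_self hs)) hs) le_rfl
    (fun s hs => by simpa using hk s (Ico_subset_Icc_self hs)) t ht

lemma hasDerivWithinAt_comp_reflect {f : ℝ → F} {f' : F} {t : ℝ}
    (h : HasDerivWithinAt f f' (Icc a b) (a + b - t)) :
    HasDerivWithinAt (fun s => f (a + b - s)) (-f') (Icc a b) t := by
  have hreflect : HasDerivWithinAt (fun s : ℝ => a + b - s) (-1) (Icc a b) t :=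
    (hasDerivWithinAt_id t (Icc a b)).const_sub (a + b)
  simpa only [Function.comp_def, neg_smul, one_smul] using
    h.scomp t hreflect fun s hs => ⟨by linarith [hs.2], by linarith [hs.1]⟩

lemma hasDerivWithinAt_integral [CompleteSpace F] {g : ℝ → F} (hg : ContinuousOn g (Icc a b))
    {t : ℝ} (ht : t ∈ Icc a b) :
    HasDerivWithinAt (fun s => ∫ r in a..s, g r) (g t) (Icc a b) t := by
  have : Fact (t ∈ Icc a b) := ⟨ht⟩
  exact intervalIntegral.integral_hasDerivWithinAt_right
    (hg.mono (uIcc_subset_Icc ⟨le_rfl, ht.1.trans ht.2⟩ ht)).intervalIntegrable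
    (hg.stronglyMeasurableAtFilter_nhdsWithin measurableSet_Icc t) (hg t ht)

lemma integral_eq_sub_of_hasDerivWithinAt_Icc [CompleteSpace F] {f g : ℝ → F}
    (hg : ContinuousOn g (Icc a b)) (hf : ∀ s ∈ Icc a b, HasDerivWithinAt f (g s) (Icc a b) s)
    {t : ℝ} (ht : t ∈ Icc a b) : ∫ r in a..t, g r = f t - f a := by
  have hsub : Icc a t ⊆ Icc a b := Icc_subset_Icc_right ht.2
  refine intervalIntegral.integral_eq_sub_of_hasDeriv_right_of_le ht.1
    (fun s hs => ((hf s (hsub hs)).mono hsub).continuousWithinAt)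
    (fun s hs => ?_) ((hg.mono hsub).intervalIntegrable_of_Icc ht.1)
  exact (hasDerivWithinAt_Ici_of_Icc (hf s (hsub (Ioo_subset_Icc_self hs)))
    ⟨hs.1.le, hs.2.trans_le ht.2⟩).mono Ioi_subset_Ici_self

/-- The radial retraction onto the closed ball of radius `r > 0`, used to truncate a vector field
outside a ball that contains all solutions. -/
def radialRetraction (r : ℝ) (x : F) : F := (r / max r ‖x‖) • x

variable {r : ℝ}

lemma norm_radialRetraction (hr : 0 < r) (x : F) :
    ‖radialRetraction r x‖ = r / max r ‖x‖ * ‖x‖ := by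
  have : 0 < max r ‖x‖ := lt_max_of_lt_left hr
  rw [radialRetraction, norm_smul, Real.norm_of_nonneg (by positivity)]

lemma norm_radialRetraction_le_radius (hr : 0 < r) (x : F) : ‖radialRetraction r x‖ ≤ r := by
  rw [norm_radialRetraction hr, div_mul_eq_mul_div, div_le_iff₀ (lt_max_of_lt_left hr)]
  exact mul_le_mul_of_nonneg_left (le_max_right _ _) hr.le

lemma norm_radialRetraction_le_norm (hr : 0 < r) (x : F) : ‖radialRetraction r x‖ ≤ ‖x‖ := by
  rw [norm_radialRetraction hr]
  exact mul_le_of_le_one_left (norm_nonneg x)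
    (div_le_one_of_le₀ (le_max_left _ _) (lt_max_of_lt_left hr).le)

lemma radialRetraction_of_norm_le (hr : 0 < r) {x : F} (hx : ‖x‖ ≤ r) :
    radialRetraction r x = x := by
  rw [radialRetraction, max_eq_left hx, div_self hr.ne', one_smul]

lemma lipschitzWith_radialRetraction (hr : 0 < r) :
    LipschitzWith 2 (radialRetraction r : F → F) := by
  refine LipschitzWith.of_dist_le_mul fun x y => ?_
  rw [dist_eq_norm, dist_eq_norm, NNReal.coe_ofNat]
  set p := max r ‖x‖ with hp
  set q := max r ‖y‖ with hq
  have hp0 : 0 < p := lt_max_of_lt_left hr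
  have hq0 : 0 < q := lt_max_of_lt_left hr
  have hrp : r / p ≤ 1 := div_le_one_of_le₀ (le_max_left _ _) hp0.le
  have hyq : ‖y‖ / q ≤ 1 := div_le_one_of_le₀ (le_max_right _ _) hq0.le
  have hsplit : radialRetraction r x - radialRetraction r y
      = (r / p) • ((x - y) + ((q - p) / q) • y) := by
    have hcoef : r / p * ((q - p) / q) = r / p - r / q := by field_simp
    rw [radialRetraction, radialRetraction, smul_add, smul_sub, smul_smul, hcoef, sub_smul]
    abel
  have hradii : |q - p| ≤ ‖x - y‖ := by
    rw [hp, hq, max_comm r, max_comm r, norm_sub_rev x y]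
    exact (abs_max_sub_max_le_abs _ _ _).trans (abs_norm_sub_norm_le y x)
  have hsecond : ‖((q - p) / q) • y‖ ≤ ‖x - y‖ := by
    rw [norm_smul, norm_div, Real.norm_eq_abs, Real.norm_of_nonneg hq0.le, div_mul_eq_mul_div,
      mul_div_assoc]
    exact (mul_le_of_le_one_right (abs_nonneg _) hyq).trans hradii
  calc ‖radialRetraction r x - radialRetraction r y‖
      = r / p * ‖(x - y) + ((q - p) / q) • y‖ := by
        rw [hsplit, norm_smul, Real.norm_of_nonneg (by positivity)]
    _ ≤ 1 * (‖x - y‖ + ‖((q - p) / q) • y‖) := by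
        gcongr
        exact norm_add_le _ _
    _ ≤ 2 * ‖x - y‖ := by linarith

variable [CompleteSpace F]

lemma exists_solution_of_lipschitz_of_bounded (hab : a ≤ b) {f : ℝ → F → F} {K L : ℝ≥0}
    (hlip : ∀ t ∈ Icc a b, LipschitzWith K (f t))
    (hcont : ∀ x, ContinuousOn (fun t => f t x) (Icc a b))
    (hbound : ∀ t ∈ Icc a b, ∀ x, ‖f t x‖ ≤ L) (x₀ : F) :
    ∃ x : ℝ → F, x a = x₀ ∧ ∀ t ∈ Icc a b, HasDerivWithinAt x (f t (x t)) (Icc a b) t := by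
  have hpl : IsPicardLindelof f (⟨a, left_mem_Icc.2 hab⟩ : Icc a b) x₀
      (L * ⟨b - a, sub_nonneg.2 hab⟩) 0 L K :=
    { lipschitzOnWith := fun t ht => (hlip t ht).lipschitzOnWith
      continuousOn := fun x _ => hcont x
      norm_le := fun t ht x _ => hbound t ht x
      mul_max_le := by
        rw [max_eq_left (by simpa using hab), NNReal.coe_zero, sub_zero]
        exact le_rfl }
  exact hpl.exists_eq_forall_mem_Icc_hasDerivWithinAt₀

theorem exists_solution_of_lipschitz (hab : a ≤ b) {f : ℝ → F → F} {K : ℝ≥0}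
    (hlip : ∀ t ∈ Icc a b, LipschitzWith K (f t))
    (hcont : ∀ x, ContinuousOn (fun t => f t x) (Icc a b)) (x₀ : F) :
    ∃ x : ℝ → F, x a = x₀ ∧ ∀ t ∈ Icc a b, HasDerivWithinAt x (f t (x t)) (Icc a b) t := by
  obtain ⟨M, hM⟩ := isCompact_Icc.exists_bound_of_continuousOn (hcont 0)
  have hM0 : 0 ≤ M := (norm_nonneg _).trans (hM a (left_mem_Icc.2 hab))
  have hgrowth : ∀ t ∈ Icc a b, ∀ x, ‖f t x‖ ≤ K * ‖x‖ + M := by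
    intro t ht x
    have hdist := (hlip t ht).dist_le_mul x 0
    rw [dist_eq_norm, dist_zero_right] at hdist
    linarith [norm_le_norm_add_norm_sub' (f t x) (f t 0), hM t ht]
  -- Every solution stays strictly inside this ball, so truncating outside it changes nothing.
  set r : ℝ := gronwallBound ‖x₀‖ K M (b - a) + 1 with hr_def
  have hmono := gronwallBound_mono (norm_nonneg x₀) hM0 K.coe_nonneg
  have hr : 0 < r := by
    have := hmono (sub_nonneg.2 hab)
    rw [gronwallBound_x0] at this
    linarith [norm_nonneg x₀, hr_def]
  obtain ⟨x, hxa, hx⟩ := exists_solution_of_lipschitz_of_bounded hab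
    (f := fun t x => f t (radialRetraction r x)) (L := ⟨K * r + M, by positivity⟩)
    (fun t ht => (hlip t ht).comp (lipschitzWith_radialRetraction hr)) (fun x => hcont _)
    (fun t ht x => (hgrowth t ht _).trans
      (add_le_add_left (mul_le_mul_of_nonneg_left (norm_radialRetraction_le_radius hr x)
        K.coe_nonneg) M)) x₀
  refine ⟨x, hxa, fun t ht => ?_⟩
  have hxt : ‖x t‖ ≤ gronwallBound ‖x₀‖ K M (t - a) :=
    norm_le_gronwallBound_of_norm_deriv_right_le (fun s hs => (hx s hs).continuousWithinAt)
      (fun s hs => hasDerivWithinAt_Ici_of_Icc (hx s (Ico_subset_Icc_self hs)) hs)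
      (by rw [hxa])
      (fun s hs => (hgrowth s (Ico_subset_Icc_self hs) _).trans
        (by gcongr; exact norm_radialRetraction_le_norm hr (x s))) t ht
  have hxr : ‖x t‖ ≤ r := by linarith [hmono (sub_le_sub_right ht.2 a)]
  simpa only [radialRetraction_of_norm_le hr hxr] using hx t ht

theorem exists_linear_solution (hab : a ≤ b) {M : ℝ → F →L[ℝ] F} {g : ℝ → F}
    (hM : ContinuousOn M (Icc a b)) (hg : ContinuousOn g (Icc a b)) (x₀ : F) :
    ∃ x : ℝ → F, x a = x₀ ∧ ∀ t ∈ Icc a b, HasDerivWithinAt x (M t (x t) + g t) (Icc a b) t := by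
  obtain ⟨K, hK⟩ := isCompact_Icc.exists_bound_of_continuousOn hM
  have hK0 : 0 ≤ K := (norm_nonneg _).trans (hK a (left_mem_Icc.2 hab))
  refine exists_solution_of_lipschitz hab (f := fun t x => M t x + g t) (K := ⟨K, hK0⟩)
    (fun t ht => LipschitzWith.of_dist_le_mul fun x y => ?_)
    (fun x => (hM.clm_apply continuousOn_const).add hg) x₀
  rw [dist_add_right, dist_eq_norm, dist_eq_norm, ← map_sub]
  exact (M t).le_of_opNorm_le (hK t ht) _

theorem exists_homogeneous_linear_solution (hab : a ≤ b) {M : ℝ → F →L[ℝ] F}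
    (hM : ContinuousOn M (Icc a b)) (x₀ : F) :
    ∃ x : ℝ → F, x a = x₀ ∧ ∀ t ∈ Icc a b, HasDerivWithinAt x (M t (x t)) (Icc a b) t := by
  simpa using exists_linear_solution hab hM (g := fun _ => 0) continuousOn_const x₀

theorem exists_homogeneous_linear_solution_right (hab : a ≤ b) {M : ℝ → F →L[ℝ] F}
    (hM : ContinuousOn M (Icc a b)) (x₁ : F) :
    ∃ x : ℝ → F, x b = x₁ ∧ ∀ t ∈ Icc a b, HasDerivWithinAt x (M t (x t)) (Icc a b) t := by
  have hmaps : MapsTo (fun t => a + b - t) (Icc a b) (Icc a b) :=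
    fun s hs => ⟨by linarith [hs.2], by linarith [hs.1]⟩
  obtain ⟨x, hxa, hx⟩ := exists_homogeneous_linear_solution hab
    (M := fun t => -M (a + b - t)) (hM.comp (by fun_prop) hmaps).neg x₁
  refine ⟨fun t => x (a + b - t), by simpa using hxa, fun t ht => ?_⟩
  simpa using hasDerivWithinAt_comp_reflect (hx _ (hmaps ht))

lemma hasDerivWithinAt_ringInverse {R : Type*} [NormedRing R] [NormedAlgebra ℝ R] [CompleteSpace R]
    {f : ℝ → R} {f' : R} {s : Set ℝ} {t : ℝ} (hf : HasDerivWithinAt f f' s t)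
    (hu : IsUnit (f t)) :
    HasDerivWithinAt (fun r => Ring.inverse (f r))
      (-(Ring.inverse (f t) * f' * Ring.inverse (f t))) s t := by
  obtain ⟨u, hu⟩ := hu
  have hinv := hasFDerivAt_ringInverse (𝕜 := ℝ) u
  rw [hu] at hinv
  rw [← hu, Ring.inverse_unit]
  simpa [Function.comp_def] using hinv.comp_hasDerivWithinAt t hf

end ODE

/-! ### Scalar estimates for the constants -/

namespace Constants

variable {C : Constants}

lemma Positive.a_pos (h : C.Positive) : 0 < C.a := by
  have := h.lA; have := h.lB; have := h.lH; have := h.gR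
  unfold a
  positivity

lemma Positive.lA_le_a (h : C.Positive) : C.lA ≤ C.a :=
  le_add_of_nonneg_right (div_nonneg (mul_nonneg h.lB.le h.lH.le) h.gR.le)

lemma Positive.exp_sub_one_pos (h : C.Positive) {k : ℝ} (hk : 0 < k) :
    0 < Real.exp (2 * k * C.σ) - 1 := by
  have := h.σ
  exact sub_pos.2 (Real.one_lt_exp_iff.2 (by positivity))

lemma Positive.αd₀_pos (h : C.Positive) : 0 < C.αd₀ := by
  have hexp : Real.exp (-2 * C.a * C.σ) < 1 :=
    Real.exp_lt_one_iff.2 (by linarith [mul_pos h.a_pos h.σ])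
  exact mul_pos (one_div_pos.2 (mul_pos two_pos h.a_pos)) (sub_pos.2 hexp)

lemma Positive.αd₁_pos (h : C.Positive) : 0 < C.αd₁ :=
  mul_pos (one_div_pos.2 (mul_pos two_pos h.a_pos)) (h.exp_sub_one_pos h.a_pos)

lemma Positive.α₁'_pos (h : C.Positive) : 0 < C.α₁' := by
  have := h.lB; have := h.a_pos; have := h.exp_sub_one_pos h.a_pos
  unfold α₁'
  rw [mul_right_comm]
  positivity

lemma Positive.c₀_pos (h : C.Positive) : 0 < C.c₀ := by
  have := h.gR; have := h.gQ; have := h.a_pos; have := h.αd₀_pos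
  unfold c₀
  positivity

lemma Positive.c₁_pos (h : C.Positive) : 0 < C.c₁ := by
  have := h.lQ; have := h.gR; have := h.a_pos
  unfold c₁
  positivity

lemma Positive.ρZ_pos (h : C.Positive) : 0 < C.ρZ :=
  div_pos h.gQ (mul_pos two_pos h.c₁_pos)

lemma Positive.cZ_pos (h : C.Positive) : 0 < C.cZ :=
  Real.sqrt_pos.2 (div_pos h.c₁_pos h.c₀_pos)

lemma Positive.Λb_pos (h : C.Positive) : 0 < C.Λb := by
  have := h.cZ_pos; have := h.c₁_pos; have := h.lQ; have := h.lH; have := h.lB; have := h.gR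
  unfold Λb
  positivity

lemma Positive.c_pos (h : C.Positive) : 0 < C.c := by
  have := h.Λb_pos; have := h.gQ
  unfold c
  positivity

lemma Positive.exp_sub_one_div_mono (h : C.Positive) :
    (Real.exp (2 * C.lA * C.σ) - 1) / (2 * C.lA) ≤ (Real.exp (2 * C.a * C.σ) - 1) / (2 * C.a) := by
  have hA := h.lA; have ha := h.a_pos; have hσ := h.σ; have hle := h.lA_le_a
  have hsecant := convexOn_exp.secant_mono (a := 0) (x := 2 * C.lA * C.σ) (y := 2 * C.a * C.σ)
    (mem_univ _) (mem_univ _) (mem_univ _) (by positivity) (by positivity) (by gcongr)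
  simp only [Real.exp_zero, sub_zero] at hsecant
  rw [← div_div _ (2 * C.lA), ← div_div _ (2 * C.a)] at hsecant
  exact (div_le_div_iff_of_pos_right hσ).1 hsecant

lemma exp_neg_two_a_σ : Real.exp (-2 * C.a * C.σ) = (Real.exp (2 * C.a * C.σ))⁻¹ := by
  rw [← Real.exp_neg]
  congr 1
  ring

/-- Here and below, `far` refers to a remaining horizon of at least `σ` and `near` to a shorter one;
the two cases are the two entries of the minimum in `c₀` and of the maximum in `c₁`. -/
lemma Positive.far_le_inv_c₀ (h : C.Positive) :
    (C.lB ^ 2 / C.gR * (1 + C.αd₁ / C.αd₀) ^ 2 + 1 / (C.gQ * C.αd₀ ^ 2))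
      * (Real.exp (2 * C.a * C.σ) / (2 * C.a)) ≤ 1 / C.c₀ := by
  have ha := h.a_pos; have := h.gQ; have := h.gR; have := h.αd₀_pos
  set q := C.lB ^ 2 / C.gR * (1 + C.αd₁ / C.αd₀) ^ 2 + 1 / (C.gQ * C.αd₀ ^ 2)
  have hq : 0 < q := by positivity
  have hc₀ : C.c₀ ≤ 2 * C.a * q⁻¹ * (Real.exp (2 * C.a * C.σ))⁻¹ := by
    unfold c₀
    rw [exp_neg_two_a_σ]
    gcongr
    exact min_le_left _ _
  calc q * (Real.exp (2 * C.a * C.σ) / (2 * C.a))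
      = 1 / (2 * C.a * q⁻¹ * (Real.exp (2 * C.a * C.σ))⁻¹) := by field_simp
    _ ≤ 1 / C.c₀ := one_div_le_one_div_of_le h.c₀_pos hc₀

lemma Positive.near_le_inv_c₀ (h : C.Positive) :
    Real.exp (2 * C.a * C.σ) / C.gQ
      + C.lB ^ 2 / C.gR * (Real.exp (2 * C.a * C.σ) / (2 * C.a)) ≤ 1 / C.c₀ := by
  have ha := h.a_pos; have := h.gQ; have := h.gR
  set q := C.lB ^ 2 / (2 * C.gR * C.a) + 1 / C.gQ with hq_def
  have hq : 0 < q := by positivity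
  have hc₀ : C.c₀ ≤ q⁻¹ * (Real.exp (2 * C.a * C.σ))⁻¹ := by
    unfold c₀
    rw [exp_neg_two_a_σ]
    gcongr
    exact min_le_right _ _
  calc Real.exp (2 * C.a * C.σ) / C.gQ + C.lB ^ 2 / C.gR * (Real.exp (2 * C.a * C.σ) / (2 * C.a))
      = q * Real.exp (2 * C.a * C.σ) := by rw [hq_def]; field_simp; ring
    _ = 1 / (q⁻¹ * (Real.exp (2 * C.a * C.σ))⁻¹) := by field_simp
    _ ≤ 1 / C.c₀ := one_div_le_one_div_of_le h.c₀_pos hc₀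

lemma Positive.αd₀_le_σ (h : C.Positive) : C.αd₀ ≤ C.σ := by
  unfold αd₀
  rw [one_div_mul_eq_div, div_le_iff₀ (mul_pos two_pos h.a_pos)]
  linarith [Real.add_one_le_exp (-2 * C.a * C.σ)]

lemma Positive.αd₀_le_inv_two_a (h : C.Positive) : C.αd₀ ≤ 1 / (2 * C.a) :=
  mul_le_of_le_one_right (one_div_nonneg.2 (mul_pos two_pos h.a_pos).le)
    (sub_le_self 1 (Real.exp_pos _).le)

lemma Positive.αd₀_sq_mul_le (h : C.Positive) : C.αd₀ ^ 2 * (2 * C.a) ≤ C.σ := by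
  have ha := h.a_pos; have hd := h.αd₀_pos; have hσ := h.σ
  calc C.αd₀ ^ 2 * (2 * C.a) = C.αd₀ * C.αd₀ * (2 * C.a) := by rw [sq]
    _ ≤ C.σ * (1 / (2 * C.a)) * (2 * C.a) := by
      gcongr
      exacts [h.αd₀_le_σ, h.αd₀_le_inv_two_a]
    _ = C.σ := by field_simp

lemma Positive.quadratic_le_exp (h : C.Positive) :
    1 + 2 * C.a * C.σ + 2 * (C.a * C.σ) ^ 2 ≤ Real.exp (2 * C.a * C.σ) := by
  have := mul_pos h.a_pos h.σ
  linarith [Real.quadratic_le_exp_of_nonneg (x := 2 * C.a * C.σ) (by linarith)]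

lemma Positive.dual_state_cost_le (h : C.Positive) :
    C.σ * ((1 / C.σ + C.a) ^ 2 / C.gQ)
      ≤ 1 / (C.gQ * C.αd₀ ^ 2) * (Real.exp (2 * C.a * C.σ) / (2 * C.a)) := by
  have ha := h.a_pos; have hσ := h.σ; have hQ := h.gQ; have hd := h.αd₀_pos
  calc C.σ * ((1 / C.σ + C.a) ^ 2 / C.gQ)
      = (1 + 2 * C.a * C.σ + (C.a * C.σ) ^ 2) / (C.gQ * C.σ) := by field_simp; ring
    _ ≤ Real.exp (2 * C.a * C.σ) / (C.gQ * (C.αd₀ ^ 2 * (2 * C.a))) := by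
      gcongr
      · linarith [h.quadratic_le_exp, sq_nonneg (C.a * C.σ)]
      · exact h.αd₀_sq_mul_le
    _ = 1 / (C.gQ * C.αd₀ ^ 2) * (Real.exp (2 * C.a * C.σ) / (2 * C.a)) := by field_simp

lemma Positive.dual_control_cost_le (h : C.Positive) :
    C.σ * (C.lB ^ 2 / C.gR) ≤ C.lB ^ 2 / C.gR * (1 + C.αd₁ / C.αd₀) ^ 2
      * (Real.exp (2 * C.a * C.σ) / (2 * C.a)) := by
  have ha := h.a_pos; have := h.σ; have := h.gR; have := h.αd₀_pos; have := h.αd₁_pos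
  have hσ : C.σ ≤ Real.exp (2 * C.a * C.σ) / (2 * C.a) := by
    rw [le_div_iff₀ (by positivity)]
    linarith [h.quadratic_le_exp, sq_nonneg (C.a * C.σ)]
  have hratio : (1 : ℝ) ≤ (1 + C.αd₁ / C.αd₀) ^ 2 :=
    one_le_pow₀ (le_add_of_nonneg_right (by positivity))
  calc C.σ * (C.lB ^ 2 / C.gR)
      ≤ Real.exp (2 * C.a * C.σ) / (2 * C.a) * (C.lB ^ 2 / C.gR * (1 + C.αd₁ / C.αd₀) ^ 2) := by
        gcongr
        exact le_mul_of_one_le_right (by positivity) hratio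
    _ = _ := mul_comm _ _

lemma Positive.dual_cost_le_inv_c₀ (h : C.Positive) :
    C.σ * ((1 / C.σ + C.a) ^ 2 / C.gQ + C.lB ^ 2 / C.gR) ≤ 1 / C.c₀ := by
  refine le_trans ?_ h.far_le_inv_c₀
  rw [mul_add, add_mul, add_comm]
  exact add_le_add h.dual_control_cost_le h.dual_state_cost_le

lemma Positive.near_le_c₁ (h : C.Positive) :
    C.lQ * (Real.exp (2 * C.a * C.σ) + Real.exp (2 * C.a * C.σ) / (2 * C.a)) ≤ C.c₁ := by
  have := h.a_pos; have := h.lQ; have := h.gR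
  have hQH : C.lQ ≤ C.lQ + C.lH ^ 2 / C.gR := le_add_of_nonneg_right (by positivity)
  calc C.lQ * (Real.exp (2 * C.a * C.σ) + Real.exp (2 * C.a * C.σ) / (2 * C.a))
      = C.lQ * (1 + 1 / (2 * C.a)) * Real.exp (2 * C.a * C.σ) := by ring
    _ ≤ (C.lQ + C.lH ^ 2 / C.gR) * (1 + 1 / (2 * C.a)) * Real.exp (2 * C.a * C.σ) := by gcongr
    _ ≤ C.c₁ := by
      unfold c₁
      gcongr
      exact le_max_right _ _

/-- Growth constant of the running cost along a trajectory steered to the origin by the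
minimum-energy control: the cost rate at time `t` is at most `steerCost * exp (2 a (t - t₀))` times
the squared norm of the initial state. -/
def steerCost (C : Constants) : ℝ :=
  C.lQ * (C.α₁' / C.α₀) ^ 2
    + C.lR * (2 * (C.lB / C.α₀) ^ 2 + 2 * (C.lH / C.gR * (C.α₁ / C.α₀)) ^ 2)

lemma Positive.steerCost_pos (h : C.Positive) : 0 < C.steerCost := by
  have := h.lQ; have := h.lR; have := h.lB; have := h.α₀; have := h.α₁'_pos
  unfold steerCost
  positivity

lemma inv_α₀'_eq : 1 / C.α₀' = 2 / C.α₀ + 2 * (C.lH / C.gR) ^ 2 * (1 + C.α₁ / C.α₀) ^ 2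
    * ((Real.exp (2 * C.lA * C.σ) - 1) / (2 * C.lA)) := by
  unfold α₀'
  rw [one_div, inv_inv]
  congr 1
  ring

lemma Positive.two_div_α₀_le_inv_α₀' (h : C.Positive) : 2 / C.α₀ ≤ 1 / C.α₀' := by
  have := h.lA; have := h.exp_sub_one_pos h.lA
  rw [inv_α₀'_eq]
  exact le_add_of_nonneg_right (by positivity)

lemma Positive.α₁'_div_α₀_le (h : C.Positive) : C.α₁' / C.α₀ ≤ 1 + C.α₁' / C.α₀' := by
  have := h.α₀; have := h.α₁'_pos
  have hle := mul_le_mul_of_nonneg_left h.two_div_α₀_le_inv_α₀' h.α₁'_pos.le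
  have hpos : 0 < C.α₁' / C.α₀ := by positivity
  calc C.α₁' / C.α₀ ≤ C.α₁' * (2 / C.α₀) := by
        rw [mul_div_left_comm]
        linarith
    _ ≤ C.α₁' * (1 / C.α₀') := hle
    _ ≤ 1 + C.α₁' / C.α₀' := by
        rw [mul_one_div]
        linarith

lemma Positive.sq_lH_ratio_le (h : C.Positive)
    (hα : C.α₀ ≤ C.lB ^ 2 * ((Real.exp (2 * C.lA * C.σ) - 1) / (2 * C.lA))) :
    (C.lH / C.gR * (C.α₁ / C.α₀)) ^ 2 ≤ C.lB ^ 2 * (2 * (C.lH / C.gR) ^ 2 * (1 + C.α₁ / C.α₀) ^ 2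
      * ((Real.exp (2 * C.lA * C.σ) - 1) / (2 * C.lA))) / C.α₀ := by
  have h0 := h.α₀; have := h.α₁
  calc (C.lH / C.gR * (C.α₁ / C.α₀)) ^ 2
      ≤ (C.lH / C.gR) ^ 2 * (1 + C.α₁ / C.α₀) ^ 2 * (2 * C.α₀) / C.α₀ := by
        rw [mul_pow, ← mul_assoc, mul_div_cancel_right₀ _ h0.ne', mul_assoc]
        have hratio : (C.α₁ / C.α₀) ^ 2 ≤ (1 + C.α₁ / C.α₀) ^ 2 := by
          gcongr
          linarith
        gcongr
        linarith [sq_nonneg (1 + C.α₁ / C.α₀)]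
    _ ≤ (C.lH / C.gR) ^ 2 * (1 + C.α₁ / C.α₀) ^ 2
          * (2 * (C.lB ^ 2 * ((Real.exp (2 * C.lA * C.σ) - 1) / (2 * C.lA)))) / C.α₀ := by gcongr
    _ = _ := by ring

lemma Positive.steer_control_cost_le (h : C.Positive)
    (hα : C.α₀ ≤ C.lB ^ 2 * ((Real.exp (2 * C.lA * C.σ) - 1) / (2 * C.lA))) :
    2 * (C.lB / C.α₀) ^ 2 + 2 * (C.lH / C.gR * (C.α₁ / C.α₀)) ^ 2 ≤ C.lB ^ 2 / C.α₀' ^ 2 := by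
  have hH := h.sq_lH_ratio_le hα
  have hinv := C.inv_α₀'_eq
  set Y := 2 * (C.lH / C.gR) ^ 2 * (1 + C.α₁ / C.α₀) ^ 2
    * ((Real.exp (2 * C.lA * C.σ) - 1) / (2 * C.lA))
  have hexpand : C.lB ^ 2 / C.α₀' ^ 2
      = 4 * (C.lB / C.α₀) ^ 2 + 4 * (C.lB ^ 2 * Y / C.α₀) + (C.lB * Y) ^ 2 := by
    calc C.lB ^ 2 / C.α₀' ^ 2 = C.lB ^ 2 * (1 / C.α₀') ^ 2 := by ring
      _ = _ := by rw [hinv]; ring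
  rw [hexpand]
  linarith [sq_nonneg (C.lB / C.α₀), sq_nonneg (C.lB * Y),
    sq_nonneg (C.lH / C.gR * (C.α₁ / C.α₀))]

lemma Positive.steerCost_mul_le_c₁ (h : C.Positive)
    (hα : C.α₀ ≤ C.lB ^ 2 * ((Real.exp (2 * C.lA * C.σ) - 1) / (2 * C.lA))) :
    C.steerCost * (Real.exp (2 * C.a * C.σ) / (2 * C.a)) ≤ C.c₁ := by
  have := h.a_pos; have := h.lQ; have := h.lR; have := h.gR; have := h.α₀; have := h.α₁'_pos
  have hcost : C.steerCost ≤ (C.lQ + C.lH ^ 2 / C.gR) * (1 + C.α₁' / C.α₀') ^ 2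
      + C.lR * C.lB ^ 2 / C.α₀' ^ 2 := by
    unfold steerCost
    rw [mul_div_assoc]
    gcongr
    · exact le_add_of_nonneg_right (by positivity)
    · exact h.α₁'_div_α₀_le
    · exact h.steer_control_cost_le hα
  calc C.steerCost * (Real.exp (2 * C.a * C.σ) / (2 * C.a))
      = C.steerCost * (1 / (2 * C.a)) * Real.exp (2 * C.a * C.σ) := by ring
    _ ≤ ((C.lQ + C.lH ^ 2 / C.gR) * (1 + C.α₁' / C.α₀') ^ 2 + C.lR * C.lB ^ 2 / C.α₀' ^ 2)
        * (1 / (2 * C.a)) * Real.exp (2 * C.a * C.σ) := by gcongr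
    _ ≤ C.c₁ := by
      unfold c₁
      gcongr
      exact le_max_left _ _

end Constants

/-! ### Linear-quadratic optimality systems -/

/-- The coefficients of a linear-quadratic problem as bounded operators, together with a
candidate `Ri` for the inverse of `R`. -/
structure LQOps (E U : Type*) [NormedAddCommGroup E] [InnerProductSpace ℝ E]
    [NormedAddCommGroup U] [InnerProductSpace ℝ U] where
  A : ℝ → E →L[ℝ] E
  B : ℝ → U →L[ℝ] E
  Q : ℝ → E →L[ℝ] E
  H : ℝ → E →L[ℝ] U
  R : ℝ → U →L[ℝ] U
  Ri : ℝ → U →L[ℝ] U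

lemma inner_apply_le_of_norm_le {F : Type*} [NormedAddCommGroup F] [InnerProductSpace ℝ F]
    {M : F →L[ℝ] F} {c : ℝ} (hM : ‖M‖ ≤ c) (v : F) : ⟪v, M v⟫_ℝ ≤ c * ‖v‖ ^ 2 :=
  calc ⟪v, M v⟫_ℝ ≤ ‖v‖ * ‖M v‖ := real_inner_le_norm _ _
    _ ≤ ‖v‖ * (c * ‖v‖) := by gcongr; exact M.le_of_opNorm_le hM v
    _ = c * ‖v‖ ^ 2 := by ring

lemma norm_le_div_of_mul_norm_sq_le_inner {F : Type*} [NormedAddCommGroup F]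
    [InnerProductSpace ℝ F] {c : ℝ} (hc : 0 < c) {v w : F} (h : c * ‖v‖ ^ 2 ≤ ⟪v, w⟫_ℝ) :
    ‖v‖ ≤ ‖w‖ / c := by
  rw [le_div_iff₀ hc]
  rcases (norm_nonneg v).eq_or_lt' with hzero | hpos
  · rw [hzero, zero_mul]
    exact norm_nonneg w
  · exact le_of_mul_le_mul_left (by linarith [h.trans (real_inner_le_norm v w)]) hpos

lemma mul_le_weighted_sq_add_sq {c g : ℝ} (hc : 0 < c) (hg : 0 < g) (p q : ℝ) :
    p * q ≤ 1 / (2 * c) * (g * q ^ 2) + c / 2 * (p ^ 2 / g) := by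
  have hsq : 1 / (2 * c) * (g * q ^ 2) + c / 2 * (p ^ 2 / g) - p * q
      = (g * q - c * p) ^ 2 / (2 * c * g) := by field_simp; ring
  have : 0 ≤ (g * q - c * p) ^ 2 / (2 * c * g) := by positivity
  linarith

namespace LQOps

section Coefficients

variable {E U : Type*} [NormedAddCommGroup E] [InnerProductSpace ℝ E]
  [NormedAddCommGroup U] [InnerProductSpace ℝ U]

/-- Boundedness, symmetry and coercivity of the coefficients at time `t`. -/
structure RegularAt (S : LQOps E U) (C : Constants) (t : ℝ) : Prop where
  boundA : ‖S.A t‖ ≤ C.lA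
  boundB : ‖S.B t‖ ≤ C.lB
  boundQ : ‖S.Q t‖ ≤ C.lQ
  boundH : ‖S.H t‖ ≤ C.lH
  boundR : ‖S.R t‖ ≤ C.lR
  symmQ : ∀ x y, ⟪S.Q t x, y⟫_ℝ = ⟪x, S.Q t y⟫_ℝ
  symmR : ∀ x y, ⟪S.R t x, y⟫_ℝ = ⟪x, S.R t y⟫_ℝ
  R_Ri : ∀ w, S.R t (S.Ri t w) = w
  Ri_R : ∀ w, S.Ri t (S.R t w) = w
  R_lower : ∀ w, C.gR * ‖w‖ ^ 2 ≤ ⟪w, S.R t w⟫_ℝ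
  Q_lower : ∀ x, C.gQ * ‖x‖ ^ 2 ≤ ⟪x, S.Q t x⟫_ℝ - ⟪S.H t x, S.Ri t (S.H t x)⟫_ℝ

/-- Continuity of the coefficients on a set of times. -/
structure Cont (S : LQOps E U) (s : Set ℝ) : Prop where
  A : ContinuousOn S.A s
  B : ContinuousOn S.B s
  Q : ContinuousOn S.Q s
  H : ContinuousOn S.H s
  R : ContinuousOn S.R s
  Ri : ContinuousOn S.Ri s

/-- The symmetric bilinear form of the running cost. -/
def form (S : LQOps E U) (t : ℝ) (x : E) (u : U) (y : E) (w : U) : ℝ :=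
  ⟪x, S.Q t y⟫_ℝ + ⟪u, S.H t y⟫_ℝ + ⟪w, S.H t x⟫_ℝ + ⟪w, S.R t u⟫_ℝ

/-- The input `u + R⁻¹ H x`, in terms of which the running cost has no cross term. -/
def shifted (S : LQOps E U) (t : ℝ) (x : E) (u : U) : U := u + S.Ri t (S.H t x)

/-- The drift `A - B R⁻¹ H` of the state equation written in the shifted input. -/
def drift (S : LQOps E U) (t : ℝ) : E →L[ℝ] E := S.A t - S.B t ∘L S.Ri t ∘L S.H t

/-- Dynamics `ẋ = A x + B u` on `[a, b]`. -/
def IsTraj (S : LQOps E U) (a b : ℝ) (x : ℝ → E) (u : ℝ → U) : Prop :=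
  ∀ s ∈ Icc a b, HasDerivWithinAt x (S.A s (x s) + S.B s (u s)) (Icc a b) s

variable {S : LQOps E U} {C : Constants} {t : ℝ}

lemma Cont.mono {s s' : Set ℝ} (h : S.Cont s) (hs : s' ⊆ s) : S.Cont s' :=
  ⟨h.A.mono hs, h.B.mono hs, h.Q.mono hs, h.H.mono hs, h.R.mono hs, h.Ri.mono hs⟩

lemma Cont.form {s : Set ℝ} (h : S.Cont s) {x y : ℝ → E} {u w : ℝ → U} (hx : ContinuousOn x s)
    (hu : ContinuousOn u s) (hy : ContinuousOn y s) (hw : ContinuousOn w s) :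
    ContinuousOn (fun r => S.form r (x r) (u r) (y r) (w r)) s :=
  (((hx.inner (h.Q.clm_apply hy)).add (hu.inner (h.H.clm_apply hy))).add
    (hw.inner (h.H.clm_apply hx))).add (hw.inner (h.R.clm_apply hu))

lemma Cont.drift {s : Set ℝ} (h : S.Cont s) : ContinuousOn S.drift s :=
  h.A.sub (h.B.clm_comp (h.Ri.clm_comp h.H))

lemma IsTraj.mono {a b a' b' : ℝ} {x : ℝ → E} {u : ℝ → U} (h : S.IsTraj a b x u)
    (hs : Icc a' b' ⊆ Icc a b) : S.IsTraj a' b' x u :=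
  fun s hs' => (h s (hs hs')).mono hs

lemma IsTraj.continuousOn {a b : ℝ} {x : ℝ → E} {u : ℝ → U} (h : S.IsTraj a b x u) :
    ContinuousOn x (Icc a b) :=
  fun s hs => (h s hs).continuousWithinAt

lemma IsTraj.add_smul {a b : ℝ} {x y : ℝ → E} {u w : ℝ → U} (hx : S.IsTraj a b x u)
    (hy : S.IsTraj a b y w) (ε : ℝ) :
    S.IsTraj a b (fun t => x t + ε • y t) (fun t => u t + ε • w t) := fun s hs => by
  convert! (hx s hs).add ((hy s hs).const_smul ε) using 1
  simp only [map_add, map_smul, smul_add]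
  abel

lemma drift_add_shifted (S : LQOps E U) (t : ℝ) (x : E) (u : U) :
    S.drift t x + S.B t (S.shifted t x u) = S.A t x + S.B t u := by
  simp only [drift, shifted, map_add, sub_apply, ContinuousLinearMap.comp_apply]
  abel

namespace RegularAt

lemma norm_A_le (h : S.RegularAt C t) (x : E) : ‖S.A t x‖ ≤ C.lA * ‖x‖ :=
  (S.A t).le_of_opNorm_le h.boundA x

lemma norm_B_le (h : S.RegularAt C t) (w : U) : ‖S.B t w‖ ≤ C.lB * ‖w‖ :=
  (S.B t).le_of_opNorm_le h.boundB w

lemma norm_H_le (h : S.RegularAt C t) (x : E) : ‖S.H t x‖ ≤ C.lH * ‖x‖ :=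
  (S.H t).le_of_opNorm_le h.boundH x

lemma norm_Ri_le (h : S.RegularAt C t) (hC : C.Positive) (w : U) :
    ‖S.Ri t w‖ ≤ ‖w‖ / C.gR :=
  norm_le_div_of_mul_norm_sq_le_inner hC.gR
    ((h.R_lower (S.Ri t w)).trans_eq (by rw [h.R_Ri]))

lemma norm_Ri_H_le (h : S.RegularAt C t) (hC : C.Positive) (x : E) :
    ‖S.Ri t (S.H t x)‖ ≤ C.lH / C.gR * ‖x‖ := by
  have := hC.gR
  calc ‖S.Ri t (S.H t x)‖ ≤ ‖S.H t x‖ / C.gR := h.norm_Ri_le hC _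
    _ ≤ C.lH * ‖x‖ / C.gR := by gcongr; exact h.norm_H_le x
    _ = C.lH / C.gR * ‖x‖ := by ring

lemma norm_drift_le (h : S.RegularAt C t) (hC : C.Positive) : ‖S.drift t‖ ≤ C.a := by
  have := hC.lB
  refine ContinuousLinearMap.opNorm_le_bound _ hC.a_pos.le fun x => ?_
  have hfeedback : ‖S.B t (S.Ri t (S.H t x))‖ ≤ C.lB * (C.lH / C.gR * ‖x‖) :=
    (h.norm_B_le _).trans (by gcongr; exact h.norm_Ri_H_le hC x)
  calc ‖S.drift t x‖ = ‖S.A t x - S.B t (S.Ri t (S.H t x))‖ := rfl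
    _ ≤ ‖S.A t x‖ + ‖S.B t (S.Ri t (S.H t x))‖ := norm_sub_le _ _
    _ ≤ C.lA * ‖x‖ + C.lB * (C.lH / C.gR * ‖x‖) := add_le_add (h.norm_A_le x) hfeedback
    _ = C.a * ‖x‖ := by unfold Constants.a; ring

lemma form_self_eq (h : S.RegularAt C t) (x : E) (u : U) :
    S.form t x u x u = (⟪x, S.Q t x⟫_ℝ - ⟪S.H t x, S.Ri t (S.H t x)⟫_ℝ)
      + ⟪S.shifted t x u, S.R t (S.shifted t x u)⟫_ℝ := by
  have hcross : ⟪S.Ri t (S.H t x), S.R t u⟫_ℝ = ⟪u, S.H t x⟫_ℝ := by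
    rw [← h.symmR, h.R_Ri, real_inner_comm]
  have hcomm : ⟪S.Ri t (S.H t x), S.H t x⟫_ℝ = ⟪S.H t x, S.Ri t (S.H t x)⟫_ℝ :=
    real_inner_comm _ _
  simp only [form, shifted, map_add, h.R_Ri, inner_add_left, inner_add_right, hcross, hcomm]
  ring

lemma le_form_self (h : S.RegularAt C t) (x : E) (u : U) :
    C.gQ * ‖x‖ ^ 2 + C.gR * ‖S.shifted t x u‖ ^ 2 ≤ S.form t x u x u := by
  rw [h.form_self_eq]
  exact add_le_add (h.Q_lower x) (h.R_lower _)

lemma form_self_nonneg (h : S.RegularAt C t) (hC : C.Positive) (x : E) (u : U) :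
    0 ≤ S.form t x u x u := by
  have := hC.gQ; have := hC.gR
  exact le_trans (by positivity) (h.le_form_self x u)

lemma inner_Ri_nonneg (h : S.RegularAt C t) (hC : C.Positive) (w : U) :
    0 ≤ ⟪w, S.Ri t w⟫_ℝ := by
  have := hC.gR
  have hcoercive := h.R_lower (S.Ri t w)
  rw [h.R_Ri, real_inner_comm] at hcoercive
  exact le_trans (by positivity) hcoercive

lemma form_self_le (h : S.RegularAt C t) (hC : C.Positive) (x : E) (u : U) :
    S.form t x u x u ≤ C.lQ * ‖x‖ ^ 2 + C.lR * ‖S.shifted t x u‖ ^ 2 := by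
  rw [h.form_self_eq]
  linarith [inner_apply_le_of_norm_le h.boundQ x,
    inner_apply_le_of_norm_le h.boundR (S.shifted t x u), h.inner_Ri_nonneg hC (S.H t x)]

lemma form_comm (h : S.RegularAt C t) (x : E) (u : U) (y : E) (w : U) :
    S.form t x u y w = S.form t y w x u := by
  unfold form
  rw [← h.symmQ x y, real_inner_comm y, ← h.symmR w u, real_inner_comm u (S.R t w)]
  ring

lemma two_mul_form_sub_le (h : S.RegularAt C t) (hC : C.Positive) (x : E) (u : U) (y : E)
    (w : U) :
    2 * S.form t x u y w - S.form t x u x u ≤ S.form t y w y w := by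
  have hnonneg := h.form_self_nonneg hC (y - x) (w - u)
  have hexpand : S.form t (y - x) (w - u) (y - x) (w - u)
      = S.form t y w y w - S.form t x u y w - S.form t y w x u + S.form t x u x u := by
    simp only [form, map_sub, inner_sub_left, inner_sub_right]; ring
  linarith [h.form_comm x u y w]

lemma norm_adjoint_drift_le [CompleteSpace E] (h : S.RegularAt C t) (hC : C.Positive) (z : E) :
    ‖(S.drift t).adjoint z‖ ≤ C.a * ‖z‖ :=
  (S.drift t).adjoint.le_of_opNorm_le
    ((ContinuousLinearMap.adjoint.norm_map (S.drift t)).trans_le (h.norm_drift_le hC)) z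

lemma neg_inner_state_le [CompleteSpace E] (h : S.RegularAt C t) (hC : C.Positive)
    {μ μ' x : E} {u : U} {ρ m c : ℝ} (hρ : ‖μ' + (S.drift t).adjoint μ‖ ≤ ρ) (hm : ‖μ‖ ≤ m)
    (hc : 0 < c) :
    -(⟪μ, S.A t x + S.B t u⟫_ℝ + ⟪μ', x⟫_ℝ)
      ≤ 1 / (2 * c) * S.form t x u x u + c / 2 * (ρ ^ 2 / C.gQ + C.lB ^ 2 * m ^ 2 / C.gR) := by
  set v := S.shifted t x u
  have := hC.lB
  have hm₀ : 0 ≤ m := (norm_nonneg _).trans hm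
  have hsplit : ⟪μ, S.A t x + S.B t u⟫_ℝ + ⟪μ', x⟫_ℝ
      = ⟪μ' + (S.drift t).adjoint μ, x⟫_ℝ + ⟪μ, S.B t v⟫_ℝ := by
    rw [← S.drift_add_shifted, inner_add_left, inner_add_right,
      ContinuousLinearMap.adjoint_inner_left]
    ring
  have hstate : -⟪μ' + (S.drift t).adjoint μ, x⟫_ℝ ≤ ρ * ‖x‖ :=
    (neg_le_abs _).trans ((abs_real_inner_le_norm _ _).trans (by gcongr))
  have hinput : -⟪μ, S.B t v⟫_ℝ ≤ C.lB * m * ‖v‖ :=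
    calc -⟪μ, S.B t v⟫_ℝ ≤ ‖μ‖ * ‖S.B t v‖ := (neg_le_abs _).trans (abs_real_inner_le_norm _ _)
      _ ≤ m * (C.lB * ‖v‖) := by gcongr; exact h.norm_B_le v
      _ = C.lB * m * ‖v‖ := by ring
  have hform : 1 / (2 * c) * (C.gQ * ‖x‖ ^ 2 + C.gR * ‖v‖ ^ 2)
      ≤ 1 / (2 * c) * S.form t x u x u := by
    gcongr; exact h.le_form_self x u
  have hyoung_state := mul_le_weighted_sq_add_sq hc hC.gQ ρ ‖x‖
  have hyoung_input := mul_le_weighted_sq_add_sq hc hC.gR (C.lB * m) ‖v‖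
  rw [mul_pow] at hyoung_input
  rw [hsplit, mul_add (c / 2)]
  linarith

end RegularAt

end Coefficients

section OptimalitySystem

variable {E U : Type*} [NormedAddCommGroup E] [InnerProductSpace ℝ E] [CompleteSpace E]
  [NormedAddCommGroup U] [InnerProductSpace ℝ U] [CompleteSpace U]

/-- The adjoint equation `l̇ = -A* l - Q x - H* u` on `[a, b]`. -/
def IsAdjoint (S : LQOps E U) (a b : ℝ) (x : ℝ → E) (u : ℝ → U) (l : ℝ → E) : Prop :=
  ∀ s ∈ Icc a b, HasDerivWithinAt l
    (-((S.A s).adjoint (l s)) - S.Q s (x s) - (S.H s).adjoint (u s)) (Icc a b) s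

/-- The optimality system: state equation, adjoint equation and stationarity in the control. -/
structure IsHam (S : LQOps E U) (a b : ℝ) (x : ℝ → E) (u : ℝ → U) (l : ℝ → E) : Prop where
  traj : S.IsTraj a b x u
  adj : S.IsAdjoint a b x u l
  stat : ∀ s ∈ Icc a b, S.R s (u s) + S.H s (x s) + (S.B s).adjoint (l s) = 0

variable {S : LQOps E U} {C : Constants} {a b t : ℝ}
  {x y l l₁ l₂ x₁ x₂ : ℝ → E} {u w u₁ u₂ : ℝ → U}

lemma RegularAt.norm_adjoint_B_le (h : S.RegularAt C t) (x : E) :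
    ‖(S.B t).adjoint x‖ ≤ C.lB * ‖x‖ :=
  (S.B t).adjoint.le_of_opNorm_le
    ((ContinuousLinearMap.adjoint.norm_map (S.B t)).trans_le h.boundB) x

lemma IsHam.mono {a' b' : ℝ} (h : S.IsHam a b x u l) (hs : Icc a' b' ⊆ Icc a b) :
    S.IsHam a' b' x u l :=
  ⟨h.traj.mono hs, fun s hs' => (h.adj s (hs hs')).mono hs, fun s hs' => h.stat s (hs hs')⟩

lemma IsHam.sub (h₁ : S.IsHam a b x₁ u₁ l₁) (h₂ : S.IsHam a b x₂ u₂ l₂) :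
    S.IsHam a b (fun s => x₁ s - x₂ s) (fun s => u₁ s - u₂ s) (fun s => l₁ s - l₂ s) where
  traj s hs := by
    convert! (h₁.traj s hs).sub (h₂.traj s hs) using 1
    simp only [map_sub]; abel
  adj s hs := by
    convert! (h₁.adj s hs).sub (h₂.adj s hs) using 1
    simp only [map_sub]; abel
  stat s hs := by
    rw [← sub_eq_zero.2 ((h₁.stat s hs).trans (h₂.stat s hs).symm)]
    simp only [map_sub]; abel

lemma IsAdjoint.hasDerivWithinAt_inner (h : S.IsAdjoint a b x u l)
    (hr : ∀ s ∈ Icc a b, S.RegularAt C s) (hy : S.IsTraj a b y w) :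
    ∀ s ∈ Icc a b, HasDerivWithinAt (fun s => ⟪l s, y s⟫_ℝ)
      (⟪w s, S.R s (u s) + S.H s (x s) + (S.B s).adjoint (l s)⟫_ℝ
        - S.form s (x s) (u s) (y s) (w s)) (Icc a b) s := by
  intro s hs
  convert! (h s hs).inner ℝ (hy s hs) using 1
  simp only [inner_add_right, inner_sub_left, inner_neg_left,
    ContinuousLinearMap.adjoint_inner_left, ContinuousLinearMap.adjoint_inner_right, form,
    (hr s hs).symmQ, real_inner_comm (l s)]
  ring

lemma IsHam.hasDerivWithinAt_inner (h : S.IsHam a b x u l) (hr : ∀ s ∈ Icc a b, S.RegularAt C s)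
    (hy : S.IsTraj a b y w) :
    ∀ s ∈ Icc a b, HasDerivWithinAt (fun s => ⟪l s, y s⟫_ℝ)
      (-S.form s (x s) (u s) (y s) (w s)) (Icc a b) s := by
  intro s hs
  simpa only [h.stat s hs, inner_zero_right, zero_sub] using h.adj.hasDerivWithinAt_inner hr hy s hs

lemma IsHam.symplectic_eq (h₁ : S.IsHam a b x₁ u₁ l₁) (h₂ : S.IsHam a b x₂ u₂ l₂)
    (hr : ∀ s ∈ Icc a b, S.RegularAt C s) {s t : ℝ} (hs : s ∈ Icc a b) (ht : t ∈ Icc a b) :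
    ⟪l₁ s, x₂ s⟫_ℝ - ⟪l₂ s, x₁ s⟫_ℝ = ⟪l₁ t, x₂ t⟫_ℝ - ⟪l₂ t, x₁ t⟫_ℝ := by
  refine eq_of_hasDerivWithinAt_zero (f := fun s => ⟪l₁ s, x₂ s⟫_ℝ - ⟪l₂ s, x₁ s⟫_ℝ)
    (fun r hrI => ?_) hs ht
  convert! (h₁.hasDerivWithinAt_inner hr h₂.traj r hrI).sub
    (h₂.hasDerivWithinAt_inner hr h₁.traj r hrI) using 1
  rw [(hr r hrI).form_comm (x₁ r)]; ring

lemma IsHam.inner_right_le_inner_left (h : S.IsHam a b x u l) (hC : C.Positive)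
    (hr : ∀ s ∈ Icc a b, S.RegularAt C s) (hab : a ≤ b) : ⟪l b, x b⟫_ℝ ≤ ⟪l a, x a⟫_ℝ := by
  have hmono := sub_le_sub_of_hasDerivWithinAt_le hab (h.hasDerivWithinAt_inner hr h.traj)
    (fun s _ => hasDerivWithinAt_const s _ (0 : ℝ))
    (fun s hs => neg_nonpos.2 ((hr s hs).form_self_nonneg hC (x s) (u s)))
  linarith

lemma IsHam.inner_le_of_competitor (h : S.IsHam a b x u l) (hC : C.Positive)
    (hr : ∀ s ∈ Icc a b, S.RegularAt C s) (hab : a ≤ b) (hy : S.IsTraj a b y w)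
    (hya : y a = x a) {κ κ' : ℝ → ℝ}
    (hκ : ∀ s ∈ Icc a b, HasDerivWithinAt κ (κ' s) (Icc a b) s)
    (hle : ∀ s ∈ Icc a b, S.form s (y s) (w s) (y s) (w s) ≤ κ' s) :
    ⟪l a, x a⟫_ℝ ≤ 2 * ⟪l b, y b⟫_ℝ - ⟪l b, x b⟫_ℝ + (κ b - κ a) := by
  have hcompare := sub_le_sub_of_hasDerivWithinAt_le hab
    (fun s hs => (h.hasDerivWithinAt_inner hr h.traj s hs).sub
      ((h.hasDerivWithinAt_inner hr hy s hs).const_mul 2)) hκ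
    (fun s hs => by
      linarith [(hr s hs).two_mul_form_sub_le hC (x s) (u s) (y s) (w s), hle s hs])
  simp only [hya, Pi.sub_apply] at hcompare
  linarith

lemma IsHam.inner_le_of_test_curve (h : S.IsHam a b x u l) (hC : C.Positive)
    (hr : ∀ s ∈ Icc a b, S.RegularAt C s) (hab : a ≤ b) {μ μ' : ℝ → E} {ρ m κ κ' : ℝ → ℝ}
    (hμ : ∀ s ∈ Icc a b, HasDerivWithinAt μ (μ' s) (Icc a b) s)
    (hρ : ∀ s ∈ Icc a b, ‖μ' s + (S.drift s).adjoint (μ s)‖ ≤ ρ s)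
    (hm : ∀ s ∈ Icc a b, ‖μ s‖ ≤ m s)
    (hκ : ∀ s ∈ Icc a b, HasDerivWithinAt κ (κ' s) (Icc a b) s)
    (hκ' : ∀ s ∈ Icc a b, ρ s ^ 2 / C.gQ + C.lB ^ 2 * m s ^ 2 / C.gR ≤ κ' s)
    {c : ℝ} (hc : 0 < c) :
    ⟪μ a, x a⟫_ℝ ≤ ⟪μ b, x b⟫_ℝ + 1 / (2 * c) * (⟪l a, x a⟫_ℝ - ⟪l b, x b⟫_ℝ)
      + c / 2 * (κ b - κ a) := by
  have hcompare := sub_le_sub_of_hasDerivWithinAt_le hab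
    (fun s hs => ((hμ s hs).inner ℝ (h.traj s hs)).neg)
    (fun s hs => ((h.hasDerivWithinAt_inner hr h.traj s hs).const_mul (-(1 / (2 * c)))).add
      ((hκ s hs).const_mul (c / 2)))
    (fun s hs => by
      have hcost := mul_le_mul_of_nonneg_left (hκ' s hs) (half_pos hc).le
      linarith [(hr s hs).neg_inner_state_le hC (x := x s) (u := u s) (hρ s hs) (hm s hs) hc])
  simp only [Pi.neg_apply, Pi.add_apply] at hcompare
  linarith

end OptimalitySystem

end LQOps

/-! ### Bounds on the value function and exponential decay -/

lemma mul_exp_sq (c k s : ℝ) : (c * Real.exp (k * s)) ^ 2 = c ^ 2 * Real.exp (2 * k * s) := by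
  rw [mul_pow, ← Real.exp_nat_mul]; congr 2; push_cast; ring

lemma hasDerivWithinAt_mul_exp (c k a t : ℝ) (s : Set ℝ) :
    HasDerivWithinAt (fun r => c * Real.exp (k * (r - a)))
      (c * (k * Real.exp (k * (t - a)))) s t := by
  have hexponent : HasDerivAt (fun r => k * (r - a)) k t := by
    simpa using ((hasDerivAt_id t).sub_const a).const_mul k
  convert! (hexponent.exp.const_mul c).hasDerivWithinAt (s := s) using 1
  ring

/-- A symmetric terminal weight `G` with `γ_Q ≤ G ≤ λ_Q`. -/
structure IsWeight {E : Type*} [NormedAddCommGroup E] [InnerProductSpace ℝ E] (C : Constants)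
    (G : E →L[ℝ] E) : Prop where
  symm : ∀ x y, ⟪G x, y⟫_ℝ = ⟪x, G y⟫_ℝ
  lower : ∀ x, C.gQ * ‖x‖ ^ 2 ≤ ⟪x, G x⟫_ℝ
  upper : ∀ x, ⟪x, G x⟫_ℝ ≤ C.lQ * ‖x‖ ^ 2

namespace IsWeight

variable {E : Type*} [NormedAddCommGroup E] [InnerProductSpace ℝ E] {C : Constants}
  {G : E →L[ℝ] E}

lemma nonneg (hG : IsWeight C G) (hC : C.Positive) (x : E) : 0 ≤ ⟪x, G x⟫_ℝ := by
  have := hC.gQ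
  exact le_trans (by positivity) (hG.lower x)

lemma two_mul_inner_sub_le (hG : IsWeight C G) (hC : C.Positive) (x y : E) :
    2 * ⟪G x, y⟫_ℝ - ⟪G x, x⟫_ℝ ≤ ⟪y, G y⟫_ℝ := by
  have hsquare := hG.nonneg hC (y - x)
  have hcomm : ⟪x, G y⟫_ℝ = ⟪y, G x⟫_ℝ := by rw [← hG.symm, real_inner_comm]
  simp only [map_sub, inner_sub_left, inner_sub_right] at hsquare
  rw [real_inner_comm, real_inner_comm x]
  linarith

end IsWeight

namespace LQOps

section Steering

variable {E U : Type*} [NormedAddCommGroup E] [InnerProductSpace ℝ E]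
  [NormedAddCommGroup U] [InnerProductSpace ℝ U]

/-- From time `t` every state can be steered to the origin within time `σ`, at a running cost that
grows at most like `e^{2a(s-t)}` and whose total stays below `c₁`. -/
def SteersToZero (S : LQOps E U) (C : Constants) (t : ℝ) : Prop :=
  ∀ ξ : E, ∃ t₁ ∈ Icc t (t + C.σ), ∃ (y : ℝ → E) (w : ℝ → U) (K : ℝ),
    S.IsTraj t t₁ y w ∧ y t = ξ ∧ y t₁ = 0 ∧ 0 ≤ K ∧
      K * (Real.exp (2 * C.a * C.σ) / (2 * C.a)) ≤ C.c₁ ∧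
      ∀ s ∈ Icc t t₁, S.form s (y s) (w s) (y s) (w s) ≤ K * Real.exp (2 * C.a * (s - t)) * ‖ξ‖ ^ 2

/-- A linear-quadratic problem on `[a, b]` with terminal weight `G` that satisfies all the
assumptions with constants `C`; controllability enters only through `SteersToZero`. -/
structure Problem (S : LQOps E U) (C : Constants) (a b : ℝ) (G : E →L[ℝ] E) : Prop where
  pos : C.Positive
  le : a ≤ b
  cont : S.Cont (Icc a b)
  reg : ∀ s ∈ Icc a b, S.RegularAt C s
  weight : IsWeight C G
  steers : ∀ t ∈ Icc a b, t + C.σ ≤ b → S.SteersToZero C t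

lemma Problem.restrict_left {S : LQOps E U} {C : Constants} {a b t : ℝ} {G : E →L[ℝ] E}
    (p : S.Problem C a b G) (ht : t ∈ Icc a b) : S.Problem C t b G :=
  have hsub : Icc t b ⊆ Icc a b := Icc_subset_Icc_left ht.1
  ⟨p.pos, ht.2, p.cont.mono hsub, fun s hs => p.reg s (hsub hs), p.weight,
    fun s hs => p.steers s (hsub hs)⟩

end Steering

section RiccatiBounds

variable {E U : Type*} [NormedAddCommGroup E] [InnerProductSpace ℝ E] [CompleteSpace E]
  [NormedAddCommGroup U] [InnerProductSpace ℝ U] [CompleteSpace U]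
  {S : LQOps E U} {C : Constants} {G : E →L[ℝ] E} {a b t : ℝ} {x l : ℝ → E} {u : ℝ → U}

lemma IsHam.norm_sq_le_of_linear_test (h : S.IsHam a b x u l) (hC : C.Positive)
    (hr : ∀ s ∈ Icc a b, S.RegularAt C s) (hab : a < b) {c : ℝ} (hc : 0 < c) :
    ‖x a‖ ^ 2 ≤ 1 / (2 * c) * (⟪l a, x a⟫_ℝ - ⟪l b, x b⟫_ℝ)
      + c / 2 * ((b - a) * ((1 / (b - a) + C.a) ^ 2 / C.gQ + C.lB ^ 2 / C.gR) * ‖x a‖ ^ 2) := by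
  set δ := b - a with hδ
  set ξ := x a
  set k := ((1 / δ + C.a) * ‖ξ‖) ^ 2 / C.gQ + C.lB ^ 2 * ‖ξ‖ ^ 2 / C.gR with hk
  have hδ₀ : 0 < δ := sub_pos.2 hab
  have := hC.a_pos
  have hμ_le : ∀ s ∈ Icc a b, ‖(1 - (s - a) / δ) • ξ‖ ≤ ‖ξ‖ := fun s hs => by
    have hnonneg : 0 ≤ (s - a) / δ := div_nonneg (by linarith [hs.1]) hδ₀.le
    have hle_one : (s - a) / δ ≤ 1 := by rw [div_le_one hδ₀]; linarith [hs.2]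
    rw [norm_smul, Real.norm_of_nonneg (by linarith)]
    exact mul_le_of_le_one_left (norm_nonneg _) (by linarith)
  have htest := h.inner_le_of_test_curve hC hr hab.le
    (μ := fun s => (1 - (s - a) / δ) • ξ) (μ' := fun _ => (-(1 / δ)) • ξ)
    (ρ := fun _ => (1 / δ + C.a) * ‖ξ‖) (m := fun _ => ‖ξ‖) (κ := fun s => k * s)
    (κ' := fun _ => k)
    (fun s _ => ((((hasDerivAt_id s).sub_const a).div_const δ).const_sub
      1).smul_const ξ |>.hasDerivWithinAt)
    (fun s hs => by
      refine (norm_add_le _ _).trans ?_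
      rw [norm_smul, norm_neg, Real.norm_of_nonneg (by positivity), add_mul]
      gcongr
      exact ((hr s hs).norm_adjoint_drift_le hC _).trans (by gcongr; exact hμ_le s hs))
    hμ_le (fun s _ => by simpa using ((hasDerivAt_id s).const_mul k).hasDerivWithinAt)
    (fun s _ => le_rfl) hc
  have hend : 1 - (b - a) / δ = 0 := by rw [← hδ, div_self hδ₀.ne', sub_self]
  have hcost : k * b - k * a = δ * ((1 / δ + C.a) ^ 2 / C.gQ + C.lB ^ 2 / C.gR) * ‖ξ‖ ^ 2 := by
    rw [hk, hδ]; ring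
  rw [hcost] at htest
  simpa only [hend, sub_self, zero_div, sub_zero, zero_smul, one_smul, inner_zero_left, zero_add,
    real_inner_self_eq_norm_sq, ξ] using htest

lemma IsHam.norm_sq_le_of_adjoint_test (h : S.IsHam a b x u l) (hC : C.Positive)
    (hcont : S.Cont (Icc a b)) (hr : ∀ s ∈ Icc a b, S.RegularAt C s) (hab : a ≤ b) {c : ℝ}
    (hc : 0 < c) :
    ‖x a‖ ^ 2 ≤ ‖x a‖ * Real.exp (C.a * (b - a)) * ‖x b‖
      + 1 / (2 * c) * (⟪l a, x a⟫_ℝ - ⟪l b, x b⟫_ℝ)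
      + c / 2 * (C.lB ^ 2 / C.gR * ((Real.exp (2 * C.a * (b - a)) - 1) / (2 * C.a))
        * ‖x a‖ ^ 2) := by
  have ha := hC.a_pos; have := hC.gR
  have hadj_cont : ContinuousOn (fun s => -(S.drift s).adjoint) (Icc a b) :=
    (ContinuousLinearMap.adjoint.continuous.comp_continuousOn hcont.drift).neg
  obtain ⟨μ, hμa, hμ⟩ := exists_homogeneous_linear_solution hab hadj_cont (x a)
  have hμ_le : ∀ s ∈ Icc a b, ‖μ s‖ ≤ ‖x a‖ * Real.exp (C.a * (s - a)) := fun s hs => by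
    rw [← hμa]
    refine norm_le_mul_exp_of_norm_deriv_le hμ (fun r hrI => ?_) hs
    rw [neg_apply, norm_neg]
    exact (hr r hrI).norm_adjoint_drift_le hC _
  set q := C.lB ^ 2 / C.gR * ‖x a‖ ^ 2 / (2 * C.a) with hq
  have htest := h.inner_le_of_test_curve hC hr hab (ρ := fun _ => 0)
    (m := fun s => ‖x a‖ * Real.exp (C.a * (s - a)))
    (κ := fun s => q * Real.exp (2 * C.a * (s - a))) hμ (fun s _ => by simp) hμ_le
    (fun s _ => hasDerivWithinAt_mul_exp _ _ _ _ _)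
    (fun s _ => by rw [mul_exp_sq, hq]; apply le_of_eq; field_simp; ring) hc
  have hend : ⟪μ b, x b⟫_ℝ ≤ ‖x a‖ * Real.exp (C.a * (b - a)) * ‖x b‖ :=
    (real_inner_le_norm _ _).trans (by gcongr; exact hμ_le b (right_mem_Icc.2 hab))
  have hcost : q * Real.exp (2 * C.a * (b - a)) - q * Real.exp (2 * C.a * (a - a))
      = C.lB ^ 2 / C.gR * ((Real.exp (2 * C.a * (b - a)) - 1) / (2 * C.a)) * ‖x a‖ ^ 2 := by
    rw [sub_self, mul_zero, Real.exp_zero, hq]; ring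
  rw [hμa, real_inner_self_eq_norm_sq, hcost] at htest
  linarith

lemma mul_le_of_le_half_add {c D v n : ℝ} (hc : 0 < c) (hn : 0 ≤ n) (hD : D ≤ 1 / c)
    (h : n ≤ 1 / (2 * c) * v + c / 2 * (D * n)) : c * n ≤ v := by
  have hDn : c / 2 * (D * n) ≤ n / 2 := by
    calc c / 2 * (D * n) ≤ c / 2 * (1 / c * n) := by gcongr
      _ = n / 2 := by field_simp
  have hhalf : n / 2 ≤ 1 / (2 * c) * v := by linarith
  calc c * n = 2 * c * (n / 2) := by ring
    _ ≤ 2 * c * (1 / (2 * c) * v) := by gcongr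
    _ = v := by field_simp

namespace Problem

lemma inner_nonneg (p : S.Problem C a b G) (h : S.IsHam a b x u l) (hl : l b = G (x b))
    (ht : t ∈ Icc a b) : 0 ≤ ⟪l t, x t⟫_ℝ := by
  have hmono := (h.mono (Icc_subset_Icc_left ht.1)).inner_right_le_inner_left p.pos
    (p.restrict_left ht).reg ht.2
  rw [hl, real_inner_comm] at hmono
  exact (p.weight.nonneg p.pos _).trans hmono

lemma c₀_mul_le_inner_of_le (p : S.Problem C a b G) (h : S.IsHam a b x u l) (hl : l b = G (x b))
    (hfar : a + C.σ ≤ b) : C.c₀ * ‖x a‖ ^ 2 ≤ ⟪l a, x a⟫_ℝ := by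
  have hσ := p.pos.σ; have hc₀ := p.pos.c₀_pos
  have hsub : Icc a (a + C.σ) ⊆ Icc a b := Icc_subset_Icc_right hfar
  have htest := (h.mono hsub).norm_sq_le_of_linear_test p.pos (fun s hs => p.reg s (hsub hs))
    (by linarith) hc₀
  have hend := mul_nonneg (show 0 ≤ 1 / (2 * C.c₀) by positivity)
    (p.inner_nonneg h hl (t := a + C.σ) ⟨by linarith, hfar⟩)
  rw [add_sub_cancel_left] at htest
  refine mul_le_of_le_half_add hc₀ (sq_nonneg _) p.pos.dual_cost_le_inv_c₀ (htest.trans ?_)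
  linarith

lemma c₀_mul_le_inner_of_lt (p : S.Problem C a b G) (h : S.IsHam a b x u l) (hl : l b = G (x b))
    (hnear : b < a + C.σ) : C.c₀ * ‖x a‖ ^ 2 ≤ ⟪l a, x a⟫_ℝ := by
  have ha := p.pos.a_pos; have hgQ := p.pos.gQ; have hgR := p.pos.gR; have hc₀ := p.pos.c₀_pos
  set e := Real.exp (2 * C.a * (b - a))
  have hexp : e ≤ Real.exp (2 * C.a * C.σ) := by
    apply Real.exp_le_exp.2; gcongr; linarith
  have hD : e / C.gQ + C.lB ^ 2 / C.gR * ((e - 1) / (2 * C.a)) ≤ 1 / C.c₀ :=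
    le_trans (by gcongr; linarith) p.pos.near_le_inv_c₀
  have hend : 1 / (2 * C.c₀) * (C.gQ * ‖x b‖ ^ 2) ≤ 1 / (2 * C.c₀) * ⟪l b, x b⟫_ℝ := by
    rw [hl, real_inner_comm]; gcongr; exact p.weight.lower _
  have htest := h.norm_sq_le_of_adjoint_test p.pos p.cont p.reg p.le hc₀
  have hyoung := mul_le_weighted_sq_add_sq hc₀ hgQ (‖x a‖ * Real.exp (C.a * (b - a))) ‖x b‖
  rw [mul_exp_sq] at hyoung
  refine mul_le_of_le_half_add hc₀ (sq_nonneg ‖x a‖) hD (htest.trans ?_)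
  linear_combination hyoung + hend

lemma inner_le_c₁_mul_of_le (p : S.Problem C a b G) (h : S.IsHam a b x u l) (hl : l b = G (x b))
    (hfar : a + C.σ ≤ b) : ⟪l a, x a⟫_ℝ ≤ C.c₁ * ‖x a‖ ^ 2 := by
  have ha := p.pos.a_pos
  obtain ⟨t₁, ht₁, y, w, K, hy, hya, hyt₁, hK₀, hK, hcost⟩ :=
    p.steers a (left_mem_Icc.2 p.le) hfar (x a)
  have hsub : Icc a t₁ ⊆ Icc a b := Icc_subset_Icc_right (ht₁.2.trans hfar)
  set k := K / (2 * C.a) * ‖x a‖ ^ 2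
  have : 0 ≤ k := by positivity
  have hcompare := (h.mono hsub).inner_le_of_competitor p.pos (fun s hs => p.reg s (hsub hs)) ht₁.1
    hy hya (fun s _ => hasDerivWithinAt_mul_exp k (2 * C.a) a s _)
    (fun s hs => (hcost s hs).trans_eq (by simp only [k]; field_simp))
  have htotal : k * Real.exp (2 * C.a * (t₁ - a)) ≤ C.c₁ * ‖x a‖ ^ 2 :=
    calc k * Real.exp (2 * C.a * (t₁ - a)) ≤ k * Real.exp (2 * C.a * C.σ) := by
          gcongr; linarith [ht₁.2]
      _ = K * (Real.exp (2 * C.a * C.σ) / (2 * C.a)) * ‖x a‖ ^ 2 := by simp only [k]; ring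
      _ ≤ C.c₁ * ‖x a‖ ^ 2 := by gcongr
  have hinit : 0 ≤ k * Real.exp (2 * C.a * (a - a)) := by positivity
  rw [hyt₁, inner_zero_right] at hcompare
  linarith [p.inner_nonneg h hl (hsub (right_mem_Icc.2 ht₁.1))]

lemma inner_le_c₁_mul_of_lt (p : S.Problem C a b G) (h : S.IsHam a b x u l) (hl : l b = G (x b))
    (hnear : b < a + C.σ) : ⟪l a, x a⟫_ℝ ≤ C.c₁ * ‖x a‖ ^ 2 := by
  have ha := p.pos.a_pos; have hlQ := p.pos.lQ
  obtain ⟨y, hya, hy⟩ := exists_homogeneous_linear_solution p.le p.cont.A (x a)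
  have hy_traj : S.IsTraj a b y (fun _ => 0) := fun s hs => by simpa using hy s hs
  have hy_sq : ∀ s ∈ Icc a b, ‖y s‖ ^ 2 ≤ ‖x a‖ ^ 2 * Real.exp (2 * C.a * (s - a)) := fun s hs => by
    rw [← mul_exp_sq, ← hya]
    gcongr
    exact norm_le_mul_exp_of_norm_deriv_le hy (fun r hr => ((p.reg r hr).norm_A_le _).trans
      (by gcongr; exact p.pos.lA_le_a)) hs
  set k := C.lQ / (2 * C.a) * ‖x a‖ ^ 2 with hk
  have hcompare := h.inner_le_of_competitor p.pos p.reg p.le hy_traj hya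
    (fun s _ => hasDerivWithinAt_mul_exp k (2 * C.a) a s _)
    (fun s hs => by
      calc S.form s (y s) 0 (y s) 0 = ⟪y s, S.Q s (y s)⟫_ℝ := by simp [form]
        _ ≤ C.lQ * ‖y s‖ ^ 2 := inner_apply_le_of_norm_le (p.reg s hs).boundQ _
        _ ≤ C.lQ * (‖x a‖ ^ 2 * Real.exp (2 * C.a * (s - a))) := by gcongr; exact hy_sq s hs
        _ = k * (2 * C.a * Real.exp (2 * C.a * (s - a))) := by rw [hk]; field_simp)
  have hterminal : 2 * ⟪l b, y b⟫_ℝ - ⟪l b, x b⟫_ℝ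
      ≤ C.lQ * (‖x a‖ ^ 2 * Real.exp (2 * C.a * (b - a))) := by
    rw [hl]
    exact (p.weight.two_mul_inner_sub_le p.pos _ _).trans ((p.weight.upper _).trans
      (by gcongr; exact hy_sq b (right_mem_Icc.2 p.le)))
  have hinit : 0 ≤ k * Real.exp (2 * C.a * (a - a)) := by positivity
  calc ⟪l a, x a⟫_ℝ ≤ C.lQ * (‖x a‖ ^ 2 * Real.exp (2 * C.a * (b - a)))
        + k * Real.exp (2 * C.a * (b - a)) := by linarith
    _ ≤ C.lQ * (‖x a‖ ^ 2 * Real.exp (2 * C.a * C.σ)) + k * Real.exp (2 * C.a * C.σ) := by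
        gcongr <;> linarith
    _ = C.lQ * (Real.exp (2 * C.a * C.σ) + Real.exp (2 * C.a * C.σ) / (2 * C.a)) * ‖x a‖ ^ 2 := by
        rw [hk]; ring
    _ ≤ C.c₁ * ‖x a‖ ^ 2 := by gcongr; exact p.pos.near_le_c₁

lemma c₀_mul_le_inner (p : S.Problem C a b G) (h : S.IsHam a b x u l) (hl : l b = G (x b))
    (ht : t ∈ Icc a b) : C.c₀ * ‖x t‖ ^ 2 ≤ ⟪l t, x t⟫_ℝ :=
  have h' := h.mono (Icc_subset_Icc_left ht.1)
  (le_or_gt (t + C.σ) b).elim ((p.restrict_left ht).c₀_mul_le_inner_of_le h' hl)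
    ((p.restrict_left ht).c₀_mul_le_inner_of_lt h' hl)

lemma inner_le_c₁_mul (p : S.Problem C a b G) (h : S.IsHam a b x u l) (hl : l b = G (x b))
    (ht : t ∈ Icc a b) : ⟪l t, x t⟫_ℝ ≤ C.c₁ * ‖x t‖ ^ 2 :=
  have h' := h.mono (Icc_subset_Icc_left ht.1)
  (le_or_gt (t + C.σ) b).elim ((p.restrict_left ht).inner_le_c₁_mul_of_le h' hl)
    ((p.restrict_left ht).inner_le_c₁_mul_of_lt h' hl)

lemma inner_mul_exp_le (p : S.Problem C a b G) (h : S.IsHam a b x u l) (hl : l b = G (x b)) {r : ℝ}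
    (har : a ≤ r) (hrt : r ≤ t) (htb : t ≤ b) :
    ⟪l t, x t⟫_ℝ * Real.exp (2 * C.ρZ * (t - r)) ≤ ⟪l r, x r⟫_ℝ := by
  have hc₁ := p.pos.c₁_pos; have hgR := p.pos.gR
  have hsub : Icc r t ⊆ Icc a b := Icc_subset_Icc har htb
  have hdissipation : ∀ s ∈ Icc r t,
      2 * C.ρZ * ⟪l s, x s⟫_ℝ ≤ S.form s (x s) (u s) (x s) (u s) := fun s hs => by
    have hstate : C.gQ * ‖x s‖ ^ 2 ≤ S.form s (x s) (u s) (x s) (u s) :=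
      le_trans (le_add_of_nonneg_right (by positivity)) ((p.reg s (hsub hs)).le_form_self _ _)
    refine le_trans ?_ hstate
    rw [show 2 * C.ρZ = C.gQ / C.c₁ by unfold Constants.ρZ; field_simp, div_mul_eq_mul_div,
      div_le_iff₀ hc₁, mul_assoc, mul_comm _ C.c₁]
    exact mul_le_mul_of_nonneg_left (p.inner_le_c₁_mul h hl (hsub hs)) p.pos.gQ.le
  have hmono := sub_le_sub_of_hasDerivWithinAt_le hrt
    (fun s hs => ((h.mono hsub).hasDerivWithinAt_inner (fun s hs => p.reg s (hsub hs))
      (h.mono hsub).traj s hs).mul (hasDerivWithinAt_mul_exp 1 (2 * C.ρZ) r s (Icc r t)))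
    (fun s _ => hasDerivWithinAt_const s _ (0 : ℝ))
    (fun s hs => by
      have := mul_le_mul_of_nonneg_right (hdissipation s hs)
        (Real.exp_pos (2 * C.ρZ * (s - r))).le
      linarith)
  simp only [Pi.mul_apply, sub_self, mul_zero, Real.exp_zero, mul_one, one_mul] at hmono
  linarith

lemma norm_state_le (p : S.Problem C a b G) (h : S.IsHam a b x u l) (hl : l b = G (x b)) {r : ℝ}
    (har : a ≤ r) (hrt : r ≤ t) (htb : t ≤ b) :
    ‖x t‖ ≤ C.cZ * Real.exp (-C.ρZ * (t - r)) * ‖x r‖ := by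
  have hc₀ := p.pos.c₀_pos; have hc₁ := p.pos.c₁_pos; have hcZ := p.pos.cZ_pos
  set e := Real.exp (2 * C.ρZ * (t - r)) with he
  have hvalue : C.c₀ * ‖x t‖ ^ 2 * e ≤ C.c₁ * ‖x r‖ ^ 2 :=
    calc C.c₀ * ‖x t‖ ^ 2 * e ≤ ⟪l t, x t⟫_ℝ * e := by
          gcongr; exact p.c₀_mul_le_inner h hl ⟨har.trans hrt, htb⟩
      _ ≤ ⟪l r, x r⟫_ℝ := p.inner_mul_exp_le h hl har hrt htb
      _ ≤ C.c₁ * ‖x r‖ ^ 2 := p.inner_le_c₁_mul h hl ⟨har, hrt.trans htb⟩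
  have hsq : (C.cZ * Real.exp (-C.ρZ * (t - r)) * ‖x r‖) ^ 2 = C.c₁ / C.c₀ * ‖x r‖ ^ 2 / e := by
    rw [mul_pow, mul_exp_sq, Constants.cZ, Real.sq_sqrt (by positivity), he, mul_neg, neg_mul,
      Real.exp_neg]
    ring
  refine (sq_le_sq₀ (norm_nonneg _) (by positivity)).1 ?_
  rw [hsq, le_div_iff₀ (Real.exp_pos _), div_mul_eq_mul_div, le_div_iff₀ hc₀]
  linarith

end Problem

end RiccatiBounds

end LQOps

/-! ### The Riccati operator and sensitivity to boundary data -/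

lemma opNorm_le_of_isSymmetric_of_inner_le {E : Type*} [NormedAddCommGroup E]
    [InnerProductSpace ℝ E] {P : E →L[ℝ] E} {c : ℝ} (hP : P.IsSymmetric) (hc : 0 ≤ c)
    (hnonneg : ∀ x, 0 ≤ ⟪P x, x⟫_ℝ) (hle : ∀ x, ⟪P x, x⟫_ℝ ≤ c * ‖x‖ ^ 2) : ‖P‖ ≤ c := by
  rw [P.norm_eq_iSup_rayleighQuotient hP]
  refine ciSup_le fun x => ?_
  have hquad : P.reApplyInnerSelf x = ⟪P x, x⟫_ℝ := rfl
  rw [ContinuousLinearMap.rayleighQuotient, hquad,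
    abs_of_nonneg (div_nonneg (hnonneg x) (sq_nonneg _))]
  exact div_le_of_le_mul₀ (sq_nonneg _) hc (hle x)

lemma continuousOn_adjoint {V W : Type*} [NormedAddCommGroup V] [InnerProductSpace ℝ V]
    [CompleteSpace V] [NormedAddCommGroup W] [InnerProductSpace ℝ W] [CompleteSpace W]
    {M : ℝ → V →L[ℝ] W} {s : Set ℝ} (hM : ContinuousOn M s) :
    ContinuousOn (fun t => (M t).adjoint) s :=
  ContinuousLinearMap.adjoint.continuous.comp_continuousOn hM

namespace LQOps

section Flow

variable {E : Type*} [NormedAddCommGroup E] [NormedSpace ℝ E]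

/-- For a flow `(X, Λ)`, the state at time `s` as a function of the state at time `r`. -/
def propagator (X : ℝ → E →L[ℝ] E) (s r : ℝ) : E →L[ℝ] E := X s ∘L Ring.inverse (X r)

/-- For a flow `(X, Λ)`, the adjoint at time `r` as a function of the state at time `r`: the
solution of the Riccati equation. -/
def riccati (X Λ : ℝ → E →L[ℝ] E) (r : ℝ) : E →L[ℝ] E := Λ r ∘L Ring.inverse (X r)

lemma propagator_apply (X : ℝ → E →L[ℝ] E) (s r : ℝ) (ζ : E) :
    propagator X s r ζ = X s (Ring.inverse (X r) ζ) := rfl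

lemma riccati_apply (X Λ : ℝ → E →L[ℝ] E) (r : ℝ) (ζ : E) :
    riccati X Λ r ζ = Λ r (Ring.inverse (X r) ζ) := rfl

end Flow

variable {E U : Type*} [NormedAddCommGroup E] [InnerProductSpace ℝ E] [CompleteSpace E]
  [NormedAddCommGroup U] [InnerProductSpace ℝ U] [CompleteSpace U]
  {S : LQOps E U} {C : Constants} {G : E →L[ℝ] E} {a b t : ℝ} {x l : ℝ → E} {u : ℝ → U}

/-- The control determined by state and adjoint through stationarity. -/
def feedback (S : LQOps E U) (t : ℝ) : E × E →L[ℝ] U :=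
  -(S.Ri t ∘L (S.H t ∘L ContinuousLinearMap.fst ℝ E E
    + (S.B t).adjoint ∘L ContinuousLinearMap.snd ℝ E E))

/-- The coefficient of the linear differential equation that state and adjoint satisfy jointly once
the control is eliminated. -/
def hamGen (S : LQOps E U) (t : ℝ) : E × E →L[ℝ] E × E :=
  (S.A t ∘L ContinuousLinearMap.fst ℝ E E + S.B t ∘L S.feedback t).prod
    (-((S.A t).adjoint ∘L ContinuousLinearMap.snd ℝ E E)
      - S.Q t ∘L ContinuousLinearMap.fst ℝ E E - (S.H t).adjoint ∘L S.feedback t)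

lemma feedback_apply (S : LQOps E U) (t : ℝ) (y z : E) :
    S.feedback t (y, z) = -S.Ri t (S.H t y + (S.B t).adjoint z) := rfl

lemma feedback_apply_add (S : LQOps E U) (t : ℝ) (y z z' : E) :
    S.feedback t (y, z + z') = S.feedback t (y, z) - S.Ri t ((S.B t).adjoint z') := by
  simp only [feedback_apply, map_add]; abel

lemma Cont.hamGen {s : Set ℝ} (h : S.Cont s) : ContinuousOn S.hamGen s := by
  have hfeedback : ContinuousOn S.feedback s :=
    (h.Ri.clm_comp ((h.H.clm_comp continuousOn_const).add
      ((continuousOn_adjoint h.B).clm_comp continuousOn_const))).neg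
  have hstate : ContinuousOn
      (fun t => S.A t ∘L ContinuousLinearMap.fst ℝ E E + S.B t ∘L S.feedback t) s :=
    (h.A.clm_comp continuousOn_const).add (h.B.clm_comp hfeedback)
  have hcostate : ContinuousOn (fun t => -((S.A t).adjoint ∘L ContinuousLinearMap.snd ℝ E E)
      - S.Q t ∘L ContinuousLinearMap.fst ℝ E E - (S.H t).adjoint ∘L S.feedback t) s :=
    (((continuousOn_adjoint h.A).clm_comp continuousOn_const).neg.sub
      (h.Q.clm_comp continuousOn_const)).sub
      ((continuousOn_adjoint h.H).clm_comp hfeedback)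
  exact (ContinuousLinearMap.prodₗᵢ ℝ).continuous.comp_continuousOn (hstate.prodMk hcostate)

lemma IsHam.control_eq (h : S.IsHam a b x u l) (ht : t ∈ Icc a b) (hr : S.RegularAt C t) :
    u t = S.feedback t (x t, l t) := by
  have hRu : S.R t (u t) = -(S.H t (x t) + (S.B t).adjoint (l t)) :=
    eq_neg_of_add_eq_zero_left ((add_assoc _ _ _).symm.trans (h.stat t ht))
  rw [feedback_apply, ← hr.Ri_R (u t), hRu, map_neg]

lemma IsHam.norm_control_le (h : S.IsHam a b x u l) (ht : t ∈ Icc a b) (hr : S.RegularAt C t)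
    (hC : C.Positive) : ‖u t‖ ≤ C.lH / C.gR * ‖x t‖ + C.lB / C.gR * ‖l t‖ := by
  have hgR := hC.gR
  rw [h.control_eq ht hr, feedback_apply, norm_neg]
  calc _ ≤ ‖S.H t (x t) + (S.B t).adjoint (l t)‖ / C.gR := hr.norm_Ri_le hC _
    _ ≤ (C.lH * ‖x t‖ + C.lB * ‖l t‖) / C.gR := by
      gcongr
      exact (norm_add_le _ _).trans (add_le_add (hr.norm_H_le _) (hr.norm_adjoint_B_le _))
    _ = _ := by ring

lemma isHam_of_hasDerivWithinAt_hamGen (hr : ∀ s ∈ Icc a b, S.RegularAt C s) {z : ℝ → E × E}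
    (hz : ∀ s ∈ Icc a b, HasDerivWithinAt z (S.hamGen s (z s)) (Icc a b) s) :
    S.IsHam a b (fun s => (z s).1) (fun s => S.feedback s (z s)) (fun s => (z s).2) where
  traj s hs := (ContinuousLinearMap.fst ℝ E E).hasFDerivAt.comp_hasDerivWithinAt s (hz s hs)
  adj s hs := (ContinuousLinearMap.snd ℝ E E).hasFDerivAt.comp_hasDerivWithinAt s (hz s hs)
  stat s hs := by
    rw [S.feedback_apply s (z s).1 (z s).2, map_neg, (hr s hs).R_Ri]
    abel

/-- An operator solution `(X, Λ)` of the optimality system with final value `(1, G)`: its columns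
are the solutions with terminal condition `λ(b) = G x(b)`. -/
structure IsFlow (S : LQOps E U) (a b : ℝ) (G : E →L[ℝ] E) (X Λ : ℝ → E →L[ℝ] E) : Prop where
  state_end : X b = 1
  adjoint_end : Λ b = G
  deriv_state : ∀ t ∈ Icc a b, HasDerivWithinAt X
    (S.A t ∘L X t + S.B t ∘L S.feedback t ∘L (X t).prod (Λ t)) (Icc a b) t
  isHam : ∀ η, S.IsHam a b (fun t => X t η) (fun t => S.feedback t (X t η, Λ t η))
    (fun t => Λ t η)

theorem exists_isFlow (hab : a ≤ b) (hcont : S.Cont (Icc a b))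
    (hr : ∀ s ∈ Icc a b, S.RegularAt C s) (G : E →L[ℝ] E) : ∃ X Λ, S.IsFlow a b G X Λ := by
  obtain ⟨Ψ, hΨb, hΨ⟩ := exists_homogeneous_linear_solution_right hab
    (M := fun t => ContinuousLinearMap.compL ℝ E (E × E) (E × E) (S.hamGen t))
    ((ContinuousLinearMap.compL ℝ E (E × E) (E × E)).continuous.comp_continuousOn hcont.hamGen)
    ((ContinuousLinearMap.id ℝ E).prod G)
  refine ⟨fun t => ContinuousLinearMap.fst ℝ E E ∘L Ψ t,
    fun t => ContinuousLinearMap.snd ℝ E E ∘L Ψ t, ?_, ?_, fun t ht => ?_, fun η => ?_⟩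
  · rw [hΨb]; rfl
  · rw [hΨb]; rfl
  · exact (ContinuousLinearMap.compL ℝ E (E × E) E
      (ContinuousLinearMap.fst ℝ E E)).hasFDerivAt.comp_hasDerivWithinAt t (hΨ t ht)
  · refine isHam_of_hasDerivWithinAt_hamGen hr (z := fun t => Ψ t η) fun s hs => ?_
    simpa using (hΨ s hs).clm_apply (hasDerivWithinAt_const s (Icc a b) η)

namespace IsFlow

variable {X Λ : ℝ → E →L[ℝ] E} {r s : ℝ}

lemma adjoint_end_apply (hf : S.IsFlow a b G X Λ) (η : E) : Λ b η = G (X b η) := by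
  rw [hf.adjoint_end, hf.state_end]; rfl

lemma isUnit [FiniteDimensional ℝ E] (hf : S.IsFlow a b G X Λ) (p : S.Problem C a b G)
    (hr : r ∈ Icc a b) : IsUnit (X r) := by
  have hinj : Function.Injective (X r) := by
    refine (injective_iff_map_eq_zero (X r)).2 fun η hη => ?_
    have hdecay := p.norm_state_le (hf.isHam η) (hf.adjoint_end_apply η) hr.1 hr.2 le_rfl
    simpa [hη, hf.state_end] using hdecay
  rw [ContinuousLinearMap.isUnit_iff_bijective]
  exact ⟨hinj, LinearMap.injective_iff_surjective.1
    (show Function.Injective (X r : E →ₗ[ℝ] E) from hinj)⟩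

variable [FiniteDimensional ℝ E]

lemma propagator_self (hf : S.IsFlow a b G X Λ) (p : S.Problem C a b G) (hr : r ∈ Icc a b) :
    propagator X r r = 1 :=
  Ring.mul_inverse_cancel _ (hf.isUnit p hr)

lemma propagator_self_apply (hf : S.IsFlow a b G X Λ) (p : S.Problem C a b G) (hr : r ∈ Icc a b)
    (ζ : E) : X r (Ring.inverse (X r) ζ) = ζ :=
  congrArg (fun M : E →L[ℝ] E => M ζ) (hf.propagator_self p hr)

lemma norm_propagator_le (hf : S.IsFlow a b G X Λ) (p : S.Problem C a b G) (har : a ≤ r)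
    (hrs : r ≤ s) (hsb : s ≤ b) : ‖propagator X s r‖ ≤ C.cZ * Real.exp (-C.ρZ * (s - r)) := by
  have hcZ := p.pos.cZ_pos
  refine ContinuousLinearMap.opNorm_le_bound _ (by positivity) fun ζ => ?_
  have hdecay := p.norm_state_le (hf.isHam (Ring.inverse (X r) ζ)) (hf.adjoint_end_apply _)
    har hrs hsb
  rwa [hf.propagator_self_apply p ⟨har, hrs.trans hsb⟩] at hdecay

lemma isSymmetric_riccati (hf : S.IsFlow a b G X Λ) (p : S.Problem C a b G) (hr : r ∈ Icc a b) :
    (riccati X Λ r).IsSymmetric := by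
  intro ζ ζ'
  have hsymplectic := (hf.isHam (Ring.inverse (X r) ζ)).symplectic_eq
    (hf.isHam (Ring.inverse (X r) ζ')) p.reg hr (right_mem_Icc.2 p.le)
  simp only [hf.propagator_self_apply p hr, hf.adjoint_end_apply, p.weight.symm] at hsymplectic
  rw [real_inner_comm _ (X b _), p.weight.symm, sub_self, sub_eq_zero] at hsymplectic
  exact hsymplectic.trans (real_inner_comm _ _)

lemma norm_riccati_le (hf : S.IsFlow a b G X Λ) (p : S.Problem C a b G) (hr : r ∈ Icc a b) :
    ‖riccati X Λ r‖ ≤ C.c₁ := by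
  refine opNorm_le_of_isSymmetric_of_inner_le (hf.isSymmetric_riccati p hr) p.pos.c₁_pos.le
    (fun ζ => ?_) (fun ζ => ?_)
  · simpa only [hf.propagator_self_apply p hr, riccati_apply] using
      p.inner_nonneg (hf.isHam (Ring.inverse (X r) ζ)) (hf.adjoint_end_apply _) hr
  · simpa only [hf.propagator_self_apply p hr, riccati_apply] using
      p.inner_le_c₁_mul (hf.isHam (Ring.inverse (X r) ζ)) (hf.adjoint_end_apply _) hr

lemma adjoint_eq_riccati_add (hf : S.IsFlow a b G X Λ) (p : S.Problem C a b G)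
    (h : S.IsHam a b x u l) {e : E} (hl : l b = G (x b) + e) (hr : r ∈ Icc a b) :
    l r = riccati X Λ r (x r) + (propagator X b r).adjoint e := by
  refine ext_inner_right ℝ fun ζ => ?_
  have hsymplectic := h.symplectic_eq (hf.isHam (Ring.inverse (X r) ζ)) p.reg hr
    (right_mem_Icc.2 p.le)
  have hterminal : ⟪l b, propagator X b r ζ⟫_ℝ - ⟪G (propagator X b r ζ), x b⟫_ℝ
      = ⟪e, propagator X b r ζ⟫_ℝ := by
    rw [hl, inner_add_left, p.weight.symm (x b), real_inner_comm (x b), add_sub_cancel_left]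
  have hpair : ⟪l r, ζ⟫_ℝ - ⟪riccati X Λ r ζ, x r⟫_ℝ = ⟪e, propagator X b r ζ⟫_ℝ := by
    rw [← hterminal]
    simpa only [hf.propagator_self_apply p hr, hf.adjoint_end_apply, propagator_apply,
      riccati_apply] using hsymplectic
  have hsymm : ⟪riccati X Λ r (x r), ζ⟫_ℝ = ⟪riccati X Λ r ζ, x r⟫_ℝ :=
    (hf.isSymmetric_riccati p hr (x r) ζ).trans (real_inner_comm _ _)
  rw [inner_add_left, ContinuousLinearMap.adjoint_inner_left, ← hpair, hsymm]
  ring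

lemma norm_adjoint_propagator_le (hf : S.IsFlow a b G X Λ) (p : S.Problem C a b G)
    (hr : r ∈ Icc a b) (e : E) :
    ‖(propagator X b r).adjoint e‖ ≤ C.cZ * Real.exp (-C.ρZ * (b - r)) * ‖e‖ :=
  (propagator X b r).adjoint.le_of_opNorm_le
    ((ContinuousLinearMap.adjoint.norm_map _).trans_le
      (hf.norm_propagator_le p hr.1 hr.2 le_rfl)) e

lemma hasDerivWithinAt_propagator (hf : S.IsFlow a b G X Λ) (p : S.Problem C a b G)
    (h : S.IsHam a b x u l) {e : E} (hl : l b = G (x b) + e) (hr : r ∈ Icc a b) :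
    HasDerivWithinAt (fun r => propagator X t r (x r))
      (-propagator X t r (S.B r (S.Ri r ((S.B r).adjoint ((propagator X b r).adjoint e)))))
      (Icc a b) r := by
  have hcontrol : u r = S.feedback r (x r, riccati X Λ r (x r))
      - S.Ri r ((S.B r).adjoint ((propagator X b r).adjoint e)) := by
    rw [h.control_eq hr (p.reg r hr), hf.adjoint_eq_riccati_add p h hl hr, feedback_apply_add]
  have hinv := hasDerivWithinAt_ringInverse (hf.deriv_state r hr) (hf.isUnit p hr)
  convert! (X t).hasFDerivAt.comp_hasDerivWithinAt r (hinv.clm_apply (h.traj r hr)) using 1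
  rw [hcontrol]
  simp only [propagator, riccati, neg_apply, mul_apply_eq_comp, add_apply,
    ContinuousLinearMap.comp_apply, ContinuousLinearMap.prod_apply,
    hf.propagator_self_apply p hr, map_sub, map_add, map_neg]
  abel

lemma norm_propagator_source_le (hf : S.IsFlow a b G X Λ) (p : S.Problem C a b G) (har : a ≤ r)
    (hrt : r ≤ t) (htb : t ≤ b) (e : E) :
    ‖propagator X t r (S.B r (S.Ri r ((S.B r).adjoint ((propagator X b r).adjoint e))))‖
      ≤ C.cZ ^ 2 * C.lB ^ 2 / C.gR
        * (Real.exp (-C.ρZ * (t - r)) * Real.exp (-C.ρZ * (b - r))) * ‖e‖ := by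
  have hr : r ∈ Icc a b := ⟨har, hrt.trans htb⟩
  have hreg := p.reg r hr
  have hgR := p.pos.gR; have hlB := p.pos.lB; have hcZ := p.pos.cZ_pos
  calc _ ≤ C.cZ * Real.exp (-C.ρZ * (t - r))
        * ‖S.B r (S.Ri r ((S.B r).adjoint ((propagator X b r).adjoint e)))‖ :=
      ContinuousLinearMap.le_of_opNorm_le _ (hf.norm_propagator_le p har hrt htb) _
    _ ≤ C.cZ * Real.exp (-C.ρZ * (t - r))
        * (C.lB * (C.lB * (C.cZ * Real.exp (-C.ρZ * (b - r)) * ‖e‖) / C.gR)) := by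
      gcongr
      refine (hreg.norm_B_le _).trans ?_
      gcongr
      refine (hreg.norm_Ri_le p.pos _).trans ?_
      gcongr
      refine (hreg.norm_adjoint_B_le _).trans ?_
      gcongr
      exact hf.norm_adjoint_propagator_le p hr e
    _ = _ := by ring

end IsFlow

namespace Problem

variable [FiniteDimensional ℝ E]

theorem norm_adjoint_le_add (p : S.Problem C a b G) (h : S.IsHam a b x u l) {e : E}
    (hl : l b = G (x b) + e) (ht : t ∈ Icc a b) :
    ‖l t‖ ≤ C.c₁ * ‖x t‖ + C.cZ * Real.exp (-C.ρZ * (b - t)) * ‖e‖ := by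
  obtain ⟨X, Λ, hf⟩ := exists_isFlow p.le p.cont p.reg G
  rw [hf.adjoint_eq_riccati_add p h hl ht]
  exact (norm_add_le _ _).trans (add_le_add
    ((riccati X Λ t).le_of_opNorm_le (hf.norm_riccati_le p ht) _)
    (hf.norm_adjoint_propagator_le p ht e))

theorem norm_state_le_add (p : S.Problem C a b G) (h : S.IsHam a b x u l) {e : E}
    (hl : l b = G (x b) + e) (ht : t ∈ Icc a b) :
    ‖x t‖ ≤ C.cZ * Real.exp (-C.ρZ * (t - a)) * ‖x a‖
      + C.cZ ^ 2 * C.lB ^ 2 / (2 * C.ρZ * C.gR) * Real.exp (-C.ρZ * (b - t)) * ‖e‖ := by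
  have hgR := p.pos.gR; have hlB := p.pos.lB; have hρ := p.pos.ρZ_pos; have hcZ := p.pos.cZ_pos
  obtain ⟨X, Λ, hf⟩ := exists_isFlow p.le p.cont p.reg G
  set k := C.cZ ^ 2 * C.lB ^ 2 / (2 * C.ρZ * C.gR) * ‖e‖ with hk
  have hsub : Icc a t ⊆ Icc a b := Icc_subset_Icc_right ht.2
  have hderiv := fun r (hr : r ∈ Icc a t) =>
    (hf.hasDerivWithinAt_propagator p h hl (t := t) (hsub hr)).mono hsub
  have hspeed : ∀ r ∈ Icc a t,
      ‖-propagator X t r (S.B r (S.Ri r ((S.B r).adjoint ((propagator X b r).adjoint e))))‖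
        ≤ k * (2 * C.ρZ * Real.exp (2 * C.ρZ * (r - (t + b) / 2))) := fun r hr => by
    have hexp : Real.exp (2 * C.ρZ * (r - (t + b) / 2))
        = Real.exp (-C.ρZ * (t - r)) * Real.exp (-C.ρZ * (b - r)) := by
      rw [← Real.exp_add]; congr 1; ring
    rw [norm_neg, hexp]
    exact (hf.norm_propagator_source_le p hr.1 hr.2 ht.2 e).trans_eq (by rw [hk]; field_simp)
  have hinit : ‖propagator X t a (x a)‖ ≤ C.cZ * Real.exp (-C.ρZ * (t - a)) * ‖x a‖
      + k * Real.exp (2 * C.ρZ * (a - (t + b) / 2)) :=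
    (ContinuousLinearMap.le_of_opNorm_le _ (hf.norm_propagator_le p le_rfl ht.1 ht.2) _).trans
      (le_add_of_nonneg_right (by positivity))
  have hbound := image_norm_le_of_norm_deriv_right_le_deriv_boundary'
    (fun r hr => (hderiv r hr).continuousWithinAt)
    (fun r hr => hasDerivWithinAt_Ici_of_Icc (hderiv r (Ico_subset_Icc_self hr)) hr) hinit
    (by fun_prop) (fun r _ => (hasDerivWithinAt_mul_exp _ _ _ _ _).const_add _)
    (fun r hr => hspeed r (Ico_subset_Icc_self hr)) (right_mem_Icc.2 ht.1)
  rw [hf.propagator_self p ht, show 2 * C.ρZ * (t - (t + b) / 2) = -C.ρZ * (b - t) by ring]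
    at hbound
  exact hbound.trans_eq (by rw [hk]; ring)

lemma norm_state_le_max_mul (p : S.Problem C a b G) (h : S.IsHam a b x u l) {e : E}
    (hl : l b = G (x b) + e) {q : ℝ} (he : ‖e‖ ≤ C.lQ * q) (ht : t ∈ Icc a b) :
    ‖x t‖ ≤ max C.cZ (C.cZ ^ 2 * C.lB ^ 2 * C.lQ / (2 * C.ρZ * C.gR))
      * (Real.exp (-C.ρZ * (t - a)) * ‖x a‖ + Real.exp (-C.ρZ * (b - t)) * q) := by
  have hgR := p.pos.gR; have hρ := p.pos.ρZ_pos
  have hq : 0 ≤ q := nonneg_of_mul_nonneg_right ((norm_nonneg e).trans he) p.pos.lQ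
  set M := max C.cZ (C.cZ ^ 2 * C.lB ^ 2 * C.lQ / (2 * C.ρZ * C.gR))
  calc ‖x t‖ ≤ C.cZ * Real.exp (-C.ρZ * (t - a)) * ‖x a‖
        + C.cZ ^ 2 * C.lB ^ 2 / (2 * C.ρZ * C.gR) * Real.exp (-C.ρZ * (b - t)) * ‖e‖ :=
      p.norm_state_le_add h hl ht
    _ ≤ C.cZ * Real.exp (-C.ρZ * (t - a)) * ‖x a‖
        + C.cZ ^ 2 * C.lB ^ 2 / (2 * C.ρZ * C.gR) * Real.exp (-C.ρZ * (b - t)) * (C.lQ * q) := by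
      gcongr
    _ = C.cZ * (Real.exp (-C.ρZ * (t - a)) * ‖x a‖)
        + C.cZ ^ 2 * C.lB ^ 2 * C.lQ / (2 * C.ρZ * C.gR)
          * (Real.exp (-C.ρZ * (b - t)) * q) := by ring
    _ ≤ M * (Real.exp (-C.ρZ * (t - a)) * ‖x a‖) + M * (Real.exp (-C.ρZ * (b - t)) * q) := by
      gcongr <;> simp [M]
    _ = _ := by ring

lemma norm_adjoint_le_max_mul (p : S.Problem C a b G) (h : S.IsHam a b x u l) {e : E}
    (hl : l b = G (x b) + e) {q : ℝ} (he : ‖e‖ ≤ C.lQ * q) (ht : t ∈ Icc a b) :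
    ‖l t‖ ≤ (C.c₁ + C.lQ) * (max C.cZ (C.cZ ^ 2 * C.lB ^ 2 * C.lQ / (2 * C.ρZ * C.gR))
      * (Real.exp (-C.ρZ * (t - a)) * ‖x a‖ + Real.exp (-C.ρZ * (b - t)) * q)) := by
  have hlQ := p.pos.lQ; have hc₁ := p.pos.c₁_pos; have hcZ := p.pos.cZ_pos
  have : 0 ≤ q := nonneg_of_mul_nonneg_right ((norm_nonneg e).trans he) hlQ
  set δ := Real.exp (-C.ρZ * (t - a)) * ‖x a‖ + Real.exp (-C.ρZ * (b - t)) * q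
  set M := max C.cZ (C.cZ ^ 2 * C.lB ^ 2 * C.lQ / (2 * C.ρZ * C.gR))
  have : 0 < M := lt_max_of_lt_left hcZ
  have hqδ : Real.exp (-C.ρZ * (b - t)) * q ≤ δ := le_add_of_nonneg_left (by positivity)
  have hstate : ‖x t‖ ≤ M * δ := p.norm_state_le_max_mul h hl he ht
  calc ‖l t‖ ≤ C.c₁ * ‖x t‖ + C.cZ * Real.exp (-C.ρZ * (b - t)) * ‖e‖ :=
        p.norm_adjoint_le_add h hl ht
    _ ≤ C.c₁ * (M * δ) + M * Real.exp (-C.ρZ * (b - t)) * (C.lQ * q) := by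
        gcongr; exact le_max_left _ _
    _ = C.c₁ * (M * δ) + C.lQ * (M * (Real.exp (-C.ρZ * (b - t)) * q)) := by ring
    _ ≤ C.c₁ * (M * δ) + C.lQ * (M * δ) := by gcongr
    _ = _ := by ring

theorem norm_le_Λb_mul (p : S.Problem C a b G) (h : S.IsHam a b x u l) {e : E}
    (hl : l b = G (x b) + e) {q : ℝ} (he : ‖e‖ ≤ C.lQ * q) (ht : t ∈ Icc a b) :
    max (max ‖x t‖ ‖u t‖) ‖l t‖
      ≤ C.Λb * (Real.exp (-C.ρZ * (t - a)) * ‖x a‖ + Real.exp (-C.ρZ * (b - t)) * q) := by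
  have hgR := p.pos.gR; have hlB := p.pos.lB; have hlH := p.pos.lH; have hlQ := p.pos.lQ
  have hc₁ := p.pos.c₁_pos
  have hstate := p.norm_state_le_max_mul h hl he ht
  have hadjoint := p.norm_adjoint_le_max_mul h hl he ht
  set δ := Real.exp (-C.ρZ * (t - a)) * ‖x a‖ + Real.exp (-C.ρZ * (b - t)) * q
  set M := max C.cZ (C.cZ ^ 2 * C.lB ^ 2 * C.lQ / (2 * C.ρZ * C.gR)) with hM
  have hcontrol : ‖u t‖ ≤ C.lH / C.gR * (M * δ) + C.lB / C.gR * ((C.c₁ + C.lQ) * (M * δ)) :=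
    (h.norm_control_le ht (p.reg t ht) p.pos).trans (by gcongr)
  have hΛb : C.Λb * δ = M * δ + C.lH / C.gR * (M * δ) + (C.c₁ + C.lQ) * (M * δ)
      + C.lB / C.gR * ((C.c₁ + C.lQ) * (M * δ)) := by
    rw [hM, Constants.Λb]; ring
  have : 0 ≤ M * δ := (norm_nonneg _).trans hstate
  have : 0 ≤ C.lH / C.gR * (M * δ) := by positivity
  have : 0 ≤ (C.c₁ + C.lQ) * (M * δ) := by positivity
  have : 0 ≤ C.lB / C.gR * ((C.c₁ + C.lQ) * (M * δ)) := by positivity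
  rw [hΛb]
  exact max_le (max_le (by linarith) (by linarith)) (by linarith)

end Problem

end LQOps

/-! ### Minimum-energy steering -/

namespace LQOps

variable {E U : Type*} [NormedAddCommGroup E] [InnerProductSpace ℝ E] [CompleteSpace E]
  [NormedAddCommGroup U] [InnerProductSpace ℝ U] [CompleteSpace U]
  {S : LQOps E U} {C : Constants} {t t₁ s : ℝ} {F N W : ℝ → E →L[ℝ] E}

/-- The data of minimum-energy steering to the origin at time `t₁`: the evolution operators
`F s = Φ(s, t)` and `N s = Φ(t, s)`, and the controllability Gramian `W s` over `[s, t₁]`,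
transported to time `t`. -/
structure IsSteering (S : LQOps E U) (t t₁ : ℝ) (F N W : ℝ → E →L[ℝ] E) : Prop where
  le : t ≤ t₁
  deriv_evolution : ∀ s ∈ Icc t t₁, HasDerivWithinAt F (S.A s * F s) (Icc t t₁) s
  deriv_inverse : ∀ s ∈ Icc t t₁, HasDerivWithinAt N (-(N s * S.A s)) (Icc t t₁) s
  evolution_mul_inverse : ∀ s ∈ Icc t t₁, F s * N s = 1
  evolution_init : F t = 1
  inverse_init : N t = 1
  deriv_gramian : ∀ s ∈ Icc t t₁, HasDerivWithinAt W
    (-(N s ∘L S.B s ∘L (S.B s).adjoint ∘L (N s).adjoint)) (Icc t t₁) s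
  gramian_end : W t₁ = 0

namespace IsSteering

lemma norm_evolution_le (h : S.IsSteering t t₁ F N W) (hr : ∀ s ∈ Icc t t₁, S.RegularAt C s)
    (hs : s ∈ Icc t t₁) : ‖F s‖ ≤ Real.exp (C.lA * (s - t)) := by
  have hgrowth := norm_le_mul_exp_of_norm_deriv_le h.deriv_evolution (k := C.lA) (fun r hrI =>
    (norm_mul_le _ _).trans (by gcongr; exact (hr r hrI).boundA)) hs
  rw [h.evolution_init] at hgrowth
  exact hgrowth.trans
    (mul_le_of_le_one_left (Real.exp_pos _).le ContinuousLinearMap.norm_id_le)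

lemma norm_inverse_le (h : S.IsSteering t t₁ F N W) (hr : ∀ s ∈ Icc t t₁, S.RegularAt C s)
    (hs : s ∈ Icc t t₁) : ‖N s‖ ≤ Real.exp (C.lA * (s - t)) := by
  have hgrowth := norm_le_mul_exp_of_norm_deriv_le h.deriv_inverse (k := C.lA) (fun r hrI => by
    rw [norm_neg, mul_comm C.lA]
    exact (norm_mul_le _ _).trans (by gcongr; exact (hr r hrI).boundA)) hs
  rw [h.inverse_init] at hgrowth
  exact hgrowth.trans
    (mul_le_of_le_one_left (Real.exp_pos _).le ContinuousLinearMap.norm_id_le)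

lemma norm_control_le (h : S.IsSteering t t₁ F N W) (hC : C.Positive)
    (hr : ∀ s ∈ Icc t t₁, S.RegularAt C s) (hs : s ∈ Icc t t₁) (η : E) :
    ‖(S.B s).adjoint ((N s).adjoint η)‖ ≤ C.lB * (Real.exp (C.lA * (s - t)) * ‖η‖) := by
  have := hC.lB
  refine ((hr s hs).norm_adjoint_B_le _).trans ?_
  gcongr
  exact (N s).adjoint.le_of_opNorm_le
    ((ContinuousLinearMap.adjoint.norm_map (N s)).trans_le (h.norm_inverse_le hr hs)) η

lemma hasDerivWithinAt_gramian_apply (h : S.IsSteering t t₁ F N W) (hs : s ∈ Icc t t₁) (η : E) :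
    HasDerivWithinAt (fun s => W s η)
      (-N s (S.B s ((S.B s).adjoint ((N s).adjoint η)))) (Icc t t₁) s := by
  simpa using (h.deriv_gramian s hs).clm_apply (hasDerivWithinAt_const s (Icc t t₁) η)

lemma hasDerivWithinAt_inner_gramian (h : S.IsSteering t t₁ F N W) (hs : s ∈ Icc t t₁) (η ζ : E) :
    HasDerivWithinAt (fun s => ⟪W s η, ζ⟫_ℝ)
      (-⟪(S.B s).adjoint ((N s).adjoint η), (S.B s).adjoint ((N s).adjoint ζ)⟫_ℝ)
      (Icc t t₁) s := by
  convert! (h.hasDerivWithinAt_gramian_apply hs η).inner ℝ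
    (hasDerivWithinAt_const s (Icc t t₁) ζ) using 1
  simp only [inner_zero_right, zero_add, inner_neg_left, ContinuousLinearMap.adjoint_inner_right]

lemma isSymmetric_gramian (h : S.IsSteering t t₁ F N W) (hs : s ∈ Icc t t₁) :
    (W s).IsSymmetric := by
  intro η ζ
  have hconst := eq_of_hasDerivWithinAt_zero (f := fun s => ⟪W s η, ζ⟫_ℝ - ⟪W s ζ, η⟫_ℝ)
    (fun r hr => by
      convert! (h.hasDerivWithinAt_inner_gramian hr η ζ).sub
        (h.hasDerivWithinAt_inner_gramian hr ζ η) using 1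
      rw [real_inner_comm]; ring)
    hs (right_mem_Icc.2 h.le)
  simp only [h.gramian_end, zero_apply, inner_zero_left, sub_self] at hconst
  exact (sub_eq_zero.1 hconst).trans (real_inner_comm _ _)

lemma inner_gramian_antitone (h : S.IsSteering t t₁ F N W) (η : E) {r : ℝ} (htr : t ≤ r)
    (hrs : r ≤ s) (hs : s ≤ t₁) : ⟪W s η, η⟫_ℝ ≤ ⟪W r η, η⟫_ℝ := by
  have hsub : Icc r s ⊆ Icc t t₁ := Icc_subset_Icc htr hs
  have hmono := sub_le_sub_of_hasDerivWithinAt_le hrs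
    (fun q hq => (h.hasDerivWithinAt_inner_gramian (hsub hq) η η).mono hsub)
    (fun q _ => hasDerivWithinAt_const q _ (0 : ℝ))
    (fun q _ => neg_nonpos.2 real_inner_self_nonneg)
  linarith

lemma inner_gramian_nonneg (h : S.IsSteering t t₁ F N W) (hs : s ∈ Icc t t₁) (η : E) :
    0 ≤ ⟪W s η, η⟫_ℝ := by
  simpa only [h.gramian_end, zero_apply, inner_zero_left] using
    h.inner_gramian_antitone η hs.1 hs.2 le_rfl

lemma norm_gramian_le (h : S.IsSteering t t₁ F N W) {m : ℝ} (hm : 0 ≤ m)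
    (hW : ∀ η, ⟪W t η, η⟫_ℝ ≤ m * ‖η‖ ^ 2) (hs : s ∈ Icc t t₁) : ‖W s‖ ≤ m :=
  opNorm_le_of_isSymmetric_of_inner_le (h.isSymmetric_gramian hs) hm (h.inner_gramian_nonneg hs)
    fun η => (h.inner_gramian_antitone η le_rfl hs.1 hs.2).trans (hW η)

lemma inner_gramian_init_le (h : S.IsSteering t t₁ F N W) (hC : C.Positive)
    (ht₁ : t₁ ≤ t + C.σ) (hr : ∀ s ∈ Icc t t₁, S.RegularAt C s) (η : E) :
    ⟪W t η, η⟫_ℝ ≤ C.lB ^ 2 * ((Real.exp (2 * C.lA * C.σ) - 1) / (2 * C.lA)) * ‖η‖ ^ 2 := by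
  have := hC.lA
  set k := C.lB ^ 2 * ‖η‖ ^ 2 / (2 * C.lA) with hk
  have hgrowth := sub_le_sub_of_hasDerivWithinAt_le h.le
    (fun s hs => (h.hasDerivWithinAt_inner_gramian hs η η).neg)
    (fun s _ => hasDerivWithinAt_mul_exp k (2 * C.lA) t s (Icc t t₁))
    (fun s hs => by
      rw [neg_neg, real_inner_self_eq_norm_sq]
      calc ‖(S.B s).adjoint ((N s).adjoint η)‖ ^ 2
          ≤ (C.lB * (Real.exp (C.lA * (s - t)) * ‖η‖)) ^ 2 := by
            gcongr; exact h.norm_control_le hC hr hs η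
        _ = (C.lB * ‖η‖ * Real.exp (C.lA * (s - t))) ^ 2 := by ring
        _ = k * (2 * C.lA * Real.exp (2 * C.lA * (s - t))) := by rw [mul_exp_sq, hk]; field_simp)
  simp only [Pi.neg_apply, h.gramian_end, zero_apply, inner_zero_left, sub_self, mul_zero,
    Real.exp_zero, neg_zero, zero_sub, neg_neg] at hgrowth
  calc ⟪W t η, η⟫_ℝ ≤ k * Real.exp (2 * C.lA * (t₁ - t)) - k * 1 := hgrowth
    _ ≤ k * Real.exp (2 * C.lA * C.σ) - k * 1 := by gcongr; linarith
    _ = _ := by rw [hk]; ring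

lemma isTraj (h : S.IsSteering t t₁ F N W) (η : E) :
    S.IsTraj t t₁ (fun s => F s (W s η)) (fun s => -(S.B s).adjoint ((N s).adjoint η)) := by
  intro s hs
  convert! (h.deriv_evolution s hs).clm_apply (h.hasDerivWithinAt_gramian_apply hs η) using 1
  have hcancel : ∀ z, F s (N s z) = z := fun z =>
    congrArg (fun M : E →L[ℝ] E => M z) (h.evolution_mul_inverse s hs)
  simp only [map_neg, hcancel, mul_apply_eq_comp]

lemma norm_state_le (h : S.IsSteering t t₁ F N W) (hC : C.Positive)
    (hr : ∀ s ∈ Icc t t₁, S.RegularAt C s) {m : ℝ} (hm : 0 ≤ m)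
    (hW : ∀ η, ⟪W t η, η⟫_ℝ ≤ m * ‖η‖ ^ 2) (hs : s ∈ Icc t t₁) (η : E) :
    ‖F s (W s η)‖ ≤ m * (Real.exp (C.a * (s - t)) * ‖η‖) := by
  have hst := hs.1
  calc ‖F s (W s η)‖ ≤ Real.exp (C.a * (s - t)) * ‖W s η‖ := by
        refine (F s).le_of_opNorm_le ((h.norm_evolution_le hr hs).trans ?_) _
        gcongr
        exact hC.lA_le_a
    _ ≤ Real.exp (C.a * (s - t)) * (m * ‖η‖) := by
        gcongr; exact (W s).le_of_opNorm_le (h.norm_gramian_le hm hW hs) _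
    _ = _ := by ring

lemma norm_shifted_sq_le (h : S.IsSteering t t₁ F N W) (hC : C.Positive)
    (hr : ∀ s ∈ Icc t t₁, S.RegularAt C s) (hup : ∀ η, ⟪W t η, η⟫_ℝ ≤ C.α₁ * ‖η‖ ^ 2)
    (hs : s ∈ Icc t t₁) (η : E) :
    ‖S.shifted s (F s (W s η)) (-(S.B s).adjoint ((N s).adjoint η))‖ ^ 2
      ≤ (2 * C.lB ^ 2 + 2 * (C.lH / C.gR * C.α₁) ^ 2)
        * (Real.exp (C.a * (s - t)) * ‖η‖) ^ 2 := by
  have hst := hs.1; have hgR := hC.gR; have hlB := hC.lB; have hlH := hC.lH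
  set ε := Real.exp (C.a * (s - t)) * ‖η‖
  have hcontrol : ‖-(S.B s).adjoint ((N s).adjoint η)‖ ≤ C.lB * ε := by
    rw [norm_neg]
    refine (h.norm_control_le hC hr hs η).trans ?_
    simp only [ε]
    gcongr
    exact hC.lA_le_a
  have hshift : ‖S.Ri s (S.H s (F s (W s η)))‖ ≤ C.lH / C.gR * (C.α₁ * ε) :=
    ((hr s hs).norm_Ri_H_le hC _).trans (by gcongr; exact h.norm_state_le hC hr hC.α₁.le hup hs η)
  calc ‖S.shifted s (F s (W s η)) (-(S.B s).adjoint ((N s).adjoint η))‖ ^ 2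
      ≤ (C.lB * ε + C.lH / C.gR * (C.α₁ * ε)) ^ 2 := by
        gcongr; exact (norm_add_le _ _).trans (add_le_add hcontrol hshift)
    _ ≤ 2 * ((C.lB * ε) ^ 2 + (C.lH / C.gR * (C.α₁ * ε)) ^ 2) := add_sq_le
    _ = _ := by ring

lemma cost_le (h : S.IsSteering t t₁ F N W) (hC : C.Positive) (ht₁ : t₁ ≤ t + C.σ)
    (hr : ∀ s ∈ Icc t t₁, S.RegularAt C s) (hup : ∀ η, ⟪W t η, η⟫_ℝ ≤ C.α₁ * ‖η‖ ^ 2)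
    (hs : s ∈ Icc t t₁) {η ξ : E} (hη : ‖η‖ ≤ ‖ξ‖ / C.α₀) :
    S.form s (F s (W s η)) (-(S.B s).adjoint ((N s).adjoint η))
        (F s (W s η)) (-(S.B s).adjoint ((N s).adjoint η))
      ≤ C.steerCost * Real.exp (2 * C.a * (s - t)) * ‖ξ‖ ^ 2 := by
  have hlQ := hC.lQ; have hlR := hC.lR; have hα₁' := hC.α₁'_pos
  set ε := Real.exp (C.a * (s - t)) with hε
  have hinit : ∀ ζ, ⟪W t ζ, ζ⟫_ℝ ≤ C.α₁' * ‖ζ‖ ^ 2 := fun ζ => by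
    refine (h.inner_gramian_init_le hC ht₁ hr ζ).trans ?_
    rw [Constants.α₁', mul_div_assoc, show 2 * C.σ * C.a = 2 * C.a * C.σ by ring]
    exact mul_le_mul_of_nonneg_right
      (mul_le_mul_of_nonneg_left hC.exp_sub_one_div_mono (sq_nonneg _)) (sq_nonneg _)
  have hstate := h.norm_state_le hC hr hα₁'.le hinit hs η
  refine ((hr s hs).form_self_le hC _ _).trans ?_
  calc _ ≤ C.lQ * (C.α₁' * (ε * ‖η‖)) ^ 2
        + C.lR * ((2 * C.lB ^ 2 + 2 * (C.lH / C.gR * C.α₁) ^ 2) * (ε * ‖η‖) ^ 2) := by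
        gcongr
        exact h.norm_shifted_sq_le hC hr hup hs η
    _ ≤ C.lQ * (C.α₁' * (ε * (‖ξ‖ / C.α₀))) ^ 2
        + C.lR * ((2 * C.lB ^ 2 + 2 * (C.lH / C.gR * C.α₁) ^ 2) * (ε * (‖ξ‖ / C.α₀)) ^ 2) := by
        gcongr
    _ = C.steerCost * ε ^ 2 * ‖ξ‖ ^ 2 := by unfold Constants.steerCost; ring
    _ = _ := by rw [hε, ← Real.exp_nat_mul]; congr 3; push_cast; ring

theorem steersToZero [FiniteDimensional ℝ E] (h : S.IsSteering t t₁ F N W) (hC : C.Positive)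
    (ht₁ : t₁ ≤ t + C.σ) (hr : ∀ s ∈ Icc t t₁, S.RegularAt C s)
    (hlow : ∀ η, C.α₀ * ‖η‖ ^ 2 ≤ ⟪W t η, η⟫_ℝ)
    (hup : ∀ η, ⟪W t η, η⟫_ℝ ≤ C.α₁ * ‖η‖ ^ 2) : S.SteersToZero C t := by
  have hα₀ := hC.α₀
  have hnorm : ∀ η, ‖η‖ ≤ ‖W t η‖ / C.α₀ := fun η =>
    norm_le_div_of_mul_norm_sq_le_inner hα₀ ((hlow η).trans_eq (real_inner_comm _ _))
  have hinj : Function.Injective (W t) := by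
    refine (injective_iff_map_eq_zero (W t)).2 fun η hη => ?_
    simpa [hη] using hnorm η
  intro ξ
  obtain ⟨η, rfl⟩ := LinearMap.injective_iff_surjective.1
    (show Function.Injective (W t : E →ₗ[ℝ] E) from hinj) ξ
  rcases eq_or_ne η 0 with rfl | hη
  · refine ⟨t, ⟨le_rfl, by linarith [hC.σ]⟩, fun _ => 0, fun _ => 0, 0, fun s _ => ?_,
      (map_zero _).symm, rfl, le_rfl, by simpa using hC.c₁_pos.le, fun s _ => by simp [form]⟩
    simpa using hasDerivWithinAt_const s (Icc t t) (0 : E)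
  · have hα₀_le : C.α₀ ≤ C.lB ^ 2 * ((Real.exp (2 * C.lA * C.σ) - 1) / (2 * C.lA)) :=
      le_of_mul_le_mul_right ((hlow η).trans (h.inner_gramian_init_le hC ht₁ hr η))
        (by positivity)
    exact ⟨t₁, ⟨h.le, ht₁⟩, fun s => F s (W s η), fun s => -(S.B s).adjoint ((N s).adjoint η),
      C.steerCost, h.isTraj η, by simp [h.evolution_init], by simp [h.gramian_end],
      hC.steerCost_pos.le, hC.steerCost_mul_le_c₁ hα₀_le,
      fun s hs => h.cost_le hC ht₁ hr hup hs (hnorm η)⟩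

end IsSteering

end LQOps

/-! ### Optimal pairs satisfy the optimality system -/

lemma eq_zero_of_forall_nonneg_quadratic {p q : ℝ} (h : ∀ ε : ℝ, 0 ≤ ε * p + ε ^ 2 * q) :
    p = 0 := by
  have hdiscrim := discrim_le_zero (a := q) (b := p) (c := 0) fun ε => by linarith [h ε, sq ε]
  unfold discrim at hdiscrim
  nlinarith [sq_nonneg p]

namespace LQOps

variable {E U : Type*} [NormedAddCommGroup E] [InnerProductSpace ℝ E]
  [NormedAddCommGroup U] [InnerProductSpace ℝ U]
  {S : LQOps E U} {C : Constants} {a b : ℝ} {x y l : ℝ → E} {u w : ℝ → U}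
  {G : E →L[ℝ] E} {g : E}

lemma RegularAt.form_add_smul {t : ℝ} (h : S.RegularAt C t) (x : E) (u : U) (y : E) (w : U)
    (ε : ℝ) :
    S.form t (x + ε • y) (u + ε • w) (x + ε • y) (u + ε • w)
      = S.form t x u x u + 2 * ε * S.form t x u y w + ε ^ 2 * S.form t y w y w := by
  have hexpand : S.form t (x + ε • y) (u + ε • w) (x + ε • y) (u + ε • w)
      = S.form t x u x u + ε * S.form t x u y w + ε * S.form t y w x u
        + ε ^ 2 * S.form t y w y w := by
    simp only [form, map_add, map_smul, inner_add_left, inner_add_right, inner_smul_left,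
      inner_smul_right, RCLike.conj_to_real]
    ring
  rw [hexpand, ← h.form_comm x u y w]
  ring

/-- The cost functional on `[a, b]` with terminal cost `½ ⟪y, G y⟫ - ⟪y, g⟫`. -/
def quadCost (S : LQOps E U) (a b : ℝ) (G : E →L[ℝ] E) (g : E) (x : ℝ → E) (u : ℝ → U) : ℝ :=
  (1 / 2) * (∫ t in a..b, S.form t (x t) (u t) (x t) (u t))
    + ((1 / 2) * ⟪x b, G (x b)⟫_ℝ - ⟪x b, g⟫_ℝ)

lemma integral_form_add_smul (hab : a ≤ b) (hc : S.Cont (Icc a b))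
    (hr : ∀ s ∈ Icc a b, S.RegularAt C s) (hx : ContinuousOn x (Icc a b))
    (hu : ContinuousOn u (Icc a b)) (hy : ContinuousOn y (Icc a b)) (hw : ContinuousOn w (Icc a b))
    (ε : ℝ) :
    ∫ t in a..b, S.form t (x t + ε • y t) (u t + ε • w t) (x t + ε • y t) (u t + ε • w t)
      = (∫ t in a..b, S.form t (x t) (u t) (x t) (u t))
        + 2 * ε * (∫ t in a..b, S.form t (x t) (u t) (y t) (w t))
        + ε ^ 2 * ∫ t in a..b, S.form t (y t) (w t) (y t) (w t) := by
  rw [← uIcc_of_le hab] at hc hr hx hu hy hw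
  have hxx := (hc.form hx hu hx hu).intervalIntegrable (μ := volume)
  have hxy := (hc.form hx hu hy hw).intervalIntegrable (μ := volume)
  have hyy := (hc.form hy hw hy hw).intervalIntegrable (μ := volume)
  rw [← intervalIntegral.integral_const_mul, ← intervalIntegral.integral_const_mul,
    ← intervalIntegral.integral_add hxx (hxy.const_mul _),
    ← intervalIntegral.integral_add (hxx.add (hxy.const_mul _)) (hyy.const_mul _)]
  exact intervalIntegral.integral_congr fun s hs => (hr s hs).form_add_smul _ _ _ _ ε

lemma quadCost_add_smul (hab : a ≤ b) (hc : S.Cont (Icc a b))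
    (hr : ∀ s ∈ Icc a b, S.RegularAt C s) (hG : ∀ y z, ⟪G y, z⟫_ℝ = ⟪y, G z⟫_ℝ)
    (hx : ContinuousOn x (Icc a b)) (hu : ContinuousOn u (Icc a b))
    (hy : ContinuousOn y (Icc a b)) (hw : ContinuousOn w (Icc a b)) (ε : ℝ) :
    S.quadCost a b G g (fun t => x t + ε • y t) (fun t => u t + ε • w t)
      = S.quadCost a b G g x u
        + ε * ((∫ t in a..b, S.form t (x t) (u t) (y t) (w t)) + ⟪G (x b) - g, y b⟫_ℝ)
        + ε ^ 2 * S.quadCost a b G 0 y w := by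
  have hcross : ⟪y b, G (x b)⟫_ℝ = ⟪x b, G (y b)⟫_ℝ := by rw [← hG, real_inner_comm]
  simp only [quadCost, integral_form_add_smul hab hc hr hx hu hy hw, map_add, map_smul,
    inner_add_left, inner_add_right, inner_smul_left, inner_smul_right, inner_sub_left,
    inner_zero_right, RCLike.conj_to_real, hG (x b) (y b), hcross, real_inner_comm (y b) g]
  ring

variable [CompleteSpace E] [CompleteSpace U]

lemma IsAdjoint.integral_form_add_inner (hl : S.IsAdjoint a b x u l) (hab : a ≤ b)
    (hc : S.Cont (Icc a b)) (hr : ∀ s ∈ Icc a b, S.RegularAt C s) (hx : ContinuousOn x (Icc a b))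
    (hu : ContinuousOn u (Icc a b)) (hy : S.IsTraj a b y w) (hya : y a = 0)
    (hw : ContinuousOn w (Icc a b)) :
    (∫ s in a..b, S.form s (x s) (u s) (y s) (w s)) + ⟪l b, y b⟫_ℝ
      = ∫ s in a..b, ⟪w s, S.R s (u s) + S.H s (x s) + (S.B s).adjoint (l s)⟫_ℝ := by
  have hform := hc.form hx hu hy.continuousOn hw
  have hresidual : ContinuousOn
      (fun s => ⟪w s, S.R s (u s) + S.H s (x s) + (S.B s).adjoint (l s)⟫_ℝ) (Icc a b) :=
    hw.inner (((hc.R.clm_apply hu).add (hc.H.clm_apply hx)).add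
      ((ContinuousLinearMap.adjoint.continuous.comp_continuousOn hc.B).clm_apply
        fun s hs => (hl s hs).continuousWithinAt))
  have hpair := integral_eq_sub_of_hasDerivWithinAt_Icc (hresidual.sub hform)
    (hl.hasDerivWithinAt_inner hr hy) (right_mem_Icc.2 hab)
  rw [← uIcc_of_le hab] at hform hresidual
  simp only [Pi.sub_apply] at hpair
  rw [intervalIntegral.integral_sub hresidual.intervalIntegrable hform.intervalIntegrable, hya,
    inner_zero_right, sub_zero] at hpair
  linarith

theorem isHam_of_optimal (hab : a < b) (hc : S.Cont (Icc a b))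
    (hr : ∀ s ∈ Icc a b, S.RegularAt C s) (hG : ∀ y z, ⟪G y, z⟫_ℝ = ⟪y, G z⟫_ℝ)
    (hu : ContinuousOn u (Icc a b)) (hx : S.IsTraj a b x u) (hl : S.IsAdjoint a b x u l)
    (hlb : l b = G (x b) - g)
    (hopt : ∀ y w, ContinuousOn w (Icc a b) → S.IsTraj a b y w → y a = 0 → ∀ ε : ℝ,
      S.quadCost a b G g x u
        ≤ S.quadCost a b G g (fun t => x t + ε • y t) (fun t => u t + ε • w t)) :
    S.IsHam a b x u l := by
  refine ⟨hx, hl, ?_⟩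
  have hlc : ContinuousOn l (Icc a b) := fun s hs => (hl s hs).continuousWithinAt
  -- The residual of the stationarity condition is itself the direction of steepest descent.
  set w : ℝ → U := fun s => S.R s (u s) + S.H s (x s) + (S.B s).adjoint (l s)
  have hw : ContinuousOn w (Icc a b) :=
    ((hc.R.clm_apply hu).add (hc.H.clm_apply hx.continuousOn)).add
      ((ContinuousLinearMap.adjoint.continuous.comp_continuousOn hc.B).clm_apply hlc)
  obtain ⟨y, hya, hy⟩ := exists_linear_solution hab.le hc.A (hc.B.clm_apply hw) 0
  have hzero : ∫ s in a..b, ⟪w s, w s⟫_ℝ = 0 :=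
    eq_zero_of_forall_nonneg_quadratic (q := S.quadCost a b G 0 y w) fun ε => by
      have hmin := hopt y w hw hy hya ε
      rw [quadCost_add_smul hab.le hc hr hG hx.continuousOn hu (IsTraj.continuousOn hy) hw, ← hlb,
        hl.integral_form_add_inner hab.le hc hr hx.continuousOn hu hy hya hw] at hmin
      linarith
  intro s hs
  by_contra hne
  exact (intervalIntegral.integral_pos hab (hw.inner hw) (fun _ _ => real_inner_self_nonneg)
    ⟨s, hs, real_inner_self_pos.2 hne⟩).ne' hzero

end LQOps

/-! ### From matrices to operators -/

section Matrices

variable {p q r : ℕ}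

/-- The operator of a matrix between Euclidean spaces; `mulV` as a continuous linear map. -/
def toCLM : Mat p q →L[ℝ] (Vec q →L[ℝ] Vec p) :=
  LinearMap.toContinuousLinearMap
    ((Matrix.toEuclideanLin (𝕜 := ℝ) (m := Fin p) (n := Fin q)).trans
      LinearMap.toContinuousLinearMap).toLinearMap

@[simp] lemma toCLM_apply (M : Mat p q) (v : Vec q) : toCLM M v = mulV M v := rfl

lemma norm_toCLM (M : Mat p q) : ‖toCLM M‖ = ‖M‖ := (Matrix.l2_opNorm_def M).symm

lemma toCLM_mul (M : Mat p q) (N : Mat q r) : toCLM (M * N) = toCLM M ∘L toCLM N := by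
  ext v : 1
  simp [mulV, Matrix.toLpLin_apply]

lemma toCLM_one : toCLM (1 : Mat p p) = 1 := by
  ext v : 1
  simp [mulV]

lemma toCLM_transpose (M : Mat p q) : toCLM Mᵀ = (toCLM M).adjoint := by
  refine (ContinuousLinearMap.eq_adjoint_iff _ _).2 fun v w => ?_
  rw [toCLM_apply, toCLM_apply, mulV, mulV, ← Matrix.conjTranspose_eq_transpose_of_trivial,
    Matrix.toEuclideanLin_conjTranspose_eq_adjoint, LinearMap.adjoint_inner_left]

lemma inner_toCLM_left_eq_right {M : Mat p p} (hM : M.IsHermitian) (v w : Vec p) :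
    ⟪toCLM M v, w⟫_ℝ = ⟪v, toCLM M w⟫_ℝ := by
  have hsymm : Mᵀ = M := (Matrix.conjTranspose_eq_transpose_of_trivial M).symm.trans hM
  rw [← ContinuousLinearMap.adjoint_inner_left, ← toCLM_transpose, hsymm]

lemma inner_toCLM_mono {M N : Mat p p} (h : M ≤ N) (v : Vec p) :
    ⟪v, toCLM M v⟫_ℝ ≤ ⟪v, toCLM N v⟫_ℝ := by
  have hdiff := (Matrix.isPositive_toEuclideanLin_iff.2 (Matrix.le_iff.1 h)).re_inner_nonneg_right v
  rwa [map_sub, LinearMap.sub_apply, inner_sub_right, RCLike.re_to_real, sub_nonneg] at hdiff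

lemma inner_toCLM_smul_one (c : ℝ) (v : Vec p) :
    ⟪v, toCLM (c • (1 : Mat p p)) v⟫_ℝ = c * ‖v‖ ^ 2 := by
  rw [map_smul, toCLM_one, smul_apply, inner_smul_right, one_apply_eq_self,
    real_inner_self_eq_norm_sq]

lemma mul_norm_sq_le_inner_toCLM {M : Mat p p} {c : ℝ} (h : c • (1 : Mat p p) ≤ M) (v : Vec p) :
    c * ‖v‖ ^ 2 ≤ ⟪v, toCLM M v⟫_ℝ :=
  (inner_toCLM_smul_one c v).symm.trans_le (inner_toCLM_mono h v)

lemma inner_toCLM_le_mul_norm_sq {M : Mat p p} {c : ℝ} (h : M ≤ c • (1 : Mat p p)) (v : Vec p) :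
    ⟪v, toCLM M v⟫_ℝ ≤ c * ‖v‖ ^ 2 :=
  (inner_toCLM_mono h v).trans_eq (inner_toCLM_smul_one c v)

lemma isHermitian_of_smul_one_le {M : Mat p p} {c : ℝ} (h : c • (1 : Mat p p) ≤ M) :
    M.IsHermitian := by
  have hone : (c • (1 : Mat p p)).IsHermitian := Matrix.isHermitian_one.smul (.all c)
  simpa only [sub_add_cancel] using (Matrix.le_iff.1 h).isHermitian.add hone

lemma posDef_of_smul_one_le {M : Mat p p} {c : ℝ} (hc : 0 < c) (h : c • (1 : Mat p p) ≤ M) :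
    M.PosDef := by
  simpa only [add_sub_cancel] using
    (Matrix.PosDef.one.smul hc).add_posSemidef (Matrix.le_iff.1 h)

lemma toCLM_mul_inv_apply {M : Mat p p} (hM : IsUnit M) (v : Vec p) :
    toCLM M (toCLM M⁻¹ v) = v := by
  rw [← ContinuousLinearMap.comp_apply, ← toCLM_mul,
    Matrix.mul_nonsing_inv _ ((Matrix.isUnit_iff_isUnit_det _).1 hM), toCLM_one,
    one_apply_eq_self]

lemma toCLM_inv_mul_apply {M : Mat p p} (hM : IsUnit M) (v : Vec p) :
    toCLM M⁻¹ (toCLM M v) = v := by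
  rw [← ContinuousLinearMap.comp_apply, ← toCLM_mul,
    Matrix.nonsing_inv_mul _ ((Matrix.isUnit_iff_isUnit_det _).1 hM), toCLM_one,
    one_apply_eq_self]

lemma norm_toCLM_inv_apply_le {M : Mat p p} {c : ℝ} (hc : 0 < c) (h : c • (1 : Mat p p) ≤ M)
    (v : Vec p) : ‖toCLM M⁻¹ v‖ ≤ ‖v‖ / c :=
  norm_le_div_of_mul_norm_sq_le_inner hc ((mul_norm_sq_le_inner_toCLM h _).trans_eq
    (by rw [toCLM_mul_inv_apply (posDef_of_smul_one_le hc h).isUnit]))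

lemma continuousOn_matrix_inv {f : ℝ → Mat p p} {s : Set ℝ} (hf : ContinuousOn f s)
    (hunit : ∀ t ∈ s, IsUnit (f t)) : ContinuousOn (fun t => (f t)⁻¹) s := by
  intro t ht
  obtain ⟨v, hv⟩ := hunit t ht
  have hinv : ContinuousAt Ring.inverse (f t) := hv ▸ NormedRing.inverse_continuousAt v
  simp only [Matrix.nonsing_inv_eq_ringInverse]
  exact hinv.comp_continuousWithinAt (hf t ht)

lemma continuousOn_matrix_mul {f : ℝ → Mat p q} {g : ℝ → Mat q r} {s : Set ℝ}
    (hf : ContinuousOn f s) (hg : ContinuousOn g s) : ContinuousOn (fun t => f t * g t) s := by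
  rw [continuousOn_iff_continuous_domRestrict] at hf hg ⊢
  exact hf.matrix_mul hg

lemma continuousOn_matrix_transpose {f : ℝ → Mat p q} {s : Set ℝ} (hf : ContinuousOn f s) :
    ContinuousOn (fun t => (f t)ᵀ) s :=
  continuous_id.matrix_transpose.comp_continuousOn hf

end Matrices

namespace LQData

variable {nx nu : ℕ} {D : LQData nx nu} {T t : ℝ} {C : Constants}

/-- The operators of a linear-quadratic problem given by matrices. -/
def ops (D : LQData nx nu) : LQOps (Vec nx) (Vec nu) where
  A t := toCLM (D.A t)
  B t := toCLM (D.B t)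
  Q t := toCLM (D.Q t)
  H t := toCLM (D.H t)
  R t := toCLM (D.R t)
  Ri t := toCLM (D.R t)⁻¹

lemma Coercive.isUnit_R (hco : D.Coercive T C) (hC : C.Positive) (ht : t ∈ Icc 0 T) :
    IsUnit (D.R t) :=
  (posDef_of_smul_one_le hC.gR (hco.R_lower t ht)).isUnit

lemma Coercive.smul_one_le_Q (hco : D.Coercive T C) (hC : C.Positive) (ht : t ∈ Icc 0 T) :
    C.gQ • (1 : Mat nx nx) ≤ D.Q t := by
  refine (hco.Q_lower t ht).trans ?_
  have hcross := (posDef_of_smul_one_le hC.gR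
    (hco.R_lower t ht)).inv.posSemidef.conjTranspose_mul_mul_same (D.H t)
  rwa [Matrix.le_iff, sub_sub_cancel, ← Matrix.conjTranspose_eq_transpose_of_trivial]

lemma ops_cont (hC : C.Positive) (hb : D.Bounded T C) (hco : D.Coercive T C) :
    D.ops.Cont (Icc 0 T) where
  A := toCLM.continuous.comp_continuousOn hb.contA
  B := toCLM.continuous.comp_continuousOn hb.contB
  Q := toCLM.continuous.comp_continuousOn hb.contQ
  H := toCLM.continuous.comp_continuousOn hb.contH
  R := toCLM.continuous.comp_continuousOn hb.contR
  Ri := toCLM.continuous.comp_continuousOn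
    (continuousOn_matrix_inv hb.contR fun _ ht => hco.isUnit_R hC ht)

lemma ops_regularAt (hC : C.Positive) (hb : D.Bounded T C) (hco : D.Coercive T C)
    (ht : t ∈ Icc 0 T) : D.ops.RegularAt C t where
  boundA := (norm_toCLM _).trans_le (hb.boundA t ht)
  boundB := (norm_toCLM _).trans_le (hb.boundB t ht)
  boundQ := (norm_toCLM _).trans_le (hb.boundQ t ht)
  boundH := (norm_toCLM _).trans_le (hb.boundH t ht)
  boundR := (norm_toCLM _).trans_le (hb.boundR t ht)
  symmQ := inner_toCLM_left_eq_right (isHermitian_of_smul_one_le (hco.smul_one_le_Q hC ht))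
  symmR := inner_toCLM_left_eq_right (isHermitian_of_smul_one_le (hco.R_lower t ht))
  R_Ri := toCLM_mul_inv_apply (hco.isUnit_R hC ht)
  Ri_R := toCLM_inv_mul_apply (hco.isUnit_R hC ht)
  R_lower := mul_norm_sq_le_inner_toCLM (hco.R_lower t ht)
  Q_lower x := by
    have hlower := mul_norm_sq_le_inner_toCLM (hco.Q_lower t ht) x
    rwa [map_sub, sub_apply, inner_sub_right, toCLM_mul, toCLM_mul, toCLM_transpose,
      ContinuousLinearMap.comp_apply, ContinuousLinearMap.comp_apply,
      ContinuousLinearMap.adjoint_inner_right] at hlower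

lemma isWeight_Q (hC : C.Positive) (hb : D.Bounded T C) (hco : D.Coercive T C)
    (ht : t ∈ Icc 0 T) : IsWeight C (toCLM (D.Q t)) where
  symm := (ops_regularAt hC hb hco ht).symmQ
  lower := mul_norm_sq_le_inner_toCLM (hco.smul_one_le_Q hC ht)
  upper := inner_apply_le_of_norm_le (ops_regularAt hC hb hco ht).boundQ

lemma Coercive.isWeight_QT (hco : D.Coercive T C) : IsWeight C (toCLM D.QT) where
  symm := inner_toCLM_left_eq_right (isHermitian_of_smul_one_le hco.QT_lower)
  lower := mul_norm_sq_le_inner_toCLM hco.QT_lower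
  upper := inner_toCLM_le_mul_norm_sq hco.QT_upper

end LQData

/-! ### The evolution operator and the controllability Gramian -/

section Evolution

variable {nx nu : ℕ} {A : ℝ → Mat nx nx} {B : ℝ → Mat nx nu} {T s t t₁ : ℝ}

lemma exists_fundamental_matrix (hT : 0 ≤ T) (hA : ContinuousOn A (Icc 0 T)) :
    ∃ F N : ℝ → Mat nx nx, (∀ t ∈ Icc 0 T, HasDerivWithinAt F (A t * F t) (Icc 0 T) t) ∧
      (∀ t ∈ Icc 0 T, HasDerivWithinAt N (-(N t * A t)) (Icc 0 T) t) ∧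
      ∀ t ∈ Icc 0 T, F t * N t = 1 := by
  obtain ⟨F, hF₀, hF⟩ : ∃ F : ℝ → Mat nx nx, F 0 = 1 ∧
      ∀ t ∈ Icc 0 T, HasDerivWithinAt F (A t * F t) (Icc 0 T) t :=
    exists_homogeneous_linear_solution hT
      ((ContinuousLinearMap.mul ℝ (Mat nx nx)).continuous.comp_continuousOn hA) 1
  obtain ⟨N, hN₀, hN⟩ : ∃ N : ℝ → Mat nx nx, N 0 = 1 ∧
      ∀ t ∈ Icc 0 T, HasDerivWithinAt N (-(N t * A t)) (Icc 0 T) t :=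
    exists_homogeneous_linear_solution hT
      ((ContinuousLinearMap.mul ℝ (Mat nx nx)).flip.continuous.comp_continuousOn hA).neg 1
  refine ⟨F, N, hF, hN, fun t ht => mul_eq_one_comm.1 ?_⟩
  have hconst := eq_of_hasDerivWithinAt_zero (f := fun t => N t * F t) (fun s hs => by
    convert! (hN s hs).mul (hF s hs) using 1
    noncomm_ring) ht (left_mem_Icc.2 hT)
  simpa only [hF₀, hN₀, mul_one] using hconst

lemma isEvolution_evolution (hT : 0 ≤ T) (hA : ContinuousOn A (Icc 0 T)) :
    IsEvolution A T (evolution A T) := by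
  obtain ⟨F, N, hF, -, hFN⟩ := exists_fundamental_matrix hT hA
  exact Classical.epsilon_spec (p := IsEvolution A T) ⟨fun t s => F t * N s, fun s hs =>
    ⟨hFN s hs, fun t ht => by simpa only [mul_assoc] using (hF t ht).mul_const (N s)⟩⟩

lemma exists_evolution_eq_mul (hT : 0 ≤ T) (hA : ContinuousOn A (Icc 0 T)) :
    ∃ F N : ℝ → Mat nx nx, (∀ t ∈ Icc 0 T, HasDerivWithinAt N (-(N t * A t)) (Icc 0 T) t) ∧
      (∀ t ∈ Icc 0 T, F t * N t = 1) ∧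
      ∀ t ∈ Icc 0 T, ∀ s ∈ Icc 0 T, evolution A T t s = F t * N s := by
  obtain ⟨F, N, -, hN, hFN⟩ := exists_fundamental_matrix hT hA
  refine ⟨F, N, hN, hFN, fun t ht s hs => ?_⟩
  obtain ⟨hinit, hderiv⟩ := isEvolution_evolution hT hA s hs
  have hconst := eq_of_hasDerivWithinAt_zero (f := fun r => N r * evolution A T r s)
    (fun r hr => by
      convert! (hN r hr).mul (hderiv r hr) using 1
      noncomm_ring) ht hs
  simp only [hinit, mul_one] at hconst
  rw [← hconst, ← mul_assoc, hFN t ht, one_mul]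

lemma evolution_mul_evolution_swap (hA : ContinuousOn A (Icc 0 T)) (hs : s ∈ Icc 0 T)
    (ht : t ∈ Icc 0 T) : evolution A T s t * evolution A T t s = 1 := by
  obtain ⟨F, N, -, hFN, heq⟩ := exists_evolution_eq_mul (hs.1.trans hs.2) hA
  rw [heq s hs t ht, heq t ht s hs, mul_assoc, ← mul_assoc (N t),
    mul_eq_one_comm.1 (hFN t ht), one_mul, hFN s hs]

lemma hasDerivWithinAt_evolution_right (hA : ContinuousOn A (Icc 0 T)) (ht : t ∈ Icc 0 T)
    (hs : s ∈ Icc 0 T) :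
    HasDerivWithinAt (evolution A T t) (-(evolution A T t s * A s)) (Icc 0 T) s := by
  obtain ⟨F, N, hN, -, heq⟩ := exists_evolution_eq_mul (ht.1.trans ht.2) hA
  have hmul := (hN s hs).const_mul (F t)
  rw [mul_neg, ← mul_assoc, ← heq t ht s hs] at hmul
  exact hmul.congr (heq t ht) (heq t ht s hs)

lemma hasDerivWithinAt_gramian (hA : ContinuousOn A (Icc 0 T)) (hB : ContinuousOn B (Icc 0 T))
    (hsub : Icc t t₁ ⊆ Icc 0 T) (hs : s ∈ Icc t t₁) :
    HasDerivWithinAt (gramian A B T t)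
      (evolution A T t s * B s * (B s)ᵀ * (evolution A T t s)ᵀ) (Icc t t₁) s := by
  have ht := hsub (left_mem_Icc.2 (hs.1.trans hs.2))
  have hΦ : ContinuousOn (evolution A T t) (Icc t t₁) := fun r hr =>
    ((hasDerivWithinAt_evolution_right hA ht (hsub hr)).mono hsub).continuousWithinAt
  have hB' := hB.mono hsub
  exact hasDerivWithinAt_integral (continuousOn_matrix_mul
    (continuousOn_matrix_mul (continuousOn_matrix_mul hΦ hB') (continuousOn_matrix_transpose hB'))
    (continuousOn_matrix_transpose hΦ)) hs

end Evolution

namespace LQData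

variable {nx nu : ℕ} {D : LQData nx nu} {T t t₁ : ℝ} {C : Constants}

lemma isSteering_evolution (hA : ContinuousOn D.A (Icc 0 T)) (hB : ContinuousOn D.B (Icc 0 T))
    (htt₁ : t ≤ t₁) (hsub : Icc t t₁ ⊆ Icc 0 T) :
    D.ops.IsSteering t t₁ (fun s => toCLM (evolution D.A T s t))
      (fun s => toCLM (evolution D.A T t s))
      (fun s => toCLM (gramian D.A D.B T t t₁ - gramian D.A D.B T t s)) := by
  have ht := hsub (left_mem_Icc.2 htt₁)
  have hevol := isEvolution_evolution (ht.1.trans ht.2) hA t ht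
  refine ⟨htt₁, fun s hs => ?_, fun s hs => ?_, fun s hs => ?_, ?_, ?_, fun s hs => ?_, ?_⟩
  · have hderiv := toCLM.hasFDerivAt.comp_hasDerivWithinAt s ((hevol.2 s (hsub hs)).mono hsub)
    rwa [toCLM_mul] at hderiv
  · have hderiv := toCLM.hasFDerivAt.comp_hasDerivWithinAt s
      ((hasDerivWithinAt_evolution_right hA ht (hsub hs)).mono hsub)
    rwa [map_neg, toCLM_mul] at hderiv
  · exact (toCLM_mul _ _).symm.trans
      (by rw [evolution_mul_evolution_swap hA (hsub hs) ht, toCLM_one])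
  · rw [hevol.1, toCLM_one]
  · rw [hevol.1, toCLM_one]
  · have hderiv := toCLM.hasFDerivAt.comp_hasDerivWithinAt s
      ((hasDerivWithinAt_gramian hA hB hsub hs).const_sub (gramian D.A D.B T t t₁))
    rw [map_neg, toCLM_mul, toCLM_mul, toCLM_mul, toCLM_transpose, toCLM_transpose] at hderiv
    exact hderiv
  · rw [sub_self, map_zero]

/-- The part of uniform complete controllability on which the convergence rate rests: two-sided
bounds for the Gramians themselves, without those for their transports. -/
def GramianBounds (D : LQData nx nu) (T : ℝ) (C : Constants) : Prop :=
  ∀ t₀ ∈ Icc 0 (T - C.σ), ∃ t₁ ∈ Icc t₀ (t₀ + C.σ),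
    C.α₀ • (1 : Mat nx nx) ≤ gramian D.A D.B T t₀ t₁ ∧
    gramian D.A D.B T t₀ t₁ ≤ C.α₁ • (1 : Mat nx nx)

lemma UCC.gramianBounds (h : D.UCC T C) : D.GramianBounds T C := fun t₀ ht₀ =>
  let ⟨t₁, ht₁, hlower, hupper, _⟩ := h t₀ ht₀
  ⟨t₁, ht₁, hlower, hupper⟩

lemma steersToZero (hC : C.Positive) (hb : D.Bounded T C) (hco : D.Coercive T C)
    (hgram : D.GramianBounds T C) (ht : 0 ≤ t) (htT : t + C.σ ≤ T) :
    D.ops.SteersToZero C t := by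
  obtain ⟨t₁, ht₁, hlower, hupper⟩ := hgram t ⟨ht, le_sub_iff_add_le.2 htT⟩
  have hsub : Icc t t₁ ⊆ Icc 0 T := Icc_subset_Icc ht (ht₁.2.trans htT)
  have hzero : gramian D.A D.B T t t = 0 := intervalIntegral.integral_same
  refine (isSteering_evolution hb.contA hb.contB ht₁.1 hsub).steersToZero hC ht₁.2
    (fun s hs => ops_regularAt hC hb hco (hsub hs)) (fun ξ => ?_) fun ξ => ?_
  · simpa only [hzero, sub_zero, real_inner_comm] using mul_norm_sq_le_inner_toCLM hlower ξ
  · simpa only [hzero, sub_zero, real_inner_comm] using inner_toCLM_le_mul_norm_sq hupper ξ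

end LQData

/-! ### Solutions satisfy the optimality system -/

/-- The terminal cost `½ yᵀ G y - yᵀ G q`, of which those of the full problem and of the
subproblems are instances. -/
def quadTerminal {n : ℕ} (G : Mat n n) (q y : Vec n) : ℝ := (1 / 2) * bil y G y - bil y G q

lemma quadTerminal_zero {n : ℕ} (G : Mat n n) :
    quadTerminal G 0 = fun y => (1 / 2) * bil y G y := by
  funext y
  have hzero : bil y G 0 = 0 := by rw [bil, mulV, map_zero, inner_zero_right]
  rw [quadTerminal, hzero, sub_zero]

lemma gradient_quadTerminal {n : ℕ} {G : Mat n n} (hG : G.IsHermitian) (q y : Vec n) :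
    gradient (quadTerminal G q) y = toCLM G y - toCLM G q := by
  refine (hasGradientAt_iff_hasFDerivAt.2 ?_).gradient
  have hderiv : HasFDerivAt (fun y : Vec n => (1 / 2) * ⟪y, toCLM G y⟫_ℝ - ⟪y, toCLM G q⟫_ℝ) _ y :=
    (((hasFDerivAt_id y).inner ℝ (toCLM G).hasFDerivAt).const_mul (1 / 2)).sub
      ((hasFDerivAt_id y).inner ℝ (hasFDerivAt_const (toCLM G q) y))
  refine hderiv.congr_fderiv ?_
  ext v
  simp only [sub_apply, smul_apply, ContinuousLinearMap.comp_apply, ContinuousLinearMap.prod_apply,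
    fderivInnerCLM_apply, InnerProductSpace.toDual_apply_apply, inner_sub_left, smul_eq_mul, id_eq,
    ContinuousLinearMap.id_apply, zero_apply, inner_zero_right, zero_add,
    ← inner_toCLM_left_eq_right hG y v, real_inner_comm _ v]
  ring

namespace LQData

variable {nx nu : ℕ} {D : LQData nx nu} {C : Constants} {a b : ℝ} {p q : Vec nx} {G : Mat nx nx}
  {L : Vec nx → ℝ} {x : ℝ → Vec nx} {u : ℝ → Vec nu} {z : Trajectory nx nu}

lemma stage_eq_form (t : ℝ) (x : Vec nx) (u : Vec nu) :
    D.stage t x u = D.ops.form t x u x u := by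
  have hcross : bil x (D.H t)ᵀ u = ⟪u, toCLM (D.H t) x⟫_ℝ := by
    change ⟪x, toCLM (D.H t)ᵀ u⟫_ℝ = _
    rw [toCLM_transpose, ContinuousLinearMap.adjoint_inner_right, real_inner_comm]
  rw [stage, hcross]
  rfl

lemma cost_eq_quadCost (x : ℝ → Vec nx) (u : ℝ → Vec nu) :
    D.cost a b (quadTerminal G q) x u = D.ops.quadCost a b (toCLM G) (toCLM G q) x u := by
  simp only [cost, LQOps.quadCost, stage_eq_form]
  rfl

lemma Admissible.left_eq (h : D.Admissible a b p x u) (hab : a ≤ b) : x a = p := by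
  simpa only [intervalIntegral.integral_same, add_zero] using
    h.state_eq a (left_mem_Icc.2 hab)

lemma Admissible.isTraj (h : D.Admissible a b p x u) (hc : D.ops.Cont (Icc a b))
    (hu : ContinuousOn u (Icc a b)) : D.ops.IsTraj a b x u := fun _ hs =>
  ((hasDerivWithinAt_integral ((hc.A.clm_apply h.state_cont).add (hc.B.clm_apply hu))
    hs).const_add p).congr_of_mem h.state_eq hs

lemma admissible_of_isTraj (hc : D.ops.Cont (Icc a b)) (hu : ContinuousOn u (Icc a b))
    (hx : D.ops.IsTraj a b x u) : D.Admissible a b (x a) x u where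
  control_meas := hu.aestronglyMeasurable measurableSet_Icc
  control_bdd := isCompact_Icc.exists_bound_of_continuousOn hu
  state_cont := LQOps.IsTraj.continuousOn hx
  state_eq t ht := by
    have hint := integral_eq_sub_of_hasDerivWithinAt_Icc
      ((hc.A.clm_apply (LQOps.IsTraj.continuousOn hx)).add (hc.B.clm_apply hu)) hx ht
    exact (add_sub_cancel (x a) (x t)).symm.trans (congrArg (x a + ·) hint.symm)

lemma IsSolution.isAdjoint (h : D.IsSolution a b p L z) :
    D.ops.IsAdjoint a b z.x z.u z.lam := by
  intro s hs
  change HasDerivWithinAt z.lam (-(toCLM (D.A s)).adjoint (z.lam s) - toCLM (D.Q s) (z.x s)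
    - (toCLM (D.H s)).adjoint (z.u s)) (Icc a b) s
  rw [← toCLM_transpose, ← toCLM_transpose]
  exact h.adjoint_eq s hs

lemma IsSolution.adjoint_end_eq (h : D.IsSolution a b p (quadTerminal G q) z)
    (hG : G.IsHermitian) : z.lam b = toCLM G (z.x b) - toCLM G q := by
  rw [h.adjoint_end, gradient_quadTerminal hG]

theorem IsSolution.isHam (h : D.IsSolution a b p (quadTerminal G q) z) (hab : a < b)
    (hc : D.ops.Cont (Icc a b)) (hr : ∀ s ∈ Icc a b, D.ops.RegularAt C s) (hG : G.IsHermitian) :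
    D.ops.IsHam a b z.x z.u z.lam := by
  have htraj := h.admissible.isTraj hc h.control_cont
  refine LQOps.isHam_of_optimal hab hc hr (inner_toCLM_left_eq_right hG) h.control_cont htraj
    h.isAdjoint (h.adjoint_end_eq hG) fun y w hw hy hya ε => ?_
  have hperturbed : D.ops.IsTraj a b (fun t => z.x t + ε • y t) (fun t => z.u t + ε • w t) :=
    htraj.add_smul hy ε
  have hadm := admissible_of_isTraj hc (h.control_cont.add (hw.const_smul ε)) hperturbed
  rw [hya, smul_zero, add_zero, h.admissible.left_eq hab.le] at hadm
  rw [← cost_eq_quadCost, ← cost_eq_quadCost]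
  exact h.optimal _ _ hadm

end LQData

/-! ### The overlapping decomposition -/

namespace Decomposition

variable {T t : ℝ} {m : ℕ} (P : Decomposition T m) {j : Fin m}

lemma t_nonneg (i : Fin (m + 1)) : 0 ≤ P.t i :=
  P.t_first.ge.trans (P.t_mono.monotone (Fin.zero_le i))

lemma t_le (i : Fin (m + 1)) : P.t i ≤ T :=
  (P.t_mono.monotone (Fin.le_last i)).trans_eq P.t_last

lemma τ_le (j : Fin m) : P.τ ≤ min (P.τ₀ j) (P.τ₁ j) :=
  ciInf_le (Set.finite_range _).bddBelow j

lemma left_nonneg (j : Fin m) : 0 ≤ P.left j := le_max_right _ _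

lemma right_le (j : Fin m) : P.right j ≤ T := min_le_right _ _

lemma left_le (j : Fin m) : P.left j ≤ P.t j.castSucc :=
  max_le (sub_le_self _ (P.τ₀_pos j).le) (P.t_nonneg _)

lemma le_right (j : Fin m) : P.t j.succ ≤ P.right j :=
  le_min (le_add_of_nonneg_right (P.τ₁_pos j).le) (P.t_le _)

lemma left_lt_right (j : Fin m) : P.left j < P.right j :=
  (P.left_le j).trans_lt ((P.t_mono Fin.castSucc_lt_succ).trans_le (P.le_right j))

lemma left_eq_zero_or_left_add_τ_le (j : Fin m) :
    P.left j = 0 ∨ P.left j + P.τ ≤ P.t j.castSucc := by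
  rcases le_total (P.t j.castSucc - P.τ₀ j) 0 with hclip | hclip
  · exact .inl (max_eq_right hclip)
  · rw [left, max_eq_left hclip]
    exact .inr (by linarith [(P.τ_le j).trans (min_le_left _ _)])

lemma add_τ_le_right (hfit : P.t j.succ + P.τ ≤ T) : P.t j.succ + P.τ ≤ P.right j :=
  le_min (by linarith [(P.τ_le j).trans (min_le_right _ _)]) hfit

lemma t_succ_of_last (hj : (j : ℕ) + 1 = m) : P.t j.succ = T :=
  (congrArg P.t (Fin.ext hj)).trans P.t_last

lemma right_of_last (hj : (j : ℕ) + 1 = m) : P.right j = T :=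
  le_antisymm (P.right_le j) ((P.t_succ_of_last hj).ge.trans (P.le_right j))

lemma piece_subset (j : Fin m) : P.piece j ⊆ Icc (P.t j.castSucc) (P.t j.succ) := by
  unfold piece
  split_ifs
  exacts [subset_rfl, Ico_subset_Icc_self]

lemma exists_mem_piece (hT : 0 < T) (ht : t ∈ Icc 0 T) : ∃ j, t ∈ P.piece j := by
  by_contra! hnot
  have hlt : ∀ j : Fin m, P.t j.castSucc ≤ t → P.t j.succ ≤ t ∧ (j : ℕ) + 1 ≠ m := fun j hj => by
    have hpiece := hnot j
    unfold piece at hpiece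
    split_ifs at hpiece with hlast
    · exact absurd ⟨hj, ht.2.trans_eq (P.t_succ_of_last hlast).symm⟩ hpiece
    · exact ⟨not_lt.1 fun hlt => hpiece ⟨hj, hlt⟩, hlast⟩
  have hall : ∀ i, P.t i ≤ t :=
    Fin.induction (P.t_first.trans_le ht.1) fun j hj => (hlt j hj).1
  obtain _ | n := m
  · exact hT.ne (P.t_first.symm.trans P.t_last)
  · exact (hlt (Fin.last n) (hall _)).2 rfl

variable {E : Type*} [NormedAddCommGroup E] {f : ℝ → E} {ρ ω : ℝ}

lemma exp_mul_norm_left_le (hρ : 0 ≤ ρ) (hω : 0 ≤ ω) (hzero : f 0 = 0)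
    (hf : ‖f (P.left j)‖ ≤ ω) (ht : P.t j.castSucc ≤ t) :
    Real.exp (-ρ * (t - P.left j)) * ‖f (P.left j)‖ ≤ Real.exp (-ρ * P.τ) * ω := by
  rcases P.left_eq_zero_or_left_add_τ_le j with hleft | hleft
  · rw [hleft, hzero, norm_zero, mul_zero]
    positivity
  · have hexp : -ρ * (t - P.left j) ≤ -ρ * P.τ :=
      mul_le_mul_of_nonpos_left (by linarith) (neg_nonpos.2 hρ)
    gcongr

lemma exp_right_le (hρ : 0 ≤ ρ) (hfit : P.t j.succ + P.τ ≤ T) (ht : t ≤ P.t j.succ) :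
    Real.exp (-ρ * (P.right j - t)) ≤ Real.exp (-ρ * P.τ) :=
  Real.exp_le_exp.2
    (mul_le_mul_of_nonpos_left (by linarith [P.add_τ_le_right hfit]) (neg_nonpos.2 hρ))

end Decomposition

/-! ### One step of the iteration -/

section Error

variable {nx nu : ℕ} {T K t : ℝ} {z s : Trajectory nx nu}

/-- The pointwise error between two trajectories, in the norm underlying `omega`. -/
def Trajectory.errorAt (z s : Trajectory nx nu) (t : ℝ) : ℝ :=
  max (max ‖z.x t - s.x t‖ ‖z.u t - s.u t‖) ‖z.lam t - s.lam t‖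

lemma supNorm_le_ofReal {n : ℕ} {f : ℝ → Vec n} (h : ∀ t ∈ Icc 0 T, ‖f t‖ ≤ K) :
    supNorm T f ≤ ENNReal.ofReal K :=
  iSup₂_le fun t ht => (ofReal_norm (f t)).symm.trans_le (ENNReal.ofReal_le_ofReal (h t ht))

lemma norm_le_toReal_of_supNorm_le {n : ℕ} {f : ℝ → Vec n} {ω : ℝ≥0∞} (hω : ω ≠ ∞)
    (h : supNorm T f ≤ ω) (ht : t ∈ Icc 0 T) : ‖f t‖ ≤ ω.toReal := by
  have henorm : ‖f t‖ₑ ≤ ω := (le_iSup₂ (f := fun t (_ : t ∈ Icc 0 T) => ‖f t‖ₑ) t ht).trans h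
  simpa only [toReal_enorm] using ENNReal.toReal_mono hω henorm

lemma omega_le_ofReal (h : ∀ t ∈ Icc 0 T, z.errorAt s t ≤ K) :
    omega T z s ≤ ENNReal.ofReal K :=
  max_le (supNorm_le_ofReal fun t ht => (max_le_iff.1 (max_le_iff.1 (h t ht)).1).1)
    (max_le (supNorm_le_ofReal fun t ht => (max_le_iff.1 (max_le_iff.1 (h t ht)).1).2)
      (supNorm_le_ofReal fun t ht => (max_le_iff.1 (h t ht)).2))

lemma errorAt_le_toReal_omega (hω : omega T z s ≠ ∞) (ht : t ∈ Icc 0 T) :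
    z.errorAt s t ≤ (omega T z s).toReal := by
  have hx : ‖z.x t - s.x t‖ ≤ (omega T z s).toReal :=
    norm_le_toReal_of_supNorm_le (f := fun t => z.x t - s.x t) hω (le_max_left _ _) ht
  have hu : ‖z.u t - s.u t‖ ≤ (omega T z s).toReal :=
    norm_le_toReal_of_supNorm_le (f := fun t => z.u t - s.u t) hω
      ((le_max_left _ _).trans (le_max_right _ _)) ht
  have hl : ‖z.lam t - s.lam t‖ ≤ (omega T z s).toReal :=
    norm_le_toReal_of_supNorm_le (f := fun t => z.lam t - s.lam t) hω
      ((le_max_right _ _).trans (le_max_right _ _)) ht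
  exact max_le (max_le hx hu) hl

end Error

namespace LQData

variable {nx nu m : ℕ} {D : LQData nx nu} {T a b t ω : ℝ} {C : Constants}
  {P : Decomposition T m} {x0 p q : Vec nx} {G : Mat nx nx} {cur next z s : Trajectory nx nu}

lemma problem (hC : C.Positive) (hb : D.Bounded T C) (hgram : D.GramianBounds T C)
    (hco : D.Coercive T C) (ha : 0 ≤ a) (hab : a ≤ b) (hbT : b ≤ T)
    {G : Vec nx →L[ℝ] Vec nx} (hG : IsWeight C G) : D.ops.Problem C a b G where
  pos := hC
  le := hab
  cont := (ops_cont hC hb hco).mono (Icc_subset_Icc ha hbT)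
  reg _ hr := ops_regularAt hC hb hco ⟨ha.trans hr.1, hr.2.trans hbT⟩
  weight := hG
  steers _ hr hrb := steersToZero hC hb hco hgram (ha.trans hr.1) (hrb.trans hbT)

lemma IsSolution.errorAt_le (hz : D.IsSolution a b p (quadTerminal G q) z) (hab : a < b)
    (hG : G.IsHermitian) (hprob : D.ops.Problem C a b (toCLM G))
    (hs : D.ops.IsHam a b s.x s.u s.lam) {r : ℝ}
    (hr : ‖toCLM G (s.x b - q) - s.lam b‖ ≤ C.lQ * r) (ht : t ∈ Icc a b) :
    z.errorAt s t ≤ C.Λb * (Real.exp (-C.ρZ * (t - a)) * ‖p - s.x a‖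
      + Real.exp (-C.ρZ * (b - t)) * r) := by
  have hham := (hz.isHam hab hprob.cont hprob.reg hG).sub hs
  have hend : z.lam b - s.lam b
      = toCLM G (z.x b - s.x b) + (toCLM G (s.x b - q) - s.lam b) := by
    rw [hz.adjoint_end_eq hG, map_sub, map_sub]
    abel
  simpa only [Trajectory.errorAt, hz.admissible.left_eq hab.le] using
    hprob.norm_le_Λb_mul hham hend hr ht

lemma IsFullSolution.isSolution (hs : D.IsFullSolution T x0 s) :
    D.IsSolution 0 T x0 (quadTerminal D.QT 0) s := by
  rwa [quadTerminal_zero]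

lemma IsSubSolution.isSolution_of_last {j : Fin m} (hz : D.IsSubSolution P j p q z)
    (hj : (j : ℕ) + 1 = m) : D.IsSolution (P.left j) (P.right j) p (quadTerminal D.QT 0) z := by
  have hterminal : D.subTerminal P j q = quadTerminal D.QT 0 := by
    rw [quadTerminal_zero]
    funext y
    exact if_pos hj
  exact hterminal ▸ hz

lemma IsSubSolution.isSolution_of_not_last {j : Fin m} (hz : D.IsSubSolution P j p q z)
    (hj : (j : ℕ) + 1 ≠ m) :
    D.IsSolution (P.left j) (P.right j) p (quadTerminal (D.Q (P.right j)) q) z := by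
  have hterminal : D.subTerminal P j q = quadTerminal (D.Q (P.right j)) q :=
    funext fun y => if_neg hj
  exact hterminal ▸ hz

lemma norm_boundary_residual_le (hC : C.Positive) (hb : D.Bounded T C) (hco : D.Coercive T C)
    (ht : t ∈ Icc 0 T) (hω : cur.errorAt s t ≤ ω) :
    ‖toCLM (D.Q t) (s.x t - (cur.x t - mulV (D.Q t)⁻¹ (cur.lam t))) - s.lam t‖
      ≤ C.lQ * ((1 + 1 / C.gQ) * ω) := by
  have hQ := hco.smul_one_le_Q hC ht
  have hunit := (posDef_of_smul_one_le hC.gQ hQ).isUnit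
  obtain ⟨⟨hx, -⟩, hl⟩ : (‖cur.x t - s.x t‖ ≤ ω ∧ _) ∧ ‖cur.lam t - s.lam t‖ ≤ ω := by
    simpa only [Trajectory.errorAt, max_le_iff] using hω
  set v := toCLM (D.Q t)⁻¹ (cur.lam t - s.lam t) - (cur.x t - s.x t)
  have hresidual : toCLM (D.Q t) (s.x t - (cur.x t - mulV (D.Q t)⁻¹ (cur.lam t))) - s.lam t
      = toCLM (D.Q t) v := by
    simp only [v, ← toCLM_apply, map_sub, toCLM_mul_inv_apply hunit]
    abel
  have hv : ‖v‖ ≤ (1 + 1 / C.gQ) * ω :=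
    calc ‖v‖ ≤ ‖toCLM (D.Q t)⁻¹ (cur.lam t - s.lam t)‖ + ‖cur.x t - s.x t‖ := norm_sub_le _ _
      _ ≤ ω / C.gQ + ω := by
        have hgQ := hC.gQ
        gcongr
        exact (norm_toCLM_inv_apply_le hgQ hQ _).trans (by gcongr)
      _ = (1 + 1 / C.gQ) * ω := by ring
  rw [hresidual]
  exact (toCLM (D.Q t)).le_of_opNorm_le_of_le (ops_regularAt hC hb hco ht).boundQ hv

lemma IsFullSolution.isHam (hs : D.IsFullSolution T x0 s) (hC : C.Positive) (hT : 0 < T)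
    (hb : D.Bounded T C) (hco : D.Coercive T C) : D.ops.IsHam 0 T s.x s.u s.lam :=
  hs.isSolution.isHam hT (ops_cont hC hb hco) (fun _ => ops_regularAt hC hb hco)
    (isHermitian_of_smul_one_le hco.QT_lower)

lemma IsSubSolution.errorAt_le {j : Fin m} (hC : C.Positive) (hT : 0 < T)
    (hb : D.Bounded T C) (hgram : D.GramianBounds T C) (hco : D.Coercive T C)
    (hfit : (j : ℕ) + 1 < m → P.t j.succ + P.τ ≤ T) (hs : D.IsFullSolution T x0 s)
    (hω : ∀ t ∈ Icc 0 T, cur.errorAt s t ≤ ω)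
    (hz : D.IsSubSolution P j p
      (cur.x (P.right j) - mulV (D.Q (P.right j))⁻¹ (cur.lam (P.right j))) z)
    (htab : t ∈ Icc (P.left j) (P.right j)) (ht : t ≤ P.t j.succ) :
    z.errorAt s t ≤ C.Λb * (Real.exp (-C.ρZ * (t - P.left j)) * ‖p - s.x (P.left j)‖
      + Real.exp (-C.ρZ * P.τ) * ((1 + 1 / C.gQ) * ω)) := by
  have hab := P.left_lt_right j
  have ha := P.left_nonneg j
  have hbT := P.right_le j
  have hright : P.right j ∈ Icc 0 T := ⟨ha.trans hab.le, hbT⟩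
  have hham := (hs.isHam hC hT hb hco).mono (Icc_subset_Icc ha hbT)
  have hω₀ : 0 ≤ ω := (norm_nonneg _).trans ((le_max_right _ _).trans (hω _ hright))
  have hgQ := hC.gQ
  have hΛ := hC.Λb_pos
  by_cases hj : (j : ℕ) + 1 = m
  · have hresidual : ‖toCLM D.QT (s.x (P.right j) - 0) - s.lam (P.right j)‖ ≤ C.lQ * 0 := by
      have hend := hs.isSolution.adjoint_end_eq (isHermitian_of_smul_one_le hco.QT_lower)
      rw [P.right_of_last hj, hend, map_sub, sub_self, norm_zero, mul_zero]
    refine ((hz.isSolution_of_last hj).errorAt_le hab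
      (isHermitian_of_smul_one_le hco.QT_lower)
      (problem hC hb hgram hco ha hab.le hbT hco.isWeight_QT) hham hresidual htab).trans ?_
    rw [mul_zero]
    gcongr
    positivity
  · refine ((hz.isSolution_of_not_last hj).errorAt_le hab
      (isHermitian_of_smul_one_le (hco.smul_one_le_Q hC hright))
      (problem hC hb hgram hco ha hab.le hbT (isWeight_Q hC hb hco hright)) hham
      (norm_boundary_residual_le hC hb hco hright (hω _ hright)) htab).trans ?_
    gcongr C.Λb * (_ + ?_ * _)
    exact P.exp_right_le hC.ρZ_pos.le (hfit (lt_of_le_of_ne j.isLt hj)) ht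

lemma errorAt_le_of_mem_piece {j : Fin m} (hC : C.Positive) (hT : 0 < T)
    (hb : D.Bounded T C) (hgram : D.GramianBounds T C) (hco : D.Coercive T C)
    (hfit : (j : ℕ) + 1 < m → P.t j.succ + P.τ ≤ T) (hs : D.IsFullSolution T x0 s)
    (hcur₀ : cur.x 0 = x0) (hω : ∀ t ∈ Icc 0 T, cur.errorAt s t ≤ ω)
    (hz : D.IsSubSolution P j (cur.x (P.left j))
      (cur.x (P.right j) - mulV (D.Q (P.right j))⁻¹ (cur.lam (P.right j))) z)
    (ht : t ∈ P.piece j) :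
    z.errorAt s t ≤ 3 * C.c * Real.exp (-C.ρZ * P.τ) * ω := by
  obtain ⟨htl, htr⟩ := P.piece_subset j ht
  have htab : t ∈ Icc (P.left j) (P.right j) :=
    ⟨(P.left_le j).trans htl, htr.trans (P.le_right j)⟩
  have hleftT : P.left j ∈ Icc 0 T :=
    ⟨P.left_nonneg j, (P.left_lt_right j).le.trans (P.right_le j)⟩
  have hnorm : ‖cur.x (P.left j) - s.x (P.left j)‖ ≤ ω :=
    (le_max_left _ _).trans ((le_max_left _ _).trans (hω _ hleftT))
  have hω₀ : 0 ≤ ω := (norm_nonneg _).trans hnorm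
  have hzero : cur.x 0 - s.x 0 = 0 := by
    rw [hcur₀, hs.isSolution.admissible.left_eq hT.le, sub_self]
  have hleft := P.exp_mul_norm_left_le (f := fun t => cur.x t - s.x t) hC.ρZ_pos.le hω₀ hzero
    hnorm htl
  have hgQ := hC.gQ
  have hΛ := hC.Λb_pos
  calc z.errorAt s t
      ≤ C.Λb * (Real.exp (-C.ρZ * (t - P.left j)) * ‖cur.x (P.left j) - s.x (P.left j)‖
        + Real.exp (-C.ρZ * P.τ) * ((1 + 1 / C.gQ) * ω)) :=
        hz.errorAt_le hC hT hb hgram hco hfit hs hω htab htr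
    _ ≤ C.Λb * (Real.exp (-C.ρZ * P.τ) * ω
        + Real.exp (-C.ρZ * P.τ) * ((1 + 1 / C.gQ) * ω)) := by gcongr
    _ = C.Λb * (1 + (1 + 1 / C.gQ)) * (Real.exp (-C.ρZ * P.τ) * ω) := by ring
    _ ≤ C.Λb * (3 * (1 + 1 / C.gQ)) * (Real.exp (-C.ρZ * P.τ) * ω) := by
        have hinv : 0 < 1 / C.gQ := by positivity
        gcongr
        linarith
    _ = 3 * C.c * Real.exp (-C.ρZ * P.τ) * ω := by rw [Constants.c]; ring

lemma SchwarzStep.state_zero (h : D.SchwarzStep P cur next) (hT : 0 < T)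
    (hcur₀ : cur.x 0 = x0) : next.x 0 = x0 := by
  obtain ⟨j, hj⟩ := P.exists_mem_piece hT (left_mem_Icc.2 hT.le)
  obtain ⟨z, hz, hnext⟩ := h j
  have hleft : P.left j = 0 :=
    le_antisymm ((P.left_le j).trans (P.piece_subset j hj).1) (P.left_nonneg j)
  have hz₀ := Admissible.left_eq (IsSolution.admissible hz) (P.left_lt_right j).le
  rw [hleft, hcur₀] at hz₀
  exact (hnext 0 hj).1.trans hz₀

lemma IsSchwarzRun.state_zero {z : ℕ → Trajectory nx nu} (h : D.IsSchwarzRun P x0 z)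
    (hT : 0 < T) (k : ℕ) : (z k).x 0 = x0 := by
  induction k with
  | zero => exact h.init
  | succ k ih => exact (h.step k).state_zero hT ih

theorem SchwarzStep.omega_le (h : D.SchwarzStep P cur next) (hC : C.Positive) (hT : 0 < T)
    (hb : D.Bounded T C) (hgram : D.GramianBounds T C) (hco : D.Coercive T C)
    (hfit : ∀ j : Fin m, (j : ℕ) + 1 < m → P.t j.succ + P.τ ≤ T)
    (hs : D.IsFullSolution T x0 s) (hcur₀ : cur.x 0 = x0) :
    omega T next s ≤ ENNReal.ofReal (3 * C.c * Real.exp (-C.ρZ * P.τ)) * omega T cur s := by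
  have hc := hC.c_pos
  have hfactor : 0 < 3 * C.c * Real.exp (-C.ρZ * P.τ) := by positivity
  by_cases hω : omega T cur s = ∞
  · rw [hω, ENNReal.mul_top (ENNReal.ofReal_pos.2 hfactor).ne']
    exact le_top
  · rw [← ENNReal.ofReal_toReal hω, ← ENNReal.ofReal_mul hfactor.le]
    refine omega_le_ofReal fun t ht => ?_
    obtain ⟨j, hj⟩ := P.exists_mem_piece hT ht
    obtain ⟨z, hz, hnext⟩ := h j
    obtain ⟨hx, hu, hl⟩ := hnext t hj
    rw [Trajectory.errorAt, hx, hu, hl]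
    exact errorAt_le_of_mem_piece hC hT hb hgram hco (hfit j) hs hcur₀
      (fun t ht => errorAt_le_toReal_omega hω ht) hz hj

end LQData

end Schwarz

end

theorem mainTheorem1_general {nx nu m : ℕ} (C : Schwarz.Constants) (hC : C.Positive)
    (T : ℝ) (hT : 0 < T) (D : Schwarz.LQData nx nu)
    (hbdd : D.Bounded T C) (hgram : D.GramianBounds T C) (hcoer : D.Coercive T C)
    (P : Schwarz.Decomposition T m)
    (hfit : ∀ j : Fin m, (j : ℕ) + 1 < m → P.t j.succ + P.τ ≤ T)
    (x0 : Schwarz.Vec nx) (zs : Schwarz.Trajectory nx nu) (hzs : D.IsFullSolution T x0 zs)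
    (z : ℕ → Schwarz.Trajectory nx nu) (hz : D.IsSchwarzRun P x0 z) :
    0 < C.c ∧ 0 < C.ρZ ∧
    ∀ k : ℕ, Schwarz.omega T (z (k + 1)) zs ≤
      ENNReal.ofReal (3 * C.c * Real.exp (-C.ρZ * P.τ)) * Schwarz.omega T (z k) zs :=
  ⟨hC.c_pos, hC.ρZ_pos, fun k =>
    (hz.step k).omega_le hC hT hbdd hgram hcoer hfit hzs (hz.state_zero hT k)⟩

theorem mainTheorem1 {nx nu m : ℕ} (C : Schwarz.Constants) (hC : C.Positive)
    (T : ℝ) (hσT : C.σ < T) (D : Schwarz.LQData nx nu)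
    (hbdd : D.Bounded T C) (hucc : D.UCC T C) (hcoer : D.Coercive T C)
    (P : Schwarz.Decomposition T m)
    (hfit : ∀ j : Fin m, (j : ℕ) + 1 < m → P.t j.succ + P.τ ≤ T)
    (x0 : Schwarz.Vec nx) (zs : Schwarz.Trajectory nx nu) (hzs : D.IsFullSolution T x0 zs)
    (z : ℕ → Schwarz.Trajectory nx nu) (hz : D.IsSchwarzRun P x0 z) :
    0 < C.c ∧ 0 < C.ρZ ∧
    ∀ k : ℕ, Schwarz.omega T (z (k + 1)) zs ≤
      ENNReal.ofReal (3 * C.c * Real.exp (-C.ρZ * P.τ)) * Schwarz.omega T (z k) zs :=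
  mainTheorem1_general C hC T (hC.σ.trans hσT) D hbdd hucc.gramianBounds hcoer P hfit x0 zs hzs z hz
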